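/- Let $\mathbb T^2=\mathbb R^2/\mathbb Z^2$, $K=2\pi\mathbb Z^2\setminus\{0\}$, $e_k(x)=e^{i\langle k,x\rangle}$, and let $V$ be the Hilbert space of complex functions in $L^2(\mathbb T^2)$ with mean zero, with orthonormal basis $(e_k)_{k\in K}$. Let $\nu>0$ and $H\in(0,1)$. Let $(\alpha_k)_{k\in K}\subset[c,\infty)$ with $c>0$, $\alpha_{-k}=\alpha_k$ and $\alpha_k\to\infty$ as $|k|\to\infty$; let $(\lambda_k)_{k\in K}\subset[0,\infty)$ be bounded with $\lambda_{-k}=\lambda_k$. Let $Ae_k=-\alpha_ke_k$, $Q^{1/2}e_k=\sqrt{\lambda_k}\,e_k$, and let $S(t)=e^{t\nu A}$, i.e. $S(t)e_k=e^{-t\nu\alpha_k}e_k$. On a probability space $(\Omega,\mathcal F,\mathbb P)$ let $(\beta_k(t))_{t\in\mathbb R}$, $k\in K$, be complex fractional Brownian motions with Hurst parameter $H$: $\beta_k=(X_k+iY_k)/\sqrt2$, where $X_k,Y_k$ are independent real two-sided fractional Brownian motions (centred Gaussian processes, null at $0$, with a.s. continuous paths and covariance $\frac12(|t|^{2H}+|s|^{2H}-|t-s|^{2H})$);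 the $\beta_k$ are independent except that $\beta_{-k}=\overline{\beta_k}$. Put formally $B=\sum_k\beta_ke_k$. Integrals of exponentials against $\beta_k$ are pathwise (improper) Riemann–Stieltjes integrals. A mild solution of $$d\psi=\nu A\psi\,dt+\nu^HQ^{1/2}dB,\qquad t\ge0, \qquad(1)$$ is a jointly measurable $V$-valued process $(\psi(t))_{t\ge0}$ such that for every $t\ge0$, a.s., $$\psi(t)=S(t)\psi(0)+\sum_{k\in K}\sqrt{\lambda_k}\,\nu^H\int_0^te^{-(t-s)\nu\alpha_k}\,d\beta_k(s)\,e_k,$$ the series converging in $L^2(\Omega;V)$. It is strictly stationary if its finite-dimensional distributions on $[0,\infty)$ are invariant under shifts $r\ge0$, and a strictly stationary solution is ergodic if for every measurable $\rho:V\to\mathbb R$ with $\mathbb E|\rho(\psi(0))|<\infty$, a.s., $\rho(\psi(\cdot))$ is integrable on bounded intervals and $\frac1T\int_0^T\rho(\psi(t))\,dt\to\mathbb E\rho(\psi(0))$ as $T\to\infty$. Adapted means that, for each $t$, $\psi(t)$ is measurable up to null sets with respect to $\sigma(\beta_k(s):s\le t,\ k\in K)$. Theorem. Assume that for some $m\in\mathbb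 N_0$ and $\gamma\in(0,1)$ $$\sum_{k\in K}\lambda_k\alpha_k^{2\gamma-2H}|k|^{2m}<\infty\quad\text{and}\quad\sum_{k\in K}\lambda_k\alpha_k^{-2H}|k|^{2m+2\gamma}<\infty .$$ Then there is a jointly measurable $V$-valued process $(\psi(t))_{t\in\mathbb R}$ given, for each $t\in\mathbb R$, by $$\psi(t)=\sum_{k\in K}\sqrt{\lambda_k}\,\nu^H\int_{-\infty}^te^{-(t-u)\nu\alpha_k}\,d\beta_k(u)\,e_k\quad\text{in }L^2(\Omega;V),$$ whose restriction to $t\ge0$ is the unique ergodic mild solution of (1): it is an adapted, strictly stationary and ergodic mild solution, and every adapted strictly stationary mild solution has the same finite-dimensional distributions. Moreover, for every $\delta\in\mathbb N_0^2$ with $|\delta|\le m$ there is a real-valued random field $Z$ on $\mathbb T^2\times\mathbb R$ that is a version of $D^\delta\psi$ (for each $t$, a.s. $Z(\cdot,t)$ is integrable and equals the distributional, i.e. Fourier-series, derivative $D^\delta\psi(t)$) such that almost surely $Z\in C^\epsilon(\mathbb T^2\times\mathbb R)$ for every $\epsilon\in(0,\min\{\gamma,H\})$, i.e. for every $T>0$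 the function $Z$ is $\epsilon$-Hölder continuous on $\mathbb T^2\times[-T,T]$. -/

import Mathlib

open MeasureTheory ProbabilityTheory Filter Set UnitAddTorus
open scoped Topology NNReal ENNReal ComplexConjugate

namespace FracField

noncomputable section

/-! ### The torus, the state space and the Fourier basis -/

/-- The two-dimensional torus `ℝ² / ℤ²`. -/
abbrev Torus : Type := UnitAddTorus (Fin 2)

/-- The Haar probability measure of the torus, i.e. Lebesgue measure of the unit square. -/
def torusMeasure : Measure Torus := Measure.pi fun _ : Fin 2 => AddCircle.haarAddCircle

instance : IsProbabilityMeasure torusMeasure :=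
  inferInstanceAs (IsProbabilityMeasure (Measure.pi fun _ : Fin 2 => AddCircle.haarAddCircle))

/-- The index set: `n : ModeIndex` stands for the wave vector `k = 2πn` in `2πℤ² \ {0}`. -/
abbrev ModeIndex : Type := {n : Fin 2 → ℤ // n ≠ 0}

instance : Neg ModeIndex := ⟨fun n => ⟨-n.1, neg_ne_zero.mpr n.2⟩⟩

/-- The wave vector `k = 2πn`; its norm is the Euclidean norm `|k|`. -/
def waveVector (n : ModeIndex) : EuclideanSpace ℝ (Fin 2) :=
  WithLp.toLp 2 fun i => 2 * Real.pi * (n.1 i : ℝ)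

/-- The Hilbert space `V` of complex square-integrable functions on the torus with mean zero. -/
def meanZero : Submodule ℂ (Lp ℂ 2 torusMeasure) where
  carrier := {f | ∫ x, f x ∂torusMeasure = 0}
  zero_mem' := by
    change ∫ x, (0 : Lp ℂ 2 torusMeasure) x ∂torusMeasure = 0
    rw [integral_congr_ae (Lp.coeFn_zero ℂ 2 torusMeasure)]
    simp
  add_mem' := by
    intro f g hf hg
    have hfi : Integrable f torusMeasure := (Lp.memLp f).integrable one_le_two
    have hgi : Integrable g torusMeasure := (Lp.memLp g).integrable one_le_two
    change ∫ x, f x ∂torusMeasure = 0 at hf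
    change ∫ x, g x ∂torusMeasure = 0 at hg
    change ∫ x, (f + g) x ∂torusMeasure = 0
    rw [integral_congr_ae (Lp.coeFn_add f g)]
    simp [integral_add hfi hgi, hf, hg]
  smul_mem' := by
    intro c f hf
    change ∫ x, f x ∂torusMeasure = 0 at hf
    change ∫ x, (c • f) x ∂torusMeasure = 0
    rw [integral_congr_ae (Lp.coeFn_smul c f)]
    simp [integral_const_mul, hf]

/-- `V` as a type. -/
abbrev V : Type := meanZero

instance : MeasurableSpace V := borel V

instance : BorelSpace V := ⟨rfl⟩

/-- A nonconstant Fourier monomial has mean zero. -/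
theorem mFourierLp_mem_meanZero (n : ModeIndex) :
    ContinuousMap.toLp (E := ℂ) 2 torusMeasure ℂ (mFourier n.1) ∈ meanZero := by
  change ∫ x, (ContinuousMap.toLp (E := ℂ) 2 torusMeasure ℂ (mFourier n.1)) x ∂torusMeasure = 0
  rw [integral_congr_ae (ContinuousMap.coeFn_toLp torusMeasure (mFourier n.1))]
  have h := (orthonormal_mFourier (d := Fin 2)).2 (Ne.symm n.2)
  change inner ℂ (mFourierLp 2 0) (mFourierLp 2 n.1) = 0 at h
  rw [ContinuousMap.inner_toLp] at h
  simpa [mFourier_zero] using! h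

/-- The basis function `e_k(x) = exp(i⟨k, x⟩)`, `k = 2πn`, as an element of `V`. -/
def e (n : ModeIndex) : V :=
  ⟨ContinuousMap.toLp (E := ℂ) 2 torusMeasure ℂ (mFourier n.1), mFourierLp_mem_meanZero n⟩

/-- The semigroup `S(t) = exp(tνA)` on `V` generated by `νA`, where `A e_k = -α_k e_k`:
`S(t) f = ∑_k exp(-tνα_k) ⟨f, e_k⟩ e_k`. (In Mathlib `inner ℂ` is conjugate linear in its first
argument.) -/
def semigroup (ν : ℝ) (α : ModeIndex → ℝ) (t : ℝ) (f : V) : V :=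
  ∑' k : ModeIndex, ((Real.exp (-(t * ν * α k)) : ℂ) * inner ℂ (e k) f) • e k

/-! ### Riemann–Stieltjes integrals -/

/-- `I` is the Riemann–Stieltjes integral `∫_a^b f dg` (for `a ≤ b`): the sums
`∑ f(ξ_i) (g(p_{i+1}) - g(p_i))` over tagged partitions `a = p_0 ≤ ⋯ ≤ p_n = b` converge to `I`
as the mesh tends to zero. -/
def HasRSIntegral (f : ℝ → ℝ) (g : ℝ → ℂ) (a b : ℝ) (I : ℂ) : Prop :=
  ∀ ε > 0, ∃ δ > 0, ∀ (n : ℕ) (p ξ : ℕ → ℝ), p 0 = a → p n = b →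
    (∀ i < n, p i ≤ p (i + 1) ∧ p (i + 1) - p i < δ ∧ ξ i ∈ Icc (p i) (p (i + 1))) →
    ‖∑ i ∈ Finset.range n, (f (ξ i) : ℂ) * (g (p (i + 1)) - g (p i)) - I‖ < ε

open Classical in
/-- The Riemann–Stieltjes integral `∫_a^b f dg`. It exists whenever `f` is continuously
differentiable and `g` is continuous, which is the only case of interest here. -/
def rsIntegral (f : ℝ → ℝ) (g : ℝ → ℂ) (a b : ℝ) : ℂ :=
  if h : ∃ I, HasRSIntegral f g a b I then h.choose else 0

/-- The improper Riemann–Stieltjes integral `∫_{-∞}^b f dg`. -/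
def rsIntegralIic (f : ℝ → ℝ) (g : ℝ → ℂ) (b : ℝ) : ℂ :=
  limUnder atBot fun a => rsIntegral f g a b

/-! ### Fractional Brownian motions -/

variable {Ω : Type*} [MeasurableSpace Ω]

/-- `X` is a real, normalized, two-sided fractional Brownian motion with Hurst parameter `H`. -/
structure IsFBM (H : ℝ) (X : ℝ → Ω → ℝ) (P : Measure Ω) : Prop where
  measurable : ∀ t, Measurable (X t)
  gaussian : IsGaussianProcess X P
  zero : ∀ᵐ ω ∂P, X 0 ω = 0
  mean : ∀ t, ∫ ω, X t ω ∂P = 0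
  cov : ∀ s t, ∫ ω, X t ω * X s ω ∂P =
    (|t| ^ (2 * H) + |s| ^ (2 * H) - |t - s| ^ (2 * H)) / 2
  cont : ∀ᵐ ω ∂P, Continuous fun t => X t ω

/-- `b` is a complex, normalized, two-sided fractional Brownian motion: `b = (X + iY) / √2` with
independent real normalized fractional Brownian motions `X` and `Y`. -/
structure IsComplexFBM (H : ℝ) (b : ℝ → Ω → ℂ) (P : Measure Ω) : Prop where
  re : IsFBM H (fun t ω => √2 * (b t ω).re) P
  im : IsFBM H (fun t ω => √2 * (b t ω).im) P
  indep : IndepFun (fun ω t => (b t ω).re) (fun ω t => (b t ω).im) P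

/-- The coordinate processes `β_k` of an infinite-dimensional fractional Brownian motion
`B = ∑_k β_k e_k`: complex fractional Brownian motions that are independent except for
`β_{-k} = conj β_k`. -/
structure IsFBMFamily (H : ℝ) (β : ModeIndex → ℝ → Ω → ℂ) (P : Measure Ω) : Prop where
  fbm : ∀ k, IsComplexFBM H (β k) P
  conj_symm : ∀ k, ∀ᵐ ω ∂P, ∀ t, β (-k) t ω = conj (β k t ω)
  indep : ∀ S : Set ModeIndex, (∀ k ∈ S, -k ∉ S) →
    iIndepFun (fun (k : S) (ω : Ω) (t : ℝ) => β k t ω) P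

/-- The natural filtration generated by the two-sided process: `σ(β_k(s) : s ≤ t, k)`. -/
abbrev natFiltration (β : ModeIndex → ℝ → Ω → ℂ) (t : ℝ) : MeasurableSpace Ω :=
  ⨆ k : ModeIndex, ⨆ s : Iic t, MeasurableSpace.comap (β k s) inferInstance

/-! ### Mild solutions of `dψ = νAψ dt + ν^H Q^{1/2} dB` -/

/-- `φ` is a mild solution: it is measurable in `(t, ω)` and, for each `t`, almost surely
`φ(t) = S(t)φ(0) + ∑_k √λ_k ν^H (∫_0^t exp(-(t-s)να_k) dβ_k(s)) e_k`,
where the series converges in `L²(Ω; V)`. -/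
structure IsMildSolution (H ν : ℝ) (α lam : ModeIndex → ℝ) (β : ModeIndex → ℝ → Ω → ℂ)
    (P : Measure Ω) (φ : ℝ≥0 → Ω → V) : Prop where
  measurable : Measurable fun p : ℝ≥0 × Ω => φ p.1 p.2
  eq : ∀ t : ℝ≥0, Tendsto (fun F : Finset ModeIndex => eLpNorm (fun ω =>
      φ t ω - semigroup ν α t (φ 0 ω) - ∑ k ∈ F, ((√(lam k) * ν ^ H : ℝ) *
        rsIntegral (fun s => Real.exp (-((t - s) * ν * α k))) (fun s => β k s ω) 0 t) • e k) 2 P)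
    atTop (𝓝 0)

/-- The finite-dimensional distribution of `φ` at the times `t_1, …, t_n`. -/
def fdd (P : Measure Ω) (φ : ℝ≥0 → Ω → V) {n : ℕ} (t : Fin n → ℝ≥0) : Measure (Fin n → V) :=
  P.map fun ω i => φ (t i) ω

/-- Strict stationarity of a process indexed by `[0, ∞)`. -/
def IsStrictlyStationary (P : Measure Ω) (φ : ℝ≥0 → Ω → V) : Prop :=
  ∀ (n : ℕ) (t : Fin n → ℝ≥0) (r : ℝ≥0), fdd P φ (fun i => t i + r) = fdd P φ t

/-- Adaptedness (up to null sets) to the natural filtration of the two-sided noise. -/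
def IsAdaptedTo (β : ModeIndex → ℝ → Ω → ℂ) (P : Measure Ω) (φ : ℝ≥0 → Ω → V) : Prop :=
  ∀ t : ℝ≥0, AEStronglyMeasurable[natFiltration β t] (φ t) P

/-- Ergodicity: time averages of integrable observables converge almost surely to the mean. -/
def IsErgodic (P : Measure Ω) (φ : ℝ≥0 → Ω → V) : Prop :=
  ∀ ρ : V → ℝ, Measurable ρ → Integrable (fun ω => ρ (φ 0 ω)) P → ∀ᵐ ω ∂P,
    (∀ T : ℝ, 0 ≤ T → IntervalIntegrable (fun t : ℝ => ρ (φ t.toNNReal ω)) volume 0 T) ∧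
    Tendsto (fun T : ℝ => T⁻¹ * ∫ t in (0 : ℝ)..T, ρ (φ t.toNNReal ω)) atTop
      (𝓝 (∫ ω', ρ (φ 0 ω') ∂P))

/-- `φ` is the unique ergodic mild solution: it is an adapted, strictly stationary, ergodic mild
solution, and each adapted strictly stationary mild solution has the same distribution. -/
structure IsUniqueErgodicMildSolution (H ν : ℝ) (α lam : ModeIndex → ℝ)
    (β : ModeIndex → ℝ → Ω → ℂ) (P : Measure Ω) (φ : ℝ≥0 → Ω → V) : Prop where
  mild : IsMildSolution H ν α lam β P φ
  stationary : IsStrictlyStationary P φ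
  adapted : IsAdaptedTo β P φ
  ergodic : IsErgodic P φ
  unique : ∀ φ' : ℝ≥0 → Ω → V, IsMildSolution H ν α lam β P φ' → IsStrictlyStationary P φ' →
    IsAdaptedTo β P φ' → ∀ (n : ℕ) (t : Fin n → ℝ≥0), fdd P φ' t = fdd P φ t

/-- `ψ(t) = ∑_k √λ_k ν^H (∫_{-∞}^t exp(-(t-u)να_k) dβ_k(u)) e_k` for all real `t`, with
convergence in `L²(Ω; V)`. -/
def IsFOUSeries (H ν : ℝ) (α lam : ModeIndex → ℝ) (β : ModeIndex → ℝ → Ω → ℂ)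
    (P : Measure Ω) (ψ : ℝ → Ω → V) : Prop :=
  ∀ t : ℝ, Tendsto (fun F : Finset ModeIndex => eLpNorm (fun ω =>
      ψ t ω - ∑ k ∈ F, ((√(lam k) * ν ^ H : ℝ) *
        rsIntegralIic (fun u => Real.exp (-((t - u) * ν * α k))) (fun u => β k u ω) t) • e k) 2 P)
    atTop (𝓝 0)

/-! ### Derivatives -/

/-- `g = D^δ f` in the sense of distributions on the torus, expressed through Fourier series:
`D^δ exp(2πi⟨n, x⟩) = (2πi n_1)^{δ_1} (2πi n_2)^{δ_2} exp(2πi⟨n, x⟩)`. Here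
`mFourierCoeff f n = ∫ exp(-2πi⟨n, x⟩) f(x) dx`. -/
def IsDistribDeriv (δ : Fin 2 → ℕ) (f g : Torus → ℂ) : Prop :=
  ∀ n : Fin 2 → ℤ, mFourierCoeff g n =
    (∏ j : Fin 2, (2 * Real.pi * Complex.I * (n j : ℂ)) ^ δ j) * mFourierCoeff f n

/-- The real random field `Z` on the torus times `ℝ` is a version of `D^δ ψ`: for each `t`,
almost surely `Z(·, t) = D^δ ψ(t)`. -/
structure IsVersionOfDeriv (δ : Fin 2 → ℕ) (P : Measure Ω) (ψ : ℝ → Ω → V)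
    (Z : Torus × ℝ → Ω → ℝ) : Prop where
  measurable : ∀ p, Measurable (Z p)
  integrable : ∀ t, ∀ᵐ ω ∂P, Integrable (fun x => Z (x, t) ω) torusMeasure
  deriv : ∀ t, ∀ᵐ ω ∂P,
    IsDistribDeriv δ (ψ t ω : Lp ℂ 2 torusMeasure) (fun x => (Z (x, t) ω : ℂ))

end

end FracField

namespace FracField

/-! ### Riemann–Stieltjes integrals of smooth kernels -/

/-! In the basis `e k` the equation is diagonal. Put κ_k = να_k and let c_k(t) be the integral of
e^{-(t-u)κ_k} dβ_k(u) over u ≤ t, a stationary scalar Ornstein–Uhlenbeck process; the solution has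
coordinates √λ_k ν^H c_k. Integration by parts turns c_k into an ordinary integral, `pathOU`, which
makes sense for every continuous path of at most quadratic growth. Almost every path of the noise is
of this kind: s² b(±1/s) is Hölder on (0,1] in mean square, and Kolmogorov–Chentsov bounds its paths
near s = 0 (`ae_growth`). Read in L²(Ω), the same formula is a Bochner integral `ouVec` of a Hilbert
space curve with the covariance of fractional Brownian motion, and Fubini identifies the two
readings (`pathOU_ae_eq`).

Second order facts thus become Hilbert space geometry: ‖c_k‖ ≤ Γ(H+1) κ_k^{-H}, ‖c_k(t) - c_k(s)‖ ≤
2|t-s|^H, inner products depend on t-s only, and they are O(|t-s|^{2H-2}) because they average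
second differences of |·|^{2H}. Distinct modes are orthogonal; this includes k and -k, since a
circular complex Gaussian has E[β_k β_k] = 0. The real part of any vector in the closed span of the
noise is a centred Gaussian variable (`integral_exp_re`), so its law is determined by its L² norm.

Stationarity: the joint characteristic functions depend only on shift invariant L² norms.
Uniqueness: two mild solutions differ by S(t) applied to their initial difference, which decays like
e^{-tνc}; stationary processes that attract each other have equal finite-dimensional distributions
(`fdd_eq_of_tendsto`).

Ergodicity: by the Gaussian formula the characters exp(i Re⟨v, ψ(t)⟩) have covariances bounded by
those of ⟨v, ψ⟩, hence by a negative power of the time lag. A second moment argument along a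
polynomial sequence of times gives their strong law (`ae_tendsto_average_of_decay`). Trigonometric
polynomials are dense in L¹ of the marginal law, and a maximal inequality of Hopf type, derived from
stationarity of the finite-dimensional distributions, carries almost sure convergence over to every
integrable observable (`ergodic_theorem`).

Regularity: with θ = min(γ, H), interpolation gives ‖c_k(t) - c_k(s)‖ ≲ κ_k^{θ-H}|t-s|^θ and |e_k(x)
- e_k(y)| ≲ |k|^θ |x-y|^θ. By orthogonality the two summability assumptions make the field D^δψ
θ-Hölder in mean square; Gaussian moments and chaining give a version that is ε-Hölder for every ε <
θ. Its Fourier coefficients are identified through finite partial sums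
(`mFourierCoeff_field_ae_eq`). -/

theorem monotoneOn_Iic_of_le_succ {p : ℕ → ℝ} {n : ℕ} (h : ∀ i < n, p i ≤ p (i + 1)) :
    MonotoneOn p (Iic n) :=
  monotoneOn_of_le_add_one ordConnected_Iic fun i _ _ hi => h i (Nat.lt_of_succ_le hi)

theorem setIntegral_Ioi_add_right (f : ℝ → ℂ) (t : ℝ) :
    ∫ v in Ioi (0 : ℝ), f (v + t) = ∫ v in Ioi t, f v := by
  rw [← integral_indicator measurableSet_Ioi, ← integral_indicator measurableSet_Ioi,
    ← integral_add_right_eq_self ((Ioi t).indicator f) t]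
  congr 1
  ext v
  simp [indicator]

/-- Both limits are compared on one uniform partition finer than both thresholds. The assumption a ≤
b is essential: for b < a there are no admissible partitions, and every number satisfies the
definition vacuously. -/
theorem HasRSIntegral.unique {f : ℝ → ℝ} {g : ℝ → ℂ} {a b : ℝ} (hab : a ≤ b) {I J : ℂ}
    (hI : HasRSIntegral f g a b I) (hJ : HasRSIntegral f g a b J) : I = J := by
  refine eq_of_forall_dist_le fun ε hε => ?_
  obtain ⟨δ, hδ, h⟩ := hI (ε / 2) (half_pos hε)
  obtain ⟨δ', hδ', h'⟩ := hJ (ε / 2) (half_pos hε)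
  obtain ⟨n, hn⟩ := exists_nat_gt ((b - a) / min δ δ')
  have hm : 0 < min δ δ' := lt_min hδ hδ'
  have hn0 : (0 : ℝ) < n + 1 := by positivity
  have key : ∀ i < n + 1, (a + i * ((b - a) / (n + 1)) ≤ a + (i + 1 : ℕ) * ((b - a) / (n + 1))) ∧
      (a + (i + 1 : ℕ) * ((b - a) / (n + 1)) - (a + i * ((b - a) / (n + 1))) < min δ δ') ∧
      a + i * ((b - a) / (n + 1)) ∈ Icc (a + i * ((b - a) / (n + 1)))
        (a + (i + 1 : ℕ) * ((b - a) / (n + 1))) := by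
    intro i _
    have h0 : 0 ≤ (b - a) / (n + 1) := div_nonneg (sub_nonneg.2 hab) hn0.le
    have h1 : (b - a) / (n + 1) < min δ δ' := by
      rw [div_lt_iff₀ hm] at hn
      rw [div_lt_iff₀ hn0]
      nlinarith
    push_cast
    refine ⟨by nlinarith, by linarith, le_rfl, by nlinarith⟩
  have e0 : a + ((0 : ℕ) : ℝ) * ((b - a) / (n + 1)) = a := by simp
  have e1 : a + ((n + 1 : ℕ) : ℝ) * ((b - a) / (n + 1)) = b := by
    push_cast; field_simp; ring
  have r := h (n + 1) (fun i => a + i * ((b - a) / (n + 1))) (fun i => a + i * ((b - a) / (n + 1)))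
    e0 e1 fun i hi => ⟨(key i hi).1, (key i hi).2.1.trans_le (min_le_left _ _), (key i hi).2.2⟩
  have r' := h' (n + 1) (fun i => a + i * ((b - a) / (n + 1)))
    (fun i => a + i * ((b - a) / (n + 1)))
    e0 e1 fun i hi => ⟨(key i hi).1, (key i hi).2.1.trans_le (min_le_right _ _), (key i hi).2.2⟩
  rw [← dist_eq_norm] at r r'
  exact (dist_triangle_left _ _ _).trans (by linarith)

/-- Integration by parts for the Riemann–Stieltjes integral of a continuously differentiable
function against a continuous one. -/
theorem hasRSIntegral_of_hasDerivAt {f f' : ℝ → ℝ} {g : ℝ → ℂ} {a b : ℝ}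
    (hf : ∀ x, HasDerivAt f (f' x) x) (hf' : Continuous f') (hg : Continuous g) :
    HasRSIntegral f g a b (f b * g b - f a * g a - ∫ u in a..b, (f' u : ℂ) * g u) := by
  intro ε hε
  rcases lt_or_ge b a with hab | hab
  · refine ⟨1, one_pos, fun n p ξ h0 hn h => absurd ?_ hab.not_ge⟩
    rw [← h0, ← hn]
    exact monotoneOn_Iic_of_le_succ (n := n) (fun i hi => (h i hi).1) (by simp) (by simp)
      (Nat.zero_le n)
  obtain ⟨C, hC⟩ := isCompact_Icc.exists_bound_of_continuousOn (hf'.continuousOn (s := Icc a b))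
  have hC0 : 0 ≤ C := (norm_nonneg _).trans (hC a ⟨le_rfl, hab⟩)
  -- The final error is C η (b - a); the summand 1 avoids division by zero and makes the last
  -- inequality strict.
  set η : ℝ := ε / (C * (b - a) + 1) with hη
  have hden : 0 < C * (b - a) + 1 := by nlinarith [mul_nonneg hC0 (sub_nonneg.2 hab)]
  have hη0 : 0 < η := div_pos hε hden
  have huc := (isCompact_Icc (a := a) (b := b)).uniformContinuousOn_of_continuous hg.continuousOn
  obtain ⟨δ, hδ, hgδ⟩ := Metric.uniformContinuousOn_iff.1 huc η hη0
  refine ⟨δ, hδ, fun n p ξ h0 hn h => ?_⟩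
  have hmono : MonotoneOn p (Iic n) := monotoneOn_Iic_of_le_succ fun i hi => (h i hi).1
  have hmem : ∀ i ≤ n, p i ∈ Icc a b := fun i hi =>
    ⟨h0 ▸ hmono (by simp) hi (Nat.zero_le i), hn ▸ hmono hi (by simp) hi⟩
  have hfg : Continuous fun u => (f' u : ℂ) * g u := (Complex.continuous_ofReal.comp hf').mul hg
  have hint : ∀ x y, IntervalIntegrable (fun u => (f' u : ℂ) * g u) volume x y :=
    fun x y => hfg.intervalIntegrable _ _
  have hf'c : Continuous fun u => (f' u : ℂ) := Complex.continuous_ofReal.comp hf'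
  have hint' : ∀ x y, IntervalIntegrable (fun u => (f' u : ℂ)) volume x y :=
    fun x y => hf'c.intervalIntegrable _ _
  have hftc : ∀ x y, ∫ u in x..y, (f' u : ℂ) = f y - f x := fun x y =>
    intervalIntegral.integral_eq_sub_of_hasDerivAt (fun u _ => (hf u).ofReal_comp) (hint' x y)
  have hpiece : ∀ x y c, ∫ u in x..y, (f' u : ℂ) * (g u - c) =
      (∫ u in x..y, (f' u : ℂ) * g u) - (f y - f x) * c := by
    intro x y c
    simp_rw [mul_sub]
    rw [intervalIntegral.integral_sub (hint x y) ((hint' x y).mul_const c),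
      intervalIntegral.integral_mul_const, hftc]
  have hsumI : ∑ i ∈ Finset.range n, ∫ u in p i..p (i + 1), (f' u : ℂ) * g u =
      ∫ u in a..b, (f' u : ℂ) * g u := by
    rw [intervalIntegral.sum_integral_adjacent_intervals fun k _ => hint _ _, h0, hn]
  have htel : ∑ i ∈ Finset.range n, ((f (p (i + 1)) : ℂ) * g (p (i + 1)) - f (p i) * g (p i)) =
      f b * g b - f a * g a := by
    rw [Finset.sum_range_sub (fun i => (f (p i) : ℂ) * g (p i)), h0, hn]
  have hpb : ∀ x y c, x ≤ y → a ≤ x → y ≤ b → (∀ u ∈ Icc x y, ‖g u - c‖ ≤ η) →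
      ‖∫ u in x..y, (f' u : ℂ) * (g u - c)‖ ≤ C * η * (y - x) := by
    intro x y c hxy hax hyb hu
    have := intervalIntegral.norm_integral_le_of_norm_le_const (a := x) (b := y)
      (f := fun u => (f' u : ℂ) * (g u - c)) (C := C * η) fun u hu' => ?_
    · rwa [abs_of_nonneg (sub_nonneg.2 hxy)] at this
    · rw [uIoc_of_le hxy] at hu'
      rw [norm_mul, Complex.norm_real]
      exact mul_le_mul (hC u ⟨hax.trans hu'.1.le, hu'.2.trans hyb⟩) (hu u ⟨hu'.1.le, hu'.2⟩)
        (norm_nonneg _) hC0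
  -- Summation by parts with the tag as breakpoint: left of ξ_i the path g is compared with its
  -- value at p_i, right of it with its value at p_{i+1}. Both differences are small by uniform
  -- continuity.
  have hrep : ∑ i ∈ Finset.range n, (f (ξ i) : ℂ) * (g (p (i + 1)) - g (p i)) -
      (f b * g b - f a * g a - ∫ u in a..b, (f' u : ℂ) * g u) =
      ∑ i ∈ Finset.range n, ((∫ u in p i..ξ i, (f' u : ℂ) * (g u - g (p i))) +
        ∫ u in ξ i..p (i + 1), (f' u : ℂ) * (g u - g (p (i + 1)))) := by
    rw [← hsumI, ← htel, ← Finset.sum_sub_distrib, ← Finset.sum_sub_distrib]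
    refine Finset.sum_congr rfl fun i _ => ?_
    rw [hpiece, hpiece, ← intervalIntegral.integral_add_adjacent_intervals (hint (p i) (ξ i))
      (hint (ξ i) (p (i + 1)))]
    ring
  rw [hrep]
  calc _ ≤ ∑ i ∈ Finset.range n, C * η * (p (i + 1) - p i) := by
        refine norm_sum_le_of_le _ fun i hi => ?_
        have hi' := Finset.mem_range.1 hi
        obtain ⟨h1, h2, h3, h4⟩ := h i hi'
        have m1 := hmem i hi'.le
        have m2 := hmem (i + 1) hi'
        refine (norm_add_le _ _).trans ?_
        have b1 := hpb (p i) (ξ i) (g (p i)) h3 m1.1 (h4.trans m2.2) fun u hu => by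
          rw [← dist_eq_norm]
          refine (hgδ u ⟨m1.1.trans hu.1, hu.2.trans (h4.trans m2.2)⟩ _ m1 ?_).le
          rw [Real.dist_eq, abs_of_nonneg (sub_nonneg.2 hu.1)]
          linarith [hu.2]
        have b2 := hpb (ξ i) (p (i + 1)) (g (p (i + 1))) h4 (m1.1.trans h3) m2.2 fun u hu => by
          rw [← dist_eq_norm]
          refine (hgδ u ⟨(m1.1.trans h3).trans hu.1, hu.2.trans m2.2⟩ _ m2 ?_).le
          rw [Real.dist_eq, abs_sub_comm, abs_of_nonneg (sub_nonneg.2 hu.2)]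
          linarith [hu.1]
        nlinarith
    _ = C * η * (b - a) := by rw [← Finset.mul_sum, Finset.sum_range_sub p, h0, hn]
    _ < ε := by
        rw [hη, show C * (ε / (C * (b - a) + 1)) * (b - a) = ε * (C * (b - a)) / (C * (b - a) + 1)
          by ring, div_lt_iff₀ hden]
        nlinarith

theorem HasRSIntegral.rsIntegral_eq {f : ℝ → ℝ} {g : ℝ → ℂ} {a b : ℝ} (hab : a ≤ b) {I : ℂ}
    (hI : HasRSIntegral f g a b I) : rsIntegral f g a b = I := by
  have h : ∃ I, HasRSIntegral f g a b I := ⟨I, hI⟩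
  rw [rsIntegral, dif_pos h]
  exact h.choose_spec.unique hab hI

/-- The exponential kernel, integrated by parts. -/
theorem rsIntegral_exp {g : ℝ → ℂ} (hg : Continuous g) (t κ : ℝ) {a b : ℝ} (hab : a ≤ b) :
    rsIntegral (fun u => Real.exp (-((t - u) * κ))) g a b =
      Real.exp (-((t - b) * κ)) * g b - Real.exp (-((t - a) * κ)) * g a -
        ∫ u in a..b, ((κ * Real.exp (-((t - u) * κ)) : ℝ) : ℂ) * g u := by
  refine (hasRSIntegral_of_hasDerivAt (fun x => ?_) (by fun_prop) hg).rsIntegral_eq hab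
  have h : HasDerivAt (fun u : ℝ => -((t - u) * κ)) κ x := by
    simpa using! (((hasDerivAt_id x).const_sub t).mul_const κ).neg
  simpa [mul_comm] using! h.exp

/-- The stationary Ornstein–Uhlenbeck convolution driven by the path `g`. -/
noncomputable def pathOU (κ : ℝ) (g : ℝ → ℂ) (t : ℝ) : ℂ :=
  g t - κ * ∫ v in Ioi (0 : ℝ), (Real.exp (-(κ * v)) : ℂ) * g (t - v)

/-- Polynomial growth, in the form satisfied by the paths of fractional Brownian motion. -/
def PolyGrowth (g : ℝ → ℂ) : Prop := ∃ C : ℝ, ∀ u, ‖g u‖ ≤ C * (1 + u ^ 2)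

theorem integrableOn_exp_mul_pow {κ : ℝ} (hκ : 0 < κ) (n : ℕ) :
    IntegrableOn (fun v : ℝ => Real.exp (-(κ * v)) * v ^ n) (Ioi 0) := by
  have h := integrableOn_rpow_mul_exp_neg_mul_rpow (s := n) (p := 1) (b := κ)
    (by have : (0 : ℝ) ≤ n := n.cast_nonneg
        linarith) one_pos hκ
  refine h.congr_fun (fun v _ => ?_) measurableSet_Ioi
  simp [mul_comm]

theorem PolyGrowth.integrableOn {g : ℝ → ℂ} (hg : Continuous g) (hp : PolyGrowth g) {κ : ℝ}
    (hκ : 0 < κ) (t : ℝ) :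
    IntegrableOn (fun v : ℝ => (Real.exp (-(κ * v)) : ℂ) * g (t - v)) (Ioi 0) := by
  obtain ⟨C, hC⟩ := hp
  have h0 := (integrableOn_exp_mul_pow hκ 0).const_mul (C * (1 + 2 * t ^ 2))
  have h2 := (integrableOn_exp_mul_pow hκ 2).const_mul (C * 2)
  have hC0 : 0 ≤ C := by simpa using (norm_nonneg _).trans (hC 0)
  refine Integrable.mono' (h0.add h2) (by fun_prop) (ae_of_all _ fun v => ?_)
  simp only [norm_mul, Complex.norm_real, Real.norm_eq_abs, Real.abs_exp, Pi.add_apply, pow_zero,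
    mul_one]
  have := mul_le_mul_of_nonneg_left (hC (t - v)) (Real.exp_pos (-(κ * v))).le
  refine this.trans ?_
  have e := Real.exp_pos (-(κ * v))
  have : C * (1 + (t - v) ^ 2) ≤ C * (1 + 2 * t ^ 2) + C * 2 * v ^ 2 := by
    nlinarith [mul_nonneg hC0 (sq_nonneg (t + v))]
  nlinarith

theorem tendsto_exp_mul_one_add_sq {κ : ℝ} (hκ : 0 < κ) (t : ℝ) :
    Tendsto (fun a : ℝ => Real.exp (-((t - a) * κ)) * (1 + a ^ 2)) atBot (𝓝 0) := by
  have h0 := (Real.tendsto_pow_mul_exp_neg_atTop_nhds_zero 0)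
  have hlin : Tendsto (fun a : ℝ => -(κ * a)) atBot atTop :=
    tendsto_neg_atBot_atTop.comp (tendsto_id.const_mul_atBot hκ)
  have A := (Real.tendsto_pow_mul_exp_neg_atTop_nhds_zero 0).comp hlin
  have B := (Real.tendsto_pow_mul_exp_neg_atTop_nhds_zero 2).comp hlin
  have := (A.const_mul (Real.exp (-(t * κ)))).add (B.const_mul (Real.exp (-(t * κ)) * (κ ^ 2)⁻¹))
  simp only [mul_zero, add_zero] at this
  refine this.congr fun a => ?_
  have : Real.exp (-((t - a) * κ)) = Real.exp (-(t * κ)) * Real.exp (κ * a) := by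
    rw [← Real.exp_add]; ring_nf
  simp only [Function.comp, pow_zero, neg_neg, this]
  field_simp

/-- After integration by parts on [a, t], the boundary term at a vanishes as a → -∞ because the
exponential beats quadratic growth; the substitution v = t - u gives the half-line integral. -/
theorem rsIntegralIic_exp {g : ℝ → ℂ} (hg : Continuous g) (hp : PolyGrowth g) {κ : ℝ} (hκ : 0 < κ)
    (t : ℝ) : rsIntegralIic (fun u => Real.exp (-((t - u) * κ))) g t = pathOU κ g t := by
  have hint := hp.integrableOn hg hκ t
  have hlim : Tendsto (fun a : ℝ => ∫ v in (0 : ℝ)..(t - a), (Real.exp (-(κ * v)) : ℂ) * g (t - v))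
      atBot (𝓝 (∫ v in Ioi (0 : ℝ), (Real.exp (-(κ * v)) : ℂ) * g (t - v))) :=
    intervalIntegral_tendsto_integral_Ioi 0 hint
      (tendsto_atTop_add_const_left _ t tendsto_neg_atBot_atTop)
  have hbd : Tendsto (fun a : ℝ => (Real.exp (-((t - a) * κ)) : ℂ) * g a) atBot (𝓝 0) := by
    obtain ⟨C, hC⟩ := hp
    rw [tendsto_zero_iff_norm_tendsto_zero]
    have := (tendsto_exp_mul_one_add_sq hκ t).const_mul C
    rw [mul_zero] at this
    refine squeeze_zero (fun _ => norm_nonneg _) (fun a => ?_) this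
    rw [norm_mul, Complex.norm_real, Real.norm_eq_abs, Real.abs_exp]
    nlinarith [hC a, Real.exp_pos (-((t - a) * κ))]
  refine Tendsto.limUnder_eq ?_
  have := ((tendsto_const_nhds (x := g t)).sub hbd).sub (hlim.const_mul (κ : ℂ))
  rw [sub_zero] at this
  refine this.congr' ?_
  filter_upwards [eventually_le_atBot t] with a ha
  rw [rsIntegral_exp hg t κ ha]
  congr 1
  · simp
  · have := intervalIntegral.integral_comp_sub_left
      (fun u => ((κ * Real.exp (-((t - u) * κ)) : ℝ) : ℂ) * g u) t (a := 0) (b := t - a)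
    rw [sub_zero, sub_sub_cancel] at this
    rw [← this, ← intervalIntegral.integral_const_mul]
    refine intervalIntegral.integral_congr fun v _ => ?_
    simp only [sub_sub_cancel]
    push_cast
    rw [mul_comm (κ : ℂ) v]
    ring

/-- The Ornstein–Uhlenbeck convolution solves its mild equation. -/
theorem pathOU_eq_add_rsIntegral {g : ℝ → ℂ} (hg : Continuous g) (hp : PolyGrowth g) {κ : ℝ}
    (hκ : 0 < κ) {t : ℝ} (ht : 0 ≤ t) :
    pathOU κ g t = Real.exp (-(t * κ)) * pathOU κ g 0 +
      rsIntegral (fun u => Real.exp (-((t - u) * κ))) g 0 t := by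
  have hint := hp.integrableOn hg hκ t
  -- Cutting at v = t separates the noise after time 0 from the past; the past part is e^{-tκ} times
  -- the integral that defines the value at time 0.
  have hsplit : ∫ v in Ioi (0 : ℝ), (Real.exp (-(κ * v)) : ℂ) * g (t - v) =
      (∫ v in (0 : ℝ)..t, (Real.exp (-(κ * v)) : ℂ) * g (t - v)) +
        ∫ v in Ioi t, (Real.exp (-(κ * v)) : ℂ) * g (t - v) :=
    (intervalIntegral.integral_interval_add_Ioi hint
      (hint.mono_set (Ioi_subset_Ioi ht))).symm
  have hshift : ∫ v in Ioi t, (Real.exp (-(κ * v)) : ℂ) * g (t - v) =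
      Real.exp (-(t * κ)) * ∫ v in Ioi (0 : ℝ), (Real.exp (-(κ * v)) : ℂ) * g (0 - v) := by
    have := setIntegral_Ioi_add_right (fun v => (Real.exp (-(κ * v)) : ℂ) * g (t - v)) t
    rw [← this, ← integral_const_mul]
    refine integral_congr_ae (ae_of_all _ fun v => ?_)
    simp only
    rw [show t - (v + t) = 0 - v by ring, show -(κ * (v + t)) = -(t * κ) + -(κ * v) by ring,
      Real.exp_add]
    push_cast
    ring
  have hfin : ∫ u in (0 : ℝ)..t, ((κ * Real.exp (-((t - u) * κ)) : ℝ) : ℂ) * g u =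
      κ * ∫ v in (0 : ℝ)..t, (Real.exp (-(κ * v)) : ℂ) * g (t - v) := by
    have := intervalIntegral.integral_comp_sub_left
      (fun u => ((κ * Real.exp (-((t - u) * κ)) : ℝ) : ℂ) * g u) t (a := 0) (b := t)
    rw [sub_zero, sub_self] at this
    rw [← this, ← intervalIntegral.integral_const_mul]
    refine intervalIntegral.integral_congr fun v _ => ?_
    simp only [sub_sub_cancel]
    push_cast
    rw [mul_comm (κ : ℂ) v]
    ring
  rw [rsIntegral_exp hg t κ ht, pathOU, pathOU, hsplit, hshift, hfin]
  simp
  ring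

end FracField

namespace FracField

/-! ### A Kolmogorov–Chentsov theorem -/

/-- The deterministic half of chaining: `π n x` is a discretization of x at scale 2^{-n}.
Neighbouring levels differ geometrically, so the values converge along the chain, and two points are
compared at the level matching their distance. The limit is written as a `limsup` so that it is
defined, and measurable, with no convergence assumption. -/
theorem exists_holder_of_chain {T : Type*} [PseudoMetricSpace T] {π : ℕ → T → T} {y : T → ℝ}
    {B : Set T} {ε K : ℝ} (hε : 0 < ε) (hK : 0 ≤ K)
    (h₁ : ∀ n, ∀ x ∈ B, |y (π n x) - y (π (n + 1) x)| ≤ K * ((1 / 2 : ℝ) ^ ε) ^ n)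
    (h₂ : ∀ n, ∀ x ∈ B, ∀ x' ∈ B, dist x x' ≤ (1 / 2) ^ n →
      |y (π n x) - y (π n x')| ≤ K * ((1 / 2 : ℝ) ^ ε) ^ n)
    (h₃ : ∀ x ∈ B, ∀ x' ∈ B, |y (π 0 x) - y (π 0 x')| ≤ K) :
    (∀ x ∈ B, ∃ l, Tendsto (fun n => y (π n x)) atTop (𝓝 l)) ∧
      ∃ C : ℝ≥0, HolderOnWith C ⟨ε, hε.le⟩ (fun x => limsup (fun n => y (π n x)) atTop) B := by
  set q : ℝ := (1 / 2 : ℝ) ^ ε with hq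
  have hq0 : 0 < q := by positivity
  have hq1 : q < 1 := Real.rpow_lt_one (by norm_num) (by norm_num) hε
  have hconv : ∀ x ∈ B, ∃ l, Tendsto (fun n => y (π n x)) atTop (𝓝 l) := fun x hx =>
    cauchySeq_tendsto_of_complete
      (cauchySeq_of_le_geometric q K hq1 fun n => by rw [Real.dist_eq]; exact h₁ n x hx)
  refine ⟨hconv, ?_⟩
  set Z : T → ℝ := fun x => limsup (fun n => y (π n x)) atTop with hZ
  have hlim : ∀ x ∈ B, Tendsto (fun n => y (π n x)) atTop (𝓝 (Z x)) := fun x hx => by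
    obtain ⟨l, hl⟩ := hconv x hx
    have : Z x = l := hl.limsup_eq
    rwa [this]
  have htail : ∀ x ∈ B, ∀ n, |y (π n x) - Z x| ≤ K * q ^ n / (1 - q) := fun x hx n => by
    rw [← Real.dist_eq]
    exact dist_le_of_le_geometric_of_tendsto q K hq1
      (fun n => by rw [Real.dist_eq]; exact h₁ n x hx) (hlim x hx) n
  set K' : ℝ := 2 * K / (1 - q) + K with hK'
  have hK'0 : 0 ≤ K' := by have := sub_pos.2 hq1; positivity
  have hstep : ∀ x ∈ B, ∀ x' ∈ B, ∀ n, |y (π n x) - y (π n x')| ≤ K * q ^ n →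
      |Z x - Z x'| ≤ K' * q ^ n := fun x hx x' hx' n h => by
    have e : Z x - Z x' = -(y (π n x) - Z x) + (y (π n x) - y (π n x')) + (y (π n x') - Z x') := by
      ring
    rw [e]
    refine (abs_add_three _ _ _).trans ?_
    rw [abs_neg]
    have := htail x hx n
    have := htail x' hx' n
    have : K' * q ^ n = K * q ^ n / (1 - q) + K * q ^ n + K * q ^ n / (1 - q) := by
      rw [hK']; ring
    linarith
  have hdist : ∀ x ∈ B, ∀ x' ∈ B, |Z x - Z x'| ≤ K' / q * dist x x' ^ ε := by
    intro x hx x' hx'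
    have hKq : K' ≤ K' / q := le_div_self hK'0 hq0 hq1.le
    rcases lt_or_ge 1 (dist x x') with h1 | h1
    · have := hstep x hx x' hx' 0 (by simpa using h₃ x hx x' hx')
      have hd : 1 ≤ dist x x' ^ ε := Real.one_le_rpow h1.le hε.le
      rw [pow_zero, mul_one] at this
      nlinarith [div_nonneg hK'0 hq0.le]
    -- In a pseudometric space distinct points may have distance zero; they are then close at every
    -- level, and the limits coincide.
    rcases (dist_nonneg (x := x) (y := x')).eq_or_lt' with h0 | h0
    · have hz : Tendsto (fun n => K' * q ^ n) atTop (𝓝 0) := by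
        simpa using (tendsto_pow_atTop_nhds_zero_of_lt_one hq0.le hq1).const_mul K'
      have : |Z x - Z x'| ≤ 0 := ge_of_tendsto' hz fun n =>
        hstep x hx x' hx' n (h₂ n x hx x' hx' (h0.trans_le (by positivity)))
      rw [h0, Real.zero_rpow hε.ne', mul_zero]
      exact this
    · obtain ⟨n, hn1, hn2⟩ := exists_nat_pow_near_of_lt_one h0 h1 (y := 1 / 2) (by norm_num)
        (by norm_num)
      refine (hstep x hx x' hx' n (h₂ n x hx x' hx' hn2)).trans ?_
      have : q ^ (n + 1) ≤ dist x x' ^ ε := by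
        rw [hq, ← Real.rpow_natCast, ← Real.rpow_mul (by norm_num), mul_comm,
          Real.rpow_mul (by norm_num), Real.rpow_natCast]
        exact Real.rpow_le_rpow (by positivity) hn1.le hε.le
      calc K' * q ^ n = K' / q * q ^ (n + 1) := by rw [pow_succ]; field_simp
        _ ≤ _ := by gcongr
  refine ⟨⟨K' / q, by positivity⟩, fun x hx x' hx' => ?_⟩
  rw [edist_dist, edist_dist, Real.dist_eq]
  refine (ENNReal.ofReal_le_ofReal (hdist x hx x' hx')).trans ?_
  rw [ENNReal.ofReal_mul (by positivity), ← ENNReal.ofReal_rpow_of_nonneg dist_nonneg hε.le]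
  rw [ENNReal.ofReal_eq_coe_nnreal (div_nonneg hK'0 hq0.le)]
  rfl

variable {Ω : Type*} [MeasurableSpace Ω] {T : Type*} [PseudoMetricSpace T]

/-- All moments of the increments of `Y` scale like `dist ^ θ`. -/
def HasMomentBound (P : Measure Ω) (Y : T → Ω → ℝ) (θ : ℝ) : Prop :=
  ∀ p : ℕ, ∃ M : ℝ≥0, ∀ x y, ∫⁻ ω, ‖Y x ω - Y y ω‖ₑ ^ p ∂P ≤ M * ENNReal.ofReal (dist x y ^ (θ * p))

/-- There are at most (C 2^{dn})² pairs at level n, each with p-th moment of order 2^{-nθp}. For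
large p the sums of |increment|^p over close pairs, weighted by 2^{εpn}, have summable expectations;
so the weighted total is almost surely finite and controls every single increment. -/
theorem ae_exists_chain_bound {P : Measure Ω} {Y : T → Ω → ℝ} (hY : ∀ x, Measurable (Y x)) {θ : ℝ}
    (hmom : HasMomentBound P Y θ) {s : ℕ → Finset T} {d C : ℕ}
    (hs : ∀ n, (s n).card ≤ C * 2 ^ (d * n)) {ε : ℝ} (hε : 0 < ε) (hεθ : ε < θ) :
    ∀ᵐ ω ∂P, ∃ K : ℝ, 0 ≤ K ∧ ∀ n, ∀ x ∈ s n, ∀ y ∈ s n, dist x y ≤ 3 * (1 / 2) ^ n →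
      |Y x ω - Y y ω| ≤ K * ((1 / 2 : ℝ) ^ ε) ^ n := by
  classical
  have hθ : 0 < θ := hε.trans hεθ
  -- With p(θ - ε) > 2d + 1 the expectation at level n is at most a constant times 2^{-n}.
  obtain ⟨p, hp⟩ := exists_nat_gt ((2 * d + 1) / (θ - ε))
  rw [div_lt_iff₀ (sub_pos.2 hεθ)] at hp
  have hp0 : 0 < p := by
    rcases Nat.eq_zero_or_pos p with rfl | h
    · simp only [CharP.cast_eq_zero, zero_mul] at hp
      have : (0 : ℝ) ≤ d := d.cast_nonneg
      linarith
    · exact h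
  obtain ⟨M, hM⟩ := hmom p
  set R : ℕ → Ω → ℝ≥0∞ := fun n ω => ∑ z ∈ (s n ×ˢ s n).filter
    (fun z => dist z.1 z.2 ≤ 3 * (1 / 2) ^ n), ‖Y z.1 ω - Y z.2 ω‖ₑ ^ p with hR
  have hRm : ∀ n, Measurable (R n) := fun n => Finset.measurable_sum _ fun z _ =>
    (((hY z.1).sub (hY z.2)).enorm.pow_const p)
  have hRint : ∀ n : ℕ, ∫⁻ ω, ENNReal.ofReal ((2 : ℝ) ^ (ε * p * n)) * R n ω ∂P ≤
      ENNReal.ofReal (C ^ 2 * M * 3 ^ (θ * p) * (1 / 2) ^ n) := by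
    intro n
    rw [lintegral_const_mul _ (hRm n), hR,
      lintegral_finsetSum _ fun z _ => ((hY z.1).sub (hY z.2)).enorm.pow_const p]
    calc _ ≤ ENNReal.ofReal ((2 : ℝ) ^ (ε * p * n)) * ∑ z ∈ (s n ×ˢ s n).filter
          (fun z => dist z.1 z.2 ≤ 3 * (1 / 2) ^ n),
            ENNReal.ofReal (M * (3 * (1 / 2) ^ n) ^ (θ * p)) := by
          gcongr with z hz
          refine (hM _ _).trans ?_
          rw [ENNReal.ofReal_mul M.coe_nonneg, ENNReal.ofReal_coe_nnreal]
          gcongr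
          exact (Finset.mem_filter.1 hz).2
      _ ≤ ENNReal.ofReal ((2 : ℝ) ^ (ε * p * n)) * (ENNReal.ofReal ((C * 2 ^ (d * n)) ^ 2) *
            ENNReal.ofReal (M * (3 * (1 / 2) ^ n) ^ (θ * p))) := by
          rw [Finset.sum_const, nsmul_eq_mul]
          gcongr
          rw [← ENNReal.ofReal_natCast]
          refine ENNReal.ofReal_le_ofReal ?_
          have h1 : ((s n ×ˢ s n).filter
              (fun z => dist z.1 z.2 ≤ 3 * (1 / 2) ^ n)).card ≤ (C * 2 ^ (d * n)) ^ 2 := by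
            refine (Finset.card_filter_le _ _).trans ?_
            rw [Finset.card_product, sq]
            exact Nat.mul_le_mul (hs n) (hs n)
          exact_mod_cast h1
      _ = ENNReal.ofReal (C ^ 2 * M * 3 ^ (θ * p) *
            ((2 : ℝ) ^ (ε * p * n) * (2 ^ (d * n)) ^ 2 * ((1 / 2) ^ n) ^ (θ * p))) := by
          rw [← ENNReal.ofReal_mul (by positivity), ← ENNReal.ofReal_mul (by positivity)]
          congr 1
          rw [Real.mul_rpow (by norm_num) (by positivity)]
          ring
      _ ≤ _ := by
          refine ENNReal.ofReal_le_ofReal (mul_le_mul_of_nonneg_left ?_ (by positivity))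
          have e1 : ((2 : ℝ) ^ (d * n)) ^ 2 = 2 ^ (2 * d * n : ℝ) := by
            rw [← pow_mul, ← Real.rpow_natCast]; push_cast; ring_nf
          have e2 : (((1 : ℝ) / 2) ^ n) ^ (θ * p) = 2 ^ (-(θ * p * n)) := by
            rw [one_div, inv_pow, ← Real.rpow_natCast, ← Real.rpow_neg (by norm_num),
              ← Real.rpow_mul (by norm_num)]
            ring_nf
          have e3 : ((1 : ℝ) / 2) ^ n = 2 ^ (-(n : ℝ)) := by
            rw [one_div, inv_pow, ← Real.rpow_natCast, ← Real.rpow_neg (by norm_num)]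
          rw [e1, e2, e3, ← Real.rpow_add (by norm_num), ← Real.rpow_add (by norm_num)]
          refine Real.rpow_le_rpow_of_exponent_le (by norm_num) ?_
          nlinarith [n.cast_nonneg (α := ℝ)]
  have hfin : ∑' n : ℕ, ∫⁻ ω, ENNReal.ofReal ((2 : ℝ) ^ (ε * p * n)) * R n ω ∂P ≠ ∞ := by
    refine ne_top_of_le_ne_top ?_ (ENNReal.tsum_le_tsum hRint)
    have hsm : Summable fun n : ℕ => (C : ℝ) ^ 2 * M * 3 ^ (θ * p) * (1 / 2) ^ n :=
      (summable_geometric_two).mul_left _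
    rw [← ENNReal.ofReal_tsum_of_nonneg (fun n => by positivity) hsm]
    exact ENNReal.ofReal_ne_top
  rw [← lintegral_tsum fun n => ((hRm n).const_mul _).aemeasurable] at hfin
  filter_upwards [ae_lt_top (Measurable.tsum fun n => (hRm n).const_mul _) hfin] with ω hω
  set A := ∑' n : ℕ, ENNReal.ofReal ((2 : ℝ) ^ (ε * p * n)) * R n ω with hA
  -- The maximum with 1 ensures K ≤ K^p, so no p-th root has to be taken.
  refine ⟨max 1 A.toReal, by positivity, fun n x hx y hy hxy => ?_⟩
  have h1 : ENNReal.ofReal ((2 : ℝ) ^ (ε * p * n)) * ‖Y x ω - Y y ω‖ₑ ^ p ≤ A := by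
    refine le_trans ?_ (ENNReal.le_tsum n)
    gcongr
    exact Finset.single_le_sum (f := fun z : T × T => ‖Y z.1 ω - Y z.2 ω‖ₑ ^ p)
      (fun _ _ => zero_le) (Finset.mem_filter.2 ⟨Finset.mk_mem_product hx hy, hxy⟩)
  have h2 : (2 : ℝ) ^ (ε * p * n) * |Y x ω - Y y ω| ^ p ≤ A.toReal := by
    have := ENNReal.toReal_mono hω.ne h1
    rwa [ENNReal.toReal_mul, ENNReal.toReal_ofReal (by positivity), ENNReal.toReal_pow,
      toReal_enorm, Real.norm_eq_abs] at this
  refine le_of_pow_le_pow_left₀ hp0.ne' (by positivity) ?_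
  have e : (((1 / 2 : ℝ) ^ ε) ^ n) ^ p = ((2 : ℝ) ^ (ε * p * n))⁻¹ := by
    rw [one_div, Real.inv_rpow (by norm_num), inv_pow, inv_pow, ← Real.rpow_natCast,
      ← Real.rpow_natCast, ← Real.rpow_mul (by positivity), ← Real.rpow_mul (by positivity)]
    ring_nf
  rw [mul_pow, e, ← div_eq_mul_inv, le_div_iff₀ (by positivity), mul_comm]
  refine h2.trans ((le_max_right 1 _).trans ?_)
  exact le_self_pow₀ (le_max_left _ _) hp0.ne'

/-- The probabilistic bound is fed into the deterministic chaining lemma, with one null set valid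
for all exponents below θ. -/
theorem ae_holder_of_momentBound {P : Measure Ω} {Y : T → Ω → ℝ} (hY : ∀ x, Measurable (Y x))
    {θ : ℝ} (hθ : 0 < θ) (hmom : HasMomentBound P Y θ) {π : ℕ → T → T}
    (hπ : ∀ n x, dist (π n x) x ≤ (1 / 2) ^ n) {B : Set T} {d C : ℕ}
    (hB : ∀ n, ∃ s : Finset T, (∀ x ∈ B, π n x ∈ s) ∧ s.card ≤ C * 2 ^ (d * n)) :
    ∀ᵐ ω ∂P, (∀ x ∈ B, ∃ l, Tendsto (fun n => Y (π n x) ω) atTop (𝓝 l)) ∧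
      ∀ ε : ℝ≥0, 0 < ε → (ε : ℝ) < θ →
        ∃ C : ℝ≥0, HolderOnWith C ε (fun x => limsup (fun n => Y (π n x) ω) atTop) B := by
  classical
  choose s hsB hsc using hB
  -- A chain step joins a point of level n to one of level n + 1, so both levels have to lie in the
  -- finite set on which increments are controlled.
  have hs' : ∀ n, (s n ∪ s (n + 1)).card ≤ (C + C * 2 ^ d) * 2 ^ (d * n) := fun n => by
    refine (Finset.card_union_le _ _).trans ((add_le_add (hsc n) (hsc (n + 1))).trans (le_of_eq ?_))
    rw [mul_add, mul_one, pow_add]; ring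
  have key : ∀ ε : ℝ, 0 < ε → ε < θ → ∀ᵐ ω ∂P,
      (∀ x ∈ B, ∃ l, Tendsto (fun n => Y (π n x) ω) atTop (𝓝 l)) ∧
      ∀ ε' : ℝ≥0, 0 < ε' → (ε' : ℝ) ≤ ε →
        ∃ C : ℝ≥0, HolderOnWith C ε' (fun x => limsup (fun n => Y (π n x) ω) atTop) B := by
    intro ε hε hεθ
    filter_upwards [ae_exists_chain_bound hY hmom hs' hε hεθ] with ω ⟨K, hK, h⟩
    set K₀ := ∑ z ∈ s 0 ×ˢ s 0, |Y z.1 ω - Y z.2 ω| with hK₀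
    have hK₀0 : 0 ≤ K₀ := Finset.sum_nonneg fun _ _ => abs_nonneg _
    have main : ∀ ε' : ℝ, ∀ hε' : 0 < ε', ε' ≤ ε →
        (∀ x ∈ B, ∃ l, Tendsto (fun n => Y (π n x) ω) atTop (𝓝 l)) ∧ ∃ C : ℝ≥0,
          HolderOnWith C ⟨ε', hε'.le⟩ (fun x => limsup (fun n => Y (π n x) ω) atTop) B := by
      intro ε' hε' hle
      have hpow : ∀ n : ℕ, K * ((1 / 2 : ℝ) ^ ε) ^ n ≤ (K + K₀) * ((1 / 2 : ℝ) ^ ε') ^ n := by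
        intro n
        have : (1 / 2 : ℝ) ^ ε ≤ (1 / 2 : ℝ) ^ ε' :=
          Real.rpow_le_rpow_of_exponent_ge (by norm_num) (by norm_num) hle
        gcongr
        linarith
      have hdd : ∀ n x, dist (π n x) (π (n + 1) x) ≤ 3 * (1 / 2) ^ n := fun n x => by
        refine (dist_triangle_right _ _ x).trans ?_
        have h1 := hπ n x
        have h2 := hπ (n + 1) x
        rw [pow_succ] at h2
        have : (0 : ℝ) < (1 / 2) ^ n := by positivity
        linarith
      refine exists_holder_of_chain (y := fun x => Y x ω) hε' (add_nonneg hK hK₀0)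
        (fun n x hx => ?_) (fun n x hx x' hx' hxx' => ?_) (fun x hx x' hx' => ?_)
      · exact (h n _ (Finset.mem_union_left _ (hsB n x hx)) _
          (Finset.mem_union_right _ (hsB (n + 1) x hx)) (hdd n x)).trans (hpow n)
      · refine (h n _ (Finset.mem_union_left _ (hsB n x hx)) _
          (Finset.mem_union_left _ (hsB n x' hx')) ?_).trans (hpow n)
        have := dist_triangle4 (π n x) x x' (π n x')
        have h1 := hπ n x
        have h2 := hπ n x'
        rw [dist_comm] at h2
        linarith
      · have := Finset.single_le_sum (f := fun z : T × T => |Y z.1 ω - Y z.2 ω|)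
          (fun _ _ => abs_nonneg _) (Finset.mk_mem_product (hsB 0 x hx) (hsB 0 x' hx'))
        exact this.trans (by linarith)
    exact ⟨(main ε hε le_rfl).1, fun ε' h0 hle => (main ε' h0 hle).2⟩
  -- Countably many exponents θ(1 - 1/(j+2)) increasing to θ suffice; each smaller exponent is
  -- dominated by one of them.
  have hj : ∀ᵐ ω ∂P, ∀ j : ℕ, (∀ x ∈ B, ∃ l, Tendsto (fun n => Y (π n x) ω) atTop (𝓝 l)) ∧
      ∀ ε' : ℝ≥0, 0 < ε' → (ε' : ℝ) ≤ θ * (1 - 1 / (j + 2)) →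
        ∃ C : ℝ≥0, HolderOnWith C ε' (fun x => limsup (fun n => Y (π n x) ω) atTop) B := by
    refine ae_all_iff.2 fun j => key _ ?_ ?_
    · have : (1 : ℝ) / (j + 2) < 1 := by
        rw [div_lt_one (by positivity)]
        have : (0 : ℝ) ≤ j := j.cast_nonneg
        linarith
      exact mul_pos hθ (sub_pos.2 this)
    · have : (0 : ℝ) < 1 / (j + 2) := by positivity
      nlinarith
  filter_upwards [hj] with ω h
  refine ⟨(h 0).1, fun ε h0 hlt => ?_⟩
  have : Tendsto (fun j : ℕ => θ * (1 - 1 / ((j : ℝ) + 2))) atTop (𝓝 (θ * (1 - 0))) := by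
    refine ((tendsto_const_nhds.sub ?_).const_mul θ)
    simp_rw [one_div]
    exact tendsto_inv_atTop_zero.comp (tendsto_atTop_add_const_right _ _ tendsto_natCast_atTop_atTop)
  rw [sub_zero, mul_one] at this
  obtain ⟨j, hj⟩ := (this.eventually (lt_mem_nhds hlt)).exists
  exact (h j).2 ε h0 hj.le

/-- The first moment bound gives L¹ convergence along the chain, hence almost sure convergence to Y
x along a subsequence; since the full sequence converges, its limit must be Y x. -/
theorem ae_eq_limsup_of_momentBound {P : Measure Ω} {Y : T → Ω → ℝ} (hY : ∀ x, Measurable (Y x))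
    {θ : ℝ} (hθ : 0 < θ) (hmom : HasMomentBound P Y θ) {π : ℕ → T → T}
    (hπ : ∀ n x, dist (π n x) x ≤ (1 / 2) ^ n) {x : T}
    (hconv : ∀ᵐ ω ∂P, ∃ l, Tendsto (fun n => Y (π n x) ω) atTop (𝓝 l)) :
    (fun ω => limsup (fun n => Y (π n x) ω) atTop) =ᵐ[P] Y x := by
  obtain ⟨M, hM⟩ := hmom 1
  have hL1 : Tendsto (fun n => eLpNorm (Y (π n x) - Y x) 1 P) atTop (𝓝 0) := by
    have hz : Tendsto (fun n : ℕ => (M : ℝ≥0∞) * ENNReal.ofReal (((1 / 2 : ℝ) ^ n) ^ θ)) atTop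
        (𝓝 0) := by
      have : Tendsto (fun n : ℕ => ((1 / 2 : ℝ) ^ n) ^ θ) atTop (𝓝 0) := by
        have := (tendsto_pow_atTop_nhds_zero_of_lt_one (r := (1 / 2 : ℝ)) (by norm_num)
          (by norm_num)).rpow_const (p := θ) (Or.inr hθ.le)
        rwa [Real.zero_rpow hθ.ne'] at this
      have := ENNReal.Tendsto.const_mul (a := (M : ℝ≥0∞)) (ENNReal.tendsto_ofReal this)
        (Or.inr ENNReal.coe_ne_top)
      simpa using this
    refine tendsto_of_tendsto_of_tendsto_of_le_of_le tendsto_const_nhds hz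
      (fun _ => zero_le) fun n => ?_
    rw [eLpNorm_one_eq_lintegral_enorm]
    have := hM (π n x) x
    simp only [pow_one, Nat.cast_one, mul_one] at this
    refine this.trans ?_
    gcongr
    exact hπ n x
  obtain ⟨ns, hns, hae⟩ := (tendstoInMeasure_of_tendsto_eLpNorm one_ne_zero
    (fun n => (hY _).aestronglyMeasurable) (hY x).aestronglyMeasurable hL1).exists_seq_tendsto_ae
  filter_upwards [hconv, hae] with ω ⟨l, hl⟩ h
  rw [hl.limsup_eq]
  exact tendsto_nhds_unique (hl.comp hns.tendsto_atTop) h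

end FracField

namespace FracField

/-! ### Fractional Brownian curves in Hilbert space -/

section Hilbert

variable {E : Type*} [NormedAddCommGroup E] [InnerProductSpace ℂ E]

local notation "⟪" x ", " y "⟫" => inner ℂ x y

/-- Covariance of fractional Brownian motion. -/
noncomputable def fbmCov (H s t : ℝ) : ℝ := (|t| ^ (2 * H) + |s| ^ (2 * H) - |t - s| ^ (2 * H)) / 2

/-- A curve in Hilbert space with the covariance of fractional Brownian motion. -/
def IsFBMCurve (H : ℝ) (b : ℝ → E) : Prop := ∀ s t, ⟪b s, b t⟫ = (fbmCov H s t : ℂ)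

theorem IsFBMCurve.inner_sub_sub {H : ℝ} {b : ℝ → E} (hb : IsFBMCurve H b) (p q r s : ℝ) :
    ⟪b p - b q, b r - b s⟫ = ((|r - q| ^ (2 * H) + |s - p| ^ (2 * H) - |r - p| ^ (2 * H) -
      |s - q| ^ (2 * H)) / 2 : ℝ) := by
  simp only [inner_sub_left, inner_sub_right, hb _ _, fbmCov]
  push_cast
  ring

theorem IsFBMCurve.norm_sub {H : ℝ} (hH : 0 < H) {b : ℝ → E} (hb : IsFBMCurve H b) (s t : ℝ) :
    ‖b t - b s‖ = |t - s| ^ H := by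
  have h := hb.inner_sub_sub t s t s
  rw [inner_self_eq_norm_sq_to_K] at h
  have h' : ‖b t - b s‖ ^ 2 = (|t - s| ^ H) ^ 2 := by
    have h2 : (‖b t - b s‖ ^ 2 : ℝ) = (|t - s| ^ (2 * H) + |s - t| ^ (2 * H) - |t - t| ^ (2 * H) -
      |s - s| ^ (2 * H)) / 2 :=
      Complex.ofReal_injective (by push_cast at h ⊢; exact h)
    rw [h2, abs_sub_comm s t, sub_self, sub_self, abs_zero, Real.zero_rpow (by positivity),
      ← Real.rpow_natCast, ← Real.rpow_mul (abs_nonneg _)]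
    push_cast
    ring_nf
  exact (pow_left_inj₀ (norm_nonneg _) (by positivity) two_ne_zero).1 h'

theorem IsFBMCurve.zero {H : ℝ} (hH : 0 < H) {b : ℝ → E} (hb : IsFBMCurve H b) : b 0 = 0 := by
  have h := hb 0 0
  rw [fbmCov, sub_self, abs_zero, Real.zero_rpow (by positivity)] at h
  simpa using h

theorem IsFBMCurve.continuous {H : ℝ} (hH : 0 < H) {b : ℝ → E} (hb : IsFBMCurve H b) :
    Continuous b := by
  rw [continuous_iff_continuousAt]
  intro s
  rw [ContinuousAt, tendsto_iff_norm_sub_tendsto_zero]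
  simp_rw [hb.norm_sub hH]
  have : ContinuousAt (fun t : ℝ => |t - s| ^ H) s :=
    (continuous_id.sub continuous_const).abs.continuousAt.rpow_const (Or.inr hH.le)
  have h := this.tendsto
  simp only [sub_self, abs_zero, Real.zero_rpow hH.ne'] at h
  exact h

theorem integrableOn_exp_mul_rpow {κ s : ℝ} (hκ : 0 < κ) (hs : 0 ≤ s) :
    IntegrableOn (fun v : ℝ => Real.exp (-(κ * v)) * v ^ s) (Ioi 0) := by
  have h := integrableOn_rpow_mul_exp_neg_mul_rpow (s := s) (p := 1) (b := κ)
    (by linarith) one_pos hκ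
  refine h.congr_fun (fun v _ => ?_) measurableSet_Ioi
  simp [mul_comm]

theorem integral_exp_mul_rpow {κ s : ℝ} (hκ : 0 < κ) (hs : 0 ≤ s) :
    ∫ v in Ioi (0 : ℝ), Real.exp (-(κ * v)) * v ^ s = κ ^ (-(s + 1)) * Real.Gamma (s + 1) := by
  have h := Real.integral_rpow_mul_exp_neg_mul_Ioi (a := s + 1) (by linarith) hκ
  rw [one_div, Real.inv_rpow hκ.le, ← Real.rpow_neg hκ.le] at h
  rw [← h]
  refine integral_congr_ae (ae_of_all _ fun v => ?_)
  simp [mul_comm]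

theorem norm_exp_smul (κ v : ℝ) (x : E) :
    ‖(Real.exp (-(κ * v)) : ℂ) • x‖ = Real.exp (-(κ * v)) * ‖x‖ := by
  rw [norm_smul, Complex.norm_real, Real.norm_eq_abs, Real.abs_exp]

variable [CompleteSpace E]

/-- The stationary Ornstein–Uhlenbeck curve driven by `b`. -/
noncomputable def ouVec (κ : ℝ) (b : ℝ → E) (t : ℝ) : E :=
  b t - (κ : ℂ) • ∫ v in Ioi (0 : ℝ), (Real.exp (-(κ * v)) : ℂ) • b (t - v)

section

variable {H κ : ℝ} (hH : 0 < H) (hκ : 0 < κ) {b : ℝ → E} (hb : IsFBMCurve H b)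
include hH hκ hb

omit [CompleteSpace E] in
theorem IsFBMCurve.integrableOn_increment (t : ℝ) :
    IntegrableOn (fun v : ℝ => (Real.exp (-(κ * v)) : ℂ) • (b t - b (t - v))) (Ioi 0) := by
  have hc := hb.continuous hH
  refine Integrable.mono' (integrableOn_exp_mul_rpow hκ hH.le)
    (Continuous.aestronglyMeasurable (by fun_prop)) ?_
  filter_upwards [ae_restrict_mem measurableSet_Ioi] with v hv
  rw [norm_exp_smul, hb.norm_sub hH, sub_sub_cancel, abs_of_pos hv]

omit [CompleteSpace E] in
theorem IsFBMCurve.integrableOn (t : ℝ) :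
    IntegrableOn (fun v : ℝ => (Real.exp (-(κ * v)) : ℂ) • b (t - v)) (Ioi 0) := by
  have h0 : IntegrableOn (fun v : ℝ => (Real.exp (-(κ * v)) : ℂ) • b t) (Ioi 0) := by
    have := integrableOn_exp_mul_rpow hκ le_rfl
    simp only [Real.rpow_zero, mul_one] at this
    exact (this.ofReal (𝕜 := ℂ)).smul_const _
  refine (h0.sub (hb.integrableOn_increment hH hκ t)).congr (ae_of_all _ fun v => ?_)
  simp [smul_sub]

/-- Since κ e^{-κv} is a probability density on v > 0, the term b(t) can be moved under the
integral. Only increments remain, of norm v^H and with stationary covariances. -/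
theorem IsFBMCurve.ouVec_eq (t : ℝ) :
    ouVec κ b t = (κ : ℂ) • ∫ v in Ioi (0 : ℝ), (Real.exp (-(κ * v)) : ℂ) • (b t - b (t - v)) := by
  have h0 : IntegrableOn (fun v : ℝ => (Real.exp (-(κ * v)) : ℂ)) (Ioi 0) := by
    have := integrableOn_exp_mul_rpow hκ le_rfl
    simp only [Real.rpow_zero, mul_one] at this
    exact (this.ofReal (𝕜 := ℂ))
  have h1 : ∫ v in Ioi (0 : ℝ), (Real.exp (-(κ * v)) : ℂ) = (κ : ℂ)⁻¹ := by
    rw [integral_complex_ofReal]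
    have := integral_exp_mul_rpow hκ (le_refl 0)
    simp only [Real.rpow_zero, mul_one, zero_add, Real.Gamma_one, Real.rpow_neg_one] at this
    rw [this, Complex.ofReal_inv]
  simp_rw [smul_sub]
  rw [integral_sub (h0.smul_const _) (hb.integrableOn hH hκ t), integral_smul_const, h1, smul_sub,
    smul_smul, mul_inv_cancel₀ (by exact_mod_cast hκ.ne'), one_smul, ouVec]

theorem IsFBMCurve.norm_ouVec_le (t : ℝ) : ‖ouVec κ b t‖ ≤ Real.Gamma (H + 1) * κ ^ (-H) := by
  rw [hb.ouVec_eq hH hκ, norm_smul, Complex.norm_real, Real.norm_of_nonneg hκ.le]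
  have h := norm_integral_le_of_norm_le (integrableOn_exp_mul_rpow hκ hH.le)
    (f := fun v : ℝ => (Real.exp (-(κ * v)) : ℂ) • (b t - b (t - v))) (by
      filter_upwards [ae_restrict_mem measurableSet_Ioi] with v hv
      rw [norm_exp_smul, hb.norm_sub hH, sub_sub_cancel, abs_of_pos hv])
  rw [integral_exp_mul_rpow hκ hH.le] at h
  refine (mul_le_mul_of_nonneg_left h hκ.le).trans (le_of_eq ?_)
  rw [show -H = 1 + -(H + 1) by ring, Real.rpow_add hκ, Real.rpow_one]
  ring

/-- The averaging kernel has total mass 1, so the convolution inherits the modulus of continuity of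
b; the constant 2 does not depend on κ. -/
theorem IsFBMCurve.norm_ouVec_sub_le (s t : ℝ) :
    ‖ouVec κ b t - ouVec κ b s‖ ≤ 2 * |t - s| ^ H := by
  have e : ouVec κ b t - ouVec κ b s = (b t - b s) - (κ : ℂ) • ∫ v in Ioi (0 : ℝ),
      (Real.exp (-(κ * v)) : ℂ) • (b (t - v) - b (s - v)) := by
    simp_rw [smul_sub]
    rw [integral_sub (hb.integrableOn hH hκ t) (hb.integrableOn hH hκ s), smul_sub, ouVec, ouVec]
    abel
  have h0 := integrableOn_exp_mul_rpow hκ le_rfl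
  have h1 := integral_exp_mul_rpow hκ (le_refl 0)
  simp only [Real.rpow_zero, mul_one, zero_add, Real.Gamma_one, Real.rpow_neg_one] at h0 h1
  have h := norm_integral_le_of_norm_le (h0.mul_const (|t - s| ^ H))
    (f := fun v : ℝ => (Real.exp (-(κ * v)) : ℂ) • (b (t - v) - b (s - v))) (by
      refine ae_of_all _ fun v => ?_
      rw [norm_exp_smul, hb.norm_sub hH, sub_sub_sub_cancel_right])
  rw [integral_mul_const, h1] at h
  rw [e]
  refine (norm_sub_le _ _).trans ?_
  rw [hb.norm_sub hH, norm_smul, Complex.norm_real, Real.norm_of_nonneg hκ.le]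
  have := mul_le_mul_of_nonneg_left h hκ.le
  rw [← mul_assoc, mul_inv_cancel₀ hκ.ne', one_mul] at this
  linarith

/-- In this explicit form s and t enter only through t - s, which yields stationarity in
`inner_ouVec_add`. -/
theorem IsFBMCurve.inner_ouVec (s t : ℝ) : ⟪ouVec κ b s, ouVec κ b t⟫ =
    (κ : ℂ) ^ 2 * ∫ w in Ioi (0 : ℝ), (Real.exp (-(κ * w)) : ℂ) * ∫ v in Ioi (0 : ℝ),
      (Real.exp (-(κ * v)) : ℂ) * ((|t - (s - v)| ^ (2 * H) + |t - w - s| ^ (2 * H) -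
        |t - s| ^ (2 * H) - |t - w - (s - v)| ^ (2 * H)) / 2 : ℝ) := by
  have h (x : E) : ⟪∫ v in Ioi (0 : ℝ), (Real.exp (-(κ * v)) : ℂ) • (b s - b (s - v)), x⟫ =
      ∫ v in Ioi (0 : ℝ), (Real.exp (-(κ * v)) : ℂ) * ⟪b s - b (s - v), x⟫ := by
    rw [← inner_conj_symm, ← integral_inner (hb.integrableOn_increment hH hκ s), ← integral_conj]
    refine integral_congr_ae (ae_of_all _ fun v => ?_)
    simp only [inner_smul_right, map_mul, Complex.conj_ofReal, inner_conj_symm]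
  rw [hb.ouVec_eq hH hκ, hb.ouVec_eq hH hκ, inner_smul_left, inner_smul_right,
    ← integral_inner (hb.integrableOn_increment hH hκ t), Complex.conj_ofReal, ← mul_assoc, ← sq]
  congr 1
  refine integral_congr_ae (ae_of_all _ fun w => ?_)
  simp only [inner_smul_right]
  rw [h]
  simp_rw [hb.inner_sub_sub]

theorem IsFBMCurve.inner_ouVec_add (s t r : ℝ) :
    ⟪ouVec κ b (s + r), ouVec κ b (t + r)⟫ = ⟪ouVec κ b s, ouVec κ b t⟫ := by
  rw [hb.inner_ouVec hH hκ, hb.inner_ouVec hH hκ]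
  simp_rw [show ∀ v, t + r - (s + r - v) = t - (s - v) by intro v; ring,
    show ∀ w, t + r - w - (s + r) = t - w - s by intro w; ring,
    show t + r - (s + r) = t - s by ring,
    show ∀ w v, t + r - w - (s + r - v) = t - w - (s - v) by intro w v; ring]

end

/-- The value at t is built from the past of b up to t. This single fact gives orthogonality of
modes, membership in the Gaussian span and adaptedness, each by a suitable choice of closed
subspace. The proof tests against the orthogonal complement; a non-integrable integrand has integral
0 and causes no harm. -/
theorem ouVec_mem {b : ℝ → E} {K : Submodule ℂ E} (hK : IsClosed (K : Set E)) {t : ℝ}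
    (h : ∀ u ≤ t, b u ∈ K) (κ : ℝ) : ouVec κ b t ∈ K := by
  have : CompleteSpace K := hK.completeSpace_coe
  refine K.sub_mem (h t le_rfl) (K.smul_mem _ ?_)
  by_cases hi : IntegrableOn (fun v : ℝ => (Real.exp (-(κ * v)) : ℂ) • b (t - v)) (Ioi 0)
  · rw [← K.orthogonal_orthogonal, Submodule.mem_orthogonal]
    intro y hy
    rw [← integral_inner hi]
    refine setIntegral_eq_zero_of_forall_eq_zero fun v hv => ?_
    rw [inner_smul_right, (Submodule.mem_orthogonal' _ _).1 hy _
      (h _ (by have : (0 : ℝ) < v := hv; linarith)), mul_zero]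
  · rw [integral_undef hi]
    exact K.zero_mem

theorem inner_ouVec_eq_zero {b b' : ℝ → E} (h : ∀ s t, ⟪b s, b' t⟫ = 0) (κ κ' s t : ℝ) :
    ⟪ouVec κ b s, ouVec κ' b' t⟫ = 0 := by
  have h1 : ∀ u, ouVec κ b s ∈ (ℂ ∙ b' u)ᗮ := fun u =>
    ouVec_mem (Submodule.isClosed_orthogonal _) (fun v _ => by
      rw [Submodule.mem_orthogonal_singleton_iff_inner_left]; exact h v u) κ
  have h2 : ouVec κ' b' t ∈ (ℂ ∙ ouVec κ b s)ᗮ :=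
    ouVec_mem (Submodule.isClosed_orthogonal _) (fun v _ => by
      rw [Submodule.mem_orthogonal_singleton_iff_inner_right]
      exact (Submodule.mem_orthogonal_singleton_iff_inner_left).1 (h1 v)) κ'
  exact (Submodule.mem_orthogonal_singleton_iff_inner_right).1 h2

/-! ### Sums of orthogonal vectors -/

theorem summable_of_orthogonal {ι : Type*} {x : ι → E} (h : Pairwise fun k l => ⟪x k, x l⟫ = 0)
    (hs : Summable fun k => ‖x k‖ ^ 2) : Summable x := by
  have hV : OrthogonalFamily ℂ (fun k => (ℂ ∙ x k)) (fun k => (ℂ ∙ x k).subtypeₗᵢ) := by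
    refine OrthogonalFamily.of_pairwise fun k l hkl => ?_
    refine Submodule.isOrtho_span.2 ?_
    rintro _ rfl _ rfl
    exact h hkl
  exact (hV.summable_iff_norm_sq_summable
    (fun k => ⟨x k, Submodule.mem_span_singleton_self _⟩)).2 hs

omit [CompleteSpace E] in
theorem inner_tsum_tsum {ι : Type*} {x y : ι → E} (hx : Summable x) (hy : Summable y)
    (h : ∀ k l, k ≠ l → ⟪x k, y l⟫ = 0) :
    HasSum (fun k => ⟪x k, y k⟫) ⟪∑' k, x k, ∑' k, y k⟫ := by
  have h1 := hy.hasSum.mapL (innerSL ℂ (∑' k, x k))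
  simp only [innerSL_apply_apply] at h1
  convert! h1 using 2 with l
  have h2 := hx.hasSum.mapL (innerSL ℂ (y l))
  simp only [innerSL_apply_apply] at h2
  have h3 := h2.unique (hasSum_single l fun k hk => by
    rw [← inner_conj_symm, h k l hk, map_zero])
  rw [← inner_conj_symm, ← inner_conj_symm (∑' k, x k), h3]

omit [CompleteSpace E] in
theorem norm_tsum_sq {ι : Type*} {x : ι → E} (hx : Summable x)
    (h : Pairwise fun k l => ⟪x k, x l⟫ = 0) :
    HasSum (fun k => ‖x k‖ ^ 2) (‖∑' k, x k‖ ^ 2) := by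
  have := inner_tsum_tsum hx hx fun k l hkl => h hkl
  simp only [inner_self_eq_norm_sq_to_K] at this
  exact_mod_cast this

/-! ### Decay of correlations -/

/-- The mean value inequality in v and then in w. Since a ≤ 2, the power z^{a-2} is largest at the
left endpoint x. -/
theorem abs_second_difference_le {a x v w : ℝ} (ha : a ≤ 2) (hx : 0 < x) (hv : 0 ≤ v)
    (hw : 0 ≤ w) : |(x + w + v) ^ a - (x + w) ^ a - (x + v) ^ a + x ^ a| ≤
      |a * (a - 1)| * x ^ (a - 2) * v * w := by
  have hd (p : ℝ) (y : ℝ) (hy : x ≤ y) : HasDerivAt (fun z : ℝ => z ^ p) (p * y ^ (p - 1)) y :=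
    Real.hasDerivAt_rpow_const (Or.inl (by linarith))
  have hd1 : ∀ y ∈ Icc x (x + w), ‖a * (y + v) ^ (a - 1) - a * y ^ (a - 1)‖ ≤
      |a * (a - 1)| * x ^ (a - 2) * v := by
    intro y hy
    have := (convex_Icc y (y + v)).norm_image_sub_le_of_norm_hasDerivWithin_le
      (f := fun z => a * z ^ (a - 1)) (f' := fun z => a * ((a - 1) * z ^ (a - 1 - 1)))
      (C := |a * (a - 1)| * x ^ (a - 2)) (x := y) (y := y + v)
      (fun z hz => ((hd (a - 1) z (hy.1.trans hz.1)).const_mul a).hasDerivWithinAt)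
      (fun z hz => ?_) ⟨le_rfl, by linarith⟩ ⟨by linarith, le_rfl⟩
    · rwa [add_sub_cancel_left, Real.norm_of_nonneg hv] at this
    · have hz' : x ≤ z := hy.1.trans hz.1
      rw [← mul_assoc, norm_mul, Real.norm_eq_abs,
        Real.norm_of_nonneg (Real.rpow_nonneg (hx.le.trans hz') _),
        show a - 1 - 1 = a - 2 by ring]
      exact mul_le_mul_of_nonneg_left
        (Real.rpow_le_rpow_of_nonpos hx hz' (by linarith)) (abs_nonneg _)
  have := (convex_Icc x (x + w)).norm_image_sub_le_of_norm_hasDerivWithin_le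
      (f := fun z => (z + v) ^ a - z ^ a)
      (f' := fun z => a * (z + v) ^ (a - 1) - a * z ^ (a - 1))
      (C := |a * (a - 1)| * x ^ (a - 2) * v) (x := x) (y := x + w)
      (fun z hz => ?_) hd1 ⟨le_rfl, by linarith⟩ ⟨by linarith, le_rfl⟩
  · rw [add_sub_cancel_left, Real.norm_of_nonneg hw, Real.norm_eq_abs] at this
    refine le_trans (le_of_eq ?_) this
    congr 1
    ring
  · have h1 := (hd a (z + v) (by linarith [hz.1])).comp_add_const z v
    exact (h1.sub (hd a z hz.1)).hasDerivWithinAt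

omit [CompleteSpace E] in
-- With d = t - s, short increments (w ≤ d/2) are handled by the second difference of |·|^{2H} at
-- distance at least d/2. Long ones use Cauchy–Schwarz together with 1 ≤ 4w²d^{-2} ≤ 4w²d^{2H-2},
-- which explains the exponent H + 2; the kernel e^{-κw} will absorb it.
theorem IsFBMCurve.norm_inner_increments_le {H : ℝ} (hH : H ∈ Ioo (0 : ℝ) 1) {b : ℝ → E}
    (hb : IsFBMCurve H b) {s t v w : ℝ} (hst : s + 1 ≤ t) (hv : 0 < v) (hw : 0 < w) :
    ‖⟪b s - b (s - v), b t - b (t - w)⟫‖ ≤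
      8 * (v * w + v ^ H * w ^ (H + 2)) * (t - s) ^ (2 * H - 2) := by
  obtain ⟨hH0, hH1⟩ := hH
  set d := t - s with hd
  have hd1 : 1 ≤ d := by linarith
  have hd0 : 0 < d := by linarith
  rcases le_or_gt w (d / 2) with h | h
  · rw [hb.inner_sub_sub, Complex.norm_real, Real.norm_eq_abs]
    have h2 := abs_second_difference_le (a := 2 * H) (x := d - w) (v := v) (w := w) (by linarith)
      (by linarith) hv.le hw.le
    rw [show d - w + w = d by ring] at h2
    rw [show t - (s - v) = d + v by rw [hd]; ring, show t - w - s = d - w by rw [hd]; ring,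
      show t - w - (s - v) = d - w + v by rw [hd]; ring, abs_of_pos (show 0 < d + v by linarith),
      abs_of_nonneg (show 0 ≤ d - w by linarith), abs_of_pos hd0,
      abs_of_nonneg (show 0 ≤ d - w + v by linarith), abs_div, abs_two]
    rw [show (d + v) ^ (2 * H) + (d - w) ^ (2 * H) - d ^ (2 * H) - (d - w + v) ^ (2 * H) =
      (d + v) ^ (2 * H) - d ^ (2 * H) - (d - w + v) ^ (2 * H) + (d - w) ^ (2 * H) by ring]
    have h3 : (d - w) ^ (2 * H - 2) ≤ 4 * d ^ (2 * H - 2) := by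
      calc (d - w) ^ (2 * H - 2) ≤ (d / 2) ^ (2 * H - 2) :=
            Real.rpow_le_rpow_of_nonpos (by linarith) (by linarith) (by linarith)
        _ = (2 : ℝ) ^ (2 - 2 * H) * d ^ (2 * H - 2) := by
            rw [Real.div_rpow hd0.le (by norm_num), div_eq_mul_inv,
              ← Real.rpow_neg (by norm_num), mul_comm, neg_sub]
        _ ≤ (2 : ℝ) ^ (2 : ℝ) * d ^ (2 * H - 2) := by
            gcongr
            · norm_num
            · linarith
        _ = _ := by norm_num
    have h4 : |2 * H * (2 * H - 1)| ≤ 2 := by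
      rw [abs_le]; constructor <;> nlinarith
    have h5 : |2 * H * (2 * H - 1)| * (d - w) ^ (2 * H - 2) * v * w ≤
        2 * (4 * d ^ (2 * H - 2)) * v * w := by
      have : 0 ≤ (d - w) ^ (2 * H - 2) := Real.rpow_nonneg (by linarith) _
      gcongr
    have h6 : 0 ≤ v ^ H * w ^ (H + 2) * d ^ (2 * H - 2) := by positivity
    have h7 : 0 ≤ d ^ (2 * H - 2) * v * w := by positivity
    rw [div_le_iff₀ two_pos]
    nlinarith
  · refine (norm_inner_le_norm _ _).trans ?_
    rw [hb.norm_sub hH0, hb.norm_sub hH0, sub_sub_cancel, sub_sub_cancel, abs_of_pos hv,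
      abs_of_pos hw]
    have h1 : (1 : ℝ) ≤ 4 * w ^ 2 * d ^ (2 * H - 2) := by
      have h2 : d ^ (-2 : ℝ) ≤ d ^ (2 * H - 2) :=
        Real.rpow_le_rpow_of_exponent_le hd1 (by linarith)
      have h3 : d ^ (-2 : ℝ) = (d ^ 2)⁻¹ := by
        rw [Real.rpow_neg hd0.le]; norm_num
      have h4 : 1 ≤ 4 * w ^ 2 * (d ^ 2)⁻¹ := by
        rw [← div_eq_mul_inv, le_div_iff₀ (by positivity)]
        nlinarith
      rw [h3] at h2
      exact h4.trans (mul_le_mul_of_nonneg_left h2 (by positivity))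
    have h5 : w ^ (H + 2) = w ^ H * w ^ 2 := by
      rw [Real.rpow_add hw]; norm_num
    rw [h5]
    have h6 : 0 ≤ v ^ H * w ^ H := by positivity
    have h7 : 0 ≤ v * w * d ^ (2 * H - 2) := by positivity
    nlinarith [mul_le_mul_of_nonneg_left h1 h6]

/-- The constant in the decay of correlations of the Ornstein–Uhlenbeck curve. -/
noncomputable def decayConst (H κ : ℝ) : ℝ :=
  8 * (Real.Gamma 2 ^ 2 * κ ^ (-2 : ℝ) +
    Real.Gamma (H + 1) * Real.Gamma (H + 3) * κ ^ (-(2 * H + 2)))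

/-- The increment bound is integrated against κ²e^{-κ(v+w)}, each power producing a Gamma factor.
The exponent 2H - 2 is negative for every H < 1, which is all that ergodicity requires. -/
theorem IsFBMCurve.norm_inner_ouVec_le {H : ℝ} (hH : H ∈ Ioo (0 : ℝ) 1) {κ : ℝ} (hκ : 0 < κ)
    {b : ℝ → E} (hb : IsFBMCurve H b) {s t : ℝ} (hst : s + 1 ≤ t) :
    ‖⟪ouVec κ b s, ouVec κ b t⟫‖ ≤ decayConst H κ * (t - s) ^ (2 * H - 2) := by
  have hH0 := hH.1
  set D := (t - s) ^ (2 * H - 2) with hD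
  have hD0 : 0 ≤ D := Real.rpow_nonneg (by linarith) _
  have i1 := integrableOn_exp_mul_rpow hκ zero_le_one
  have i2 := integrableOn_exp_mul_rpow hκ hH0.le
  have i3 := integrableOn_exp_mul_rpow hκ (show 0 ≤ H + 2 by linarith)
  simp only [Real.rpow_one] at i1
  have j1 := integral_exp_mul_rpow hκ zero_le_one
  have j2 := integral_exp_mul_rpow hκ hH0.le
  have j3 := integral_exp_mul_rpow hκ (show 0 ≤ H + 2 by linarith)
  simp only [Real.rpow_one] at j1
  set G2 := κ ^ (-((1 : ℝ) + 1)) * Real.Gamma (1 + 1) with hG2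
  set G1 := κ ^ (-(H + 1)) * Real.Gamma (H + 1) with hG1
  set G3 := κ ^ (-(H + 2 + 1)) * Real.Gamma (H + 2 + 1) with hG3
  have hin : ∀ w > 0, ‖⟪∫ v in Ioi (0 : ℝ), (Real.exp (-(κ * v)) : ℂ) • (b s - b (s - v)),
      b t - b (t - w)⟫‖ ≤ 8 * (G2 * w + G1 * w ^ (H + 2)) * D := by
    intro w hw
    rw [← inner_conj_symm, RCLike.norm_conj,
      ← integral_inner (hb.integrableOn_increment hH0 hκ s)]
    have i4 : IntegrableOn (fun v : ℝ => 8 * D * w * (Real.exp (-(κ * v)) * v) +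
        8 * D * w ^ (H + 2) * (Real.exp (-(κ * v)) * v ^ H)) (Ioi 0) :=
      (i1.const_mul _).add (i2.const_mul _)
    refine (norm_integral_le_of_norm_le i4 ?_).trans (le_of_eq ?_)
    · filter_upwards [ae_restrict_mem measurableSet_Ioi] with v hv
      rw [inner_smul_right, norm_mul, Complex.norm_real, Real.norm_eq_abs, Real.abs_exp,
        ← inner_conj_symm, RCLike.norm_conj]
      have := mul_le_mul_of_nonneg_left (hb.norm_inner_increments_le hH hst hv hw)
        (Real.exp_pos (-(κ * v))).le
      refine this.trans (le_of_eq ?_)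
      ring
    · rw [integral_add (i1.const_mul _) (i2.const_mul _), integral_const_mul, integral_const_mul,
        j1, j2]
      ring
  rw [hb.ouVec_eq hH0 hκ, hb.ouVec_eq hH0 hκ, inner_smul_left, inner_smul_right,
    ← integral_inner (hb.integrableOn_increment hH0 hκ t), Complex.conj_ofReal, norm_mul, norm_mul,
    Complex.norm_real, Real.norm_of_nonneg hκ.le]
  have i5 : IntegrableOn (fun w : ℝ => 8 * D * G2 * (Real.exp (-(κ * w)) * w) +
        8 * D * G1 * (Real.exp (-(κ * w)) * w ^ (H + 2))) (Ioi 0) :=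
      (i1.const_mul _).add (i3.const_mul _)
  have := norm_integral_le_of_norm_le i5 (f := fun w : ℝ =>
    ⟪∫ v in Ioi (0 : ℝ), (Real.exp (-(κ * v)) : ℂ) • (b s - b (s - v)),
      (Real.exp (-(κ * w)) : ℂ) • (b t - b (t - w))⟫) (by
    filter_upwards [ae_restrict_mem measurableSet_Ioi] with w hw
    rw [inner_smul_right, norm_mul, Complex.norm_real, Real.norm_eq_abs, Real.abs_exp]
    refine (mul_le_mul_of_nonneg_left (hin w hw) (Real.exp_pos (-(κ * w))).le).trans (le_of_eq ?_)
    ring)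
  rw [integral_add (i1.const_mul _) (i3.const_mul _), integral_const_mul, integral_const_mul,
    j1, j3] at this
  have h2 := mul_le_mul_of_nonneg_left (mul_le_mul_of_nonneg_left this hκ.le) hκ.le
  refine h2.trans (le_of_eq ?_)
  have e1 : κ * (κ * (G2 * G2)) = Real.Gamma 2 ^ 2 * κ ^ (-2 : ℝ) := by
    have : κ ^ (-((1 : ℝ) + 1)) * κ ^ (-((1 : ℝ) + 1)) * (κ ^ (1 : ℝ) * κ ^ (1 : ℝ)) =
        κ ^ (-2 : ℝ) := by
      rw [← Real.rpow_add hκ, ← Real.rpow_add hκ, ← Real.rpow_add hκ]; norm_num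
    rw [← this, hG2, Real.rpow_one, show (1 : ℝ) + 1 = 2 by norm_num]
    ring
  have e2 : κ * (κ * (G1 * G3)) =
      Real.Gamma (H + 1) * Real.Gamma (H + 3) * κ ^ (-(2 * H + 2)) := by
    have : κ ^ (-(H + 1)) * κ ^ (-(H + 2 + 1)) * (κ ^ (1 : ℝ) * κ ^ (1 : ℝ)) =
        κ ^ (-(2 * H + 2)) := by
      rw [← Real.rpow_add hκ, ← Real.rpow_add hκ, ← Real.rpow_add hκ]; congr 1; ring
    rw [← this, hG1, hG3, Real.rpow_one, show H + 2 + 1 = H + 3 by ring]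
    ring
  rw [decayConst, ← e1, ← e2]
  ring

theorem decayConst_anti {H κ₀ κ : ℝ} (hH : 0 < H) (h0 : 0 < κ₀) (h : κ₀ ≤ κ) :
    decayConst H κ ≤ decayConst H κ₀ := by
  have g1 : 0 < Real.Gamma (H + 1) := Real.Gamma_pos_of_pos (by linarith)
  have g3 : 0 < Real.Gamma (H + 3) := Real.Gamma_pos_of_pos (by linarith)
  have h1 : κ ^ (-2 : ℝ) ≤ κ₀ ^ (-2 : ℝ) := Real.rpow_le_rpow_of_nonpos h0 h (by norm_num)
  have h2 : κ ^ (-(2 * H + 2)) ≤ κ₀ ^ (-(2 * H + 2)) :=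
    Real.rpow_le_rpow_of_nonpos h0 h (by linarith)
  unfold decayConst
  gcongr

end Hilbert

end FracField

namespace FracField

/-! ### Characters of a Hilbert space -/

section Characters

variable {E : Type*} [NormedAddCommGroup E] [InnerProductSpace ℂ E]

/-- The character `x ↦ exp(i Re⟨v, x⟩)`. -/
noncomputable def chi (v x : E) : ℂ := Complex.exp (((inner ℂ v x).re : ℝ) * Complex.I)

theorem norm_chi (v x : E) : ‖chi v x‖ = 1 := Complex.norm_exp_ofReal_mul_I _

theorem continuous_chi (v : E) : Continuous (chi v) := by
  unfold chi
  fun_prop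

theorem conj_chi (v x : E) : conj (chi v x) = chi (-v) x := by
  rw [chi, chi, ← Complex.exp_conj]
  simp

/-- Trigonometric polynomials. -/
def trigPoly (E : Type*) [NormedAddCommGroup E] [InnerProductSpace ℂ E] : Submodule ℂ (E → ℂ) :=
  Submodule.span ℂ (range chi)

theorem trigPoly_bounded {f : E → ℂ} (hf : f ∈ trigPoly E) :
    Continuous f ∧ ∃ C, ∀ x, ‖f x‖ ≤ C := by
  induction hf using Submodule.span_induction with
  | mem f hf =>
    obtain ⟨v, rfl⟩ := hf
    exact ⟨continuous_chi v, 1, fun x => (norm_chi v x).le⟩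
  | zero => exact ⟨continuous_const, 0, by simp⟩
  | add f g _ _ hf hg =>
    obtain ⟨hf, C, hC⟩ := hf
    obtain ⟨hg, D, hD⟩ := hg
    exact ⟨hf.add hg, C + D, fun x => norm_add_le_of_le (hC x) (hD x)⟩
  | smul c f _ hf =>
    obtain ⟨hf, C, hC⟩ := hf
    refine ⟨hf.const_smul c, ‖c‖ * C, fun x => ?_⟩
    rw [Pi.smul_apply, norm_smul]
    exact mul_le_mul_of_nonneg_left (hC x) (norm_nonneg c)

variable [CompleteSpace E] [SecondCountableTopology E] [MeasurableSpace E] [BorelSpace E]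

theorem measure_ext_of_chi {μ ν : Measure E} [IsFiniteMeasure μ] [IsFiniteMeasure ν]
    (h : ∀ v, ∫ x, chi v x ∂μ = ∫ x, chi v x ∂ν) : μ = ν := by
  let L : E →ₗ[ℝ] E →ₗ[ℝ] ℝ := LinearMap.mk₂ ℝ (fun x w => (inner ℂ w x).re)
    (fun x y w => by simp) (fun c x w => by simp [inner_smul_right_eq_smul])
    (fun x y w => by simp) (fun c x w => by simp [inner_smul_left_eq_smul])
  refine ext_of_integral_char_eq (L := L) Real.continuous_probChar Real.probChar_ne_one
    (fun v hv h0 => hv ?_) (by change Continuous fun p : E × E => (inner ℂ p.2 p.1).re; fun_prop)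
    fun w => ?_
  · have : (inner ℂ v v).re = 0 := LinearMap.congr_fun h0 v
    exact inner_self_eq_zero.1 (Complex.ext this (inner_self_im (𝕜 := ℂ) v))
  · exact h w

/-- A product of characters is a character of the product space for the pairing ∑ Re⟨w_i, x_i⟩,
which separates points. Joint laws are therefore determined by mixed characters. -/
theorem measure_pi_ext_of_chi {n : ℕ} {μ ν : Measure (Fin n → E)} [IsFiniteMeasure μ]
    [IsFiniteMeasure ν]
    (h : ∀ v : Fin n → E, ∫ x, ∏ i, chi (v i) (x i) ∂μ = ∫ x, ∏ i, chi (v i) (x i) ∂ν) : μ = ν := by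
  let L : (Fin n → E) →ₗ[ℝ] (Fin n → E) →ₗ[ℝ] ℝ :=
    LinearMap.mk₂ ℝ (fun x w => ∑ i, (inner ℂ (w i) (x i)).re)
    (fun x y w => by simp [Finset.sum_add_distrib])
    (fun c x w => by simp [inner_smul_right_eq_smul, Finset.mul_sum])
    (fun x y w => by simp [Finset.sum_add_distrib])
    (fun c x w => by simp [inner_smul_left_eq_smul, Finset.mul_sum])
  refine ext_of_integral_char_eq (L := L) Real.continuous_probChar Real.probChar_ne_one
    (fun v hv h0 => hv ?_)
    (by change Continuous fun p : (Fin n → E) × (Fin n → E) => ∑ i, (inner ℂ (p.2 i) (p.1 i)).re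
        fun_prop)
    fun w => ?_
  · have h1 : ∑ i, (inner ℂ (v i) (v i)).re = 0 := LinearMap.congr_fun h0 v
    have h2 := (Finset.sum_eq_zero_iff_of_nonneg fun i _ => inner_self_nonneg (𝕜 := ℂ)).1 h1
    ext i
    exact inner_self_eq_zero.1 (Complex.ext (h2 i (Finset.mem_univ i)) (inner_self_im (𝕜 := ℂ) (v i)))
  · have (x : Fin n → E) : BoundedContinuousFunction.char (V := Fin n → E) (W := Fin n → E) (L := L)
      Real.continuous_probChar (by
        change Continuous fun p : (Fin n → E) × (Fin n → E) => ∑ i, (inner ℂ (p.2 i) (p.1 i)).re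
        fun_prop) w x = ∏ i, chi (w i) (x i) := by
      change Complex.exp ((∑ i, (inner ℂ (w i) (x i)).re : ℝ) * Complex.I) = _
      rw [Complex.ofReal_sum, Finset.sum_mul, Complex.exp_sum]
      rfl
    simp_rw [this]
    exact h w

/-- The positive and negative parts of g are densities of two finite measures with the same
characteristic function; these measures coincide, hence so do the densities. -/
theorem ae_eq_zero_of_integral_mul_chi_real {μ : Measure E} [IsFiniteMeasure μ] {g : E → ℝ}
    (hg : Integrable g μ) (h : ∀ v, ∫ x, (g x : ℂ) * chi v x ∂μ = 0) : g =ᵐ[μ] 0 := by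
  have hneg : Integrable (fun x => -g x) μ := hg.neg
  have hfin : ∀ u : E → ℝ, Integrable u μ → ∫⁻ x, ENNReal.ofReal (u x) ∂μ ≠ ∞ := fun u hu =>
    ((lintegral_mono fun x => Real.ofReal_le_enorm (u x)).trans_lt hu.2).ne
  have hlt : ∀ u : E → ℝ, ∀ᵐ x ∂μ, ENNReal.ofReal (u x) < ∞ := fun u =>
    ae_of_all _ fun x => ENNReal.ofReal_lt_top
  have hm : ∀ u : E → ℝ, Integrable u μ → AEMeasurable (fun x => ENNReal.ofReal (u x)) μ :=
    fun u hu => hu.aemeasurable.ennreal_ofReal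
  have i1 : IsFiniteMeasure (μ.withDensity fun x => ENNReal.ofReal (g x)) :=
    isFiniteMeasure_withDensity (hfin g hg)
  have i2 : IsFiniteMeasure (μ.withDensity fun x => ENNReal.ofReal (-g x)) :=
    isFiniteMeasure_withDensity (hfin _ hneg)
  have hint : ∀ u : E → ℝ, Integrable u μ → ∀ v,
      Integrable (fun x => (ENNReal.ofReal (u x)).toReal • chi v x) μ := by
    intro u hu v
    refine Integrable.mono (hu.pos_part) ?_ (ae_of_all _ fun x => ?_)
    · exact ((hm u hu).ennreal_toReal.aestronglyMeasurable).smul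
        (continuous_chi v).aestronglyMeasurable
    · rw [norm_smul, norm_chi, mul_one, ENNReal.toReal_ofReal']
  have heq : (μ.withDensity fun x => ENNReal.ofReal (g x)) =
      μ.withDensity fun x => ENNReal.ofReal (-g x) := by
    refine measure_ext_of_chi fun v => ?_
    rw [integral_withDensity_eq_integral_toReal_smul₀ (hm g hg) (hlt g),
      integral_withDensity_eq_integral_toReal_smul₀ (hm _ hneg) (hlt _), ← sub_eq_zero,
      ← integral_sub (hint g hg v) (hint _ hneg v), ← h v]
    refine integral_congr_ae (ae_of_all _ fun x => ?_)
    simp only [← sub_smul]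
    rw [ENNReal.toReal_ofReal', ENNReal.toReal_ofReal', max_zero_sub_max_neg_zero_eq_self,
      Complex.real_smul]
  have := (withDensity_eq_iff (hm g hg) (hm _ hneg) (hfin g hg)).1 heq
  filter_upwards [this] with x hx
  rcases le_total 0 (g x) with h0 | h0
  · rw [ENNReal.ofReal_of_nonpos (neg_nonpos.2 h0), ENNReal.ofReal_eq_zero] at hx
    exact le_antisymm hx h0
  · rw [ENNReal.ofReal_of_nonpos h0, eq_comm, ENNReal.ofReal_eq_zero] at hx
    exact le_antisymm h0 (neg_nonpos.1 hx)

/-- The conjugate of a character is again a character, so conj g is orthogonal to all characters as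
well, and the real and imaginary parts can be treated separately. -/
theorem ae_eq_zero_of_integral_mul_chi {μ : Measure E} [IsFiniteMeasure μ] {g : E → ℂ}
    (hg : Integrable g μ) (h : ∀ v, ∫ x, g x * chi v x ∂μ = 0) : g =ᵐ[μ] 0 := by
  have hint : ∀ v, Integrable (fun x => g x * chi v x) μ := fun v =>
    hg.mul_bdd (c := 1) (continuous_chi v).aestronglyMeasurable
      (ae_of_all _ fun x => (norm_chi v x).le)
  have hc : ∀ v, ∫ x, conj (g x) * chi v x ∂μ = 0 := fun v => by
    have : ∀ x, conj (g x) * chi v x = conj (g x * chi (-v) x) := fun x => by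
      rw [map_mul, conj_chi, neg_neg]
    simp_rw [this]
    rw [integral_conj, h, map_zero]
  have hintc : ∀ v, Integrable (fun x => conj (g x) * chi v x) μ := fun v => by
    refine Integrable.mul_bdd (c := 1) ?_ (continuous_chi v).aestronglyMeasurable
      (ae_of_all _ fun x => (norm_chi v x).le)
    exact (Complex.conjCLE.toContinuousLinearMap.integrable_comp hg)
  have hre := ae_eq_zero_of_integral_mul_chi_real (hg.re) fun v => by
    have : ∀ x, ((RCLike.re (g x) : ℝ) : ℂ) * chi v x =
        (2 : ℂ)⁻¹ * (g x * chi v x) + (2 : ℂ)⁻¹ * (conj (g x) * chi v x) := fun x => by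
      have := Complex.re_eq_add_conj (g x)
      change ((g x).re : ℂ) * _ = _
      rw [this]; ring
    simp_rw [this]
    rw [integral_add ((hint v).const_mul _) ((hintc v).const_mul _), integral_const_mul,
      integral_const_mul, h, hc]
    simp
  have him := ae_eq_zero_of_integral_mul_chi_real (hg.im) fun v => by
    have : ∀ x, ((RCLike.im (g x) : ℝ) : ℂ) * chi v x =
        (2 * Complex.I)⁻¹ * (g x * chi v x) - (2 * Complex.I)⁻¹ * (conj (g x) * chi v x) :=
      fun x => by
      have := Complex.im_eq_sub_conj (g x)
      change ((g x).im : ℂ) * _ = _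
      rw [this]; ring
    simp_rw [this]
    rw [integral_sub ((hint v).const_mul _) ((hintc v).const_mul _), integral_const_mul,
      integral_const_mul, h, hc]
    simp
  filter_upwards [hre, him] with x h1 h2
  exact Complex.ext h1 h2

/-- Trigonometric polynomials are dense in `L¹`. -/
theorem exists_trigPoly_lintegral_sub_le {μ : Measure E} [IsProbabilityMeasure μ] {ρ : E → ℂ}
    (hρ : Integrable ρ μ) {ε : ℝ≥0∞} (hε : ε ≠ 0) :
    ∃ f ∈ trigPoly E, ∫⁻ x, ‖ρ x - f x‖ₑ ∂μ ≤ ε := by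
  -- A bounded continuous approximant lies in L², where density is an orthogonality statement; on a
  -- probability space L² approximation implies L¹ approximation.
  obtain ⟨g, hg, -⟩ := hρ.exists_boundedContinuous_lintegral_sub_le
    (ENNReal.half_pos hε).ne'
  have hgL : MemLp g 2 μ := MemLp.of_bound g.continuous.aestronglyMeasurable ‖g‖
    (ae_of_all _ g.norm_coe_le_norm)
  have hmem : ∀ f ∈ trigPoly E, MemLp f 2 μ := fun f hf => by
    obtain ⟨hc, C, hC⟩ := trigPoly_bounded hf
    exact MemLp.of_bound hc.aestronglyMeasurable C (ae_of_all _ hC)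
  let K : Submodule ℂ (Lp ℂ 2 μ) :=
    { carrier := {u | ∃ f, ∃ hf : f ∈ trigPoly E, u = (hmem f hf).toLp f}
      zero_mem' := ⟨0, Submodule.zero_mem _, (MemLp.toLp_zero _).symm⟩
      add_mem' := by
        rintro _ _ ⟨f, hf, rfl⟩ ⟨f', hf', rfl⟩
        exact ⟨f + f', Submodule.add_mem _ hf hf', (MemLp.toLp_add _ _).symm⟩
      smul_mem' := by
        rintro c _ ⟨f, hf, rfl⟩
        exact ⟨c • f, Submodule.smul_mem _ c hf, (MemLp.toLp_const_smul _ _).symm⟩ }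
  have hK : K.topologicalClosure = ⊤ := by
    rw [Submodule.topologicalClosure_eq_top_iff, Submodule.eq_bot_iff]
    intro u hu
    rw [Submodule.mem_orthogonal] at hu
    have hu0 : (u : E → ℂ) =ᵐ[μ] 0 := by
      refine ae_eq_zero_of_integral_mul_chi ((Lp.memLp u).integrable one_le_two) fun v => ?_
      have hv : chi (-v) ∈ trigPoly E := Submodule.subset_span ⟨_, rfl⟩
      have := hu _ ⟨chi (-v), hv, rfl⟩
      rw [L2.inner_def] at this
      rw [← this]
      refine integral_congr_ae ?_
      filter_upwards [(hmem _ hv).coeFn_toLp] with x hx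
      rw [hx, RCLike.inner_apply, conj_chi, neg_neg]
    exact (Lp.eq_zero_iff_ae_eq_zero).2 hu0
  have hcl : hgL.toLp g ∈ closure (K : Set (Lp ℂ 2 μ)) := by
    rw [← Submodule.topologicalClosure_coe, hK]; trivial
  obtain ⟨_, ⟨f, hf, rfl⟩, hfd⟩ := EMetric.mem_closure_iff.1 hcl (ε / 2) (ENNReal.half_pos hε)
  refine ⟨f, hf, ?_⟩
  have h2 : ∫⁻ x, ‖g x - f x‖ₑ ∂μ ≤ ε / 2 := by
    rw [Lp.edist_toLp_toLp] at hfd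
    refine le_trans ?_ hfd.le
    rw [← eLpNorm_one_eq_lintegral_enorm]
    exact eLpNorm_le_eLpNorm_of_exponent_le one_le_two
      (hgL.aestronglyMeasurable.sub (hmem f hf).aestronglyMeasurable)
  calc ∫⁻ x, ‖ρ x - f x‖ₑ ∂μ ≤ ∫⁻ x, (‖ρ x - g x‖ₑ + ‖g x - f x‖ₑ) ∂μ :=
        lintegral_mono fun x => by
          rw [← sub_add_sub_cancel (ρ x) (g x) (f x)]; exact enorm_add_le _ _
    _ = ∫⁻ x, ‖ρ x - g x‖ₑ ∂μ + ∫⁻ x, ‖g x - f x‖ₑ ∂μ :=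
        lintegral_add_left' (hρ.1.sub g.continuous.aestronglyMeasurable).enorm _
    _ ≤ ε / 2 + ε / 2 := add_le_add hg h2
    _ = ε := ENNReal.add_halves ε

end Characters

end FracField

namespace FracField

/-! ### A maximal inequality -/

/-- The running maximum of the partial sums, floored at zero. -/
noncomputable def maxSum : ℕ → (ℕ → ℝ) → ℝ
  | 0, _ => 0
  | n + 1, x => max 0 (x 0 + maxSum n fun i => x (i + 1))

theorem maxSum_nonneg (n : ℕ) (x : ℕ → ℝ) : 0 ≤ maxSum n x := by
  cases n with
  | zero => exact le_rfl
  | succ n => exact le_max_left _ _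

theorem maxSum_congr {n : ℕ} {x y : ℕ → ℝ} (h : ∀ i < n, x i = y i) : maxSum n x = maxSum n y := by
  induction n generalizing x y with
  | zero => rfl
  | succ n ih =>
    rw [maxSum, maxSum, h 0 n.succ_pos, ih fun i hi => h (i + 1) (Nat.succ_lt_succ hi)]

theorem maxSum_le_succ (n : ℕ) (x : ℕ → ℝ) : maxSum n x ≤ maxSum (n + 1) x := by
  induction n generalizing x with
  | zero => exact maxSum_nonneg _ _
  | succ n ih =>
    rw [maxSum, maxSum]
    exact max_le_max le_rfl (add_le_add le_rfl (ih _))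

theorem sum_le_maxSum {n N : ℕ} (h : n ≤ N) (x : ℕ → ℝ) :
    ∑ i ∈ Finset.range n, x i ≤ maxSum N x := by
  induction N generalizing x n with
  | zero => rw [Nat.le_zero.1 h]; exact le_rfl
  | succ N ih =>
    cases n with
    | zero => simpa using maxSum_nonneg _ _
    | succ n =>
      rw [Finset.sum_range_succ', add_comm]
      exact (add_le_add le_rfl (ih (Nat.le_of_succ_le_succ h) _)).trans (le_max_right _ _)

/-- Garsia's observation: where the maximum is positive, its recursion expresses it through the
shifted maximum, with x 0 as the difference. -/
theorem maxSum_sub_le {n : ℕ} {x : ℕ → ℝ} (h : 0 < maxSum n x) :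
    maxSum n x - maxSum n (fun i => x (i + 1)) ≤ x 0 := by
  cases n with
  | zero => exact absurd h (lt_irrefl _)
  | succ n =>
    have h1 : maxSum (n + 1) x = x 0 + maxSum n fun i => x (i + 1) := by
      rw [maxSum] at h ⊢
      exact max_eq_right ((lt_max_iff.1 h).resolve_left (lt_irrefl _)).le
    have h2 := maxSum_le_succ n fun i => x (i + 1)
    linarith

theorem maxSum_le_sum_abs (n : ℕ) (x : ℕ → ℝ) : maxSum n x ≤ ∑ i ∈ Finset.range n, |x i| := by
  induction n generalizing x with
  | zero => exact le_rfl
  | succ n ih =>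
    rw [maxSum, Finset.sum_range_succ', add_comm _ |x 0|]
    exact max_le (add_nonneg (abs_nonneg _) (Finset.sum_nonneg fun _ _ => abs_nonneg _))
      (add_le_add (le_abs_self _) (ih _))

theorem measurable_maxSum (n : ℕ) : Measurable (maxSum n) := by
  induction n with
  | zero => exact measurable_const
  | succ n ih =>
    have : Measurable fun x : ℕ → ℝ => fun i => x (i + 1) :=
      measurable_pi_lambda _ fun i => measurable_pi_apply _
    exact measurable_const.max ((measurable_pi_apply 0).add (ih.comp this))

section

variable {Ω : Type*} [MeasurableSpace Ω] {P : Measure Ω}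

/-- Stationarity of a real sequence. -/
def IsStationarySeq (P : Measure Ω) (X : ℕ → Ω → ℝ) : Prop :=
  ∀ N : ℕ, P.map (fun ω (i : Fin N) => X (i + 1) ω) = P.map (fun ω (i : Fin N) => X i ω)

theorem IsStationarySeq.integral_maxSum_shift {X : ℕ → Ω → ℝ} (hX : ∀ i, Measurable (X i))
    (hst : IsStationarySeq P X) (N : ℕ) :
    ∫ ω, maxSum N (fun i => X (i + 1) ω) ∂P = ∫ ω, maxSum N (fun i => X i ω) ∂P := by
  -- `maxSum N` reads only the first N entries, so padding with zeros makes it a function of a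
  -- finite-dimensional marginal, to which stationarity applies.
  let ext : (Fin N → ℝ) → ℕ → ℝ := fun y i => if h : i < N then y ⟨i, h⟩ else 0
  have hext : Measurable ext := measurable_pi_lambda _ fun i => by
    by_cases h : i < N
    · simpa [ext, h] using measurable_pi_apply _
    · simp [ext, h]
  have hmext : Measurable fun y => maxSum N (ext y) := (measurable_maxSum N).comp hext
  have key : ∀ Z : ℕ → Ω → ℝ, (∀ i, Measurable (Z i)) → ∫ ω, maxSum N (fun i => Z i ω) ∂P =
      ∫ y, maxSum N (ext y) ∂P.map (fun ω (i : Fin N) => Z i ω) := fun Z hZ => by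
    rw [integral_map (measurable_pi_lambda _ fun i : Fin N => hZ i).aemeasurable
      (hmext.aestronglyMeasurable)]
    refine integral_congr_ae (ae_of_all _ fun ω => maxSum_congr fun i hi => ?_)
    simp [ext, hi]
  rw [key _ hX, key (fun i => X (i + 1)) fun i => hX (i + 1), hst N]

/-- The maximal ergodic lemma. The maximum and its shift have equal expectation, and their
difference is at most X 0 where the maximum is positive and at most 0 elsewhere. Equality of
finite-dimensional laws takes the place of a measure preserving map. -/
theorem IsStationarySeq.setIntegral_nonneg {X : ℕ → Ω → ℝ} (hX : ∀ i, Measurable (X i))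
    (hi : ∀ i, Integrable (X i) P) (hst : IsStationarySeq P X) (N : ℕ) :
    0 ≤ ∫ ω in {ω | 0 < maxSum N fun i => X i ω}, X 0 ω ∂P := by
  have hm : ∀ Z : ℕ → Ω → ℝ, (∀ i, Measurable (Z i)) →
      Measurable fun ω => maxSum N fun i => Z i ω := fun Z hZ =>
    (measurable_maxSum N).comp (measurable_pi_lambda _ hZ)
  have hint : ∀ Z : ℕ → Ω → ℝ, (∀ i, Measurable (Z i)) → (∀ i, Integrable (Z i) P) →
      Integrable (fun ω => maxSum N fun i => Z i ω) P := fun Z hZ hZi => by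
    refine Integrable.mono' (integrable_finsetSum (Finset.range N) fun i _ => (hZi i).abs)
      (hm Z hZ).aestronglyMeasurable (ae_of_all _ fun ω => ?_)
    rw [Real.norm_of_nonneg (maxSum_nonneg _ _)]
    exact maxSum_le_sum_abs _ _
  have i1 := hint X hX hi
  have i2 := hint (fun i => X (i + 1)) (fun i => hX _) fun i => hi _
  set A := {ω | 0 < maxSum N fun i => X i ω} with hA
  have hAm : MeasurableSet A := measurableSet_lt measurable_const (hm X hX)
  calc (0 : ℝ) = ∫ ω, (maxSum N (fun i => X i ω) - maxSum N fun i => X (i + 1) ω) ∂P := by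
        rw [integral_sub i1 i2, hst.integral_maxSum_shift hX, sub_self]
    _ ≤ ∫ ω, A.indicator (X 0) ω ∂P := by
        refine integral_mono (i1.sub i2) ((hi 0).indicator hAm) fun ω => ?_
        by_cases h : ω ∈ A
        · rw [indicator_of_mem h]
          exact maxSum_sub_le (x := fun i => X i ω) h
        · rw [indicator_of_notMem h]
          have h1 : maxSum N (fun i => X i ω) ≤ 0 := not_lt.1 h
          have h2 := maxSum_nonneg N fun i => X (i + 1) ω
          simp only
          linarith
    _ = _ := integral_indicator hAm

/-- The maximal ergodic lemma for X - c: on the exceedance event some partial sum of X - c is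
positive. -/
theorem IsStationarySeq.measure_exists_le [IsProbabilityMeasure P] {X : ℕ → Ω → ℝ}
    (hX : ∀ i, Measurable (X i)) (hi : ∀ i, Integrable (X i) P) (h0 : ∀ i ω, 0 ≤ X i ω)
    (hst : IsStationarySeq P X) {c : ℝ} (hc : 0 < c) (N : ℕ) :
    P {ω | ∃ n ≤ N, n * c < ∑ i ∈ Finset.range n, X i ω} ≤
      ENNReal.ofReal ((∫ ω, X 0 ω ∂P) / c) := by
  set Y : ℕ → Ω → ℝ := fun i ω => X i ω - c with hY
  have hYm : ∀ i, Measurable (Y i) := fun i => (hX i).sub_const c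
  have hYi : ∀ i, Integrable (Y i) P := fun i => (hi i).sub (integrable_const c)
  have hYst : IsStationarySeq P Y := fun n => by
    have hs : Measurable fun (x : Fin n → ℝ) (i : Fin n) => x i - c :=
      measurable_pi_lambda _ fun i => (measurable_pi_apply (X := fun _ : Fin n => ℝ) i).sub_const c
    have := congr_arg (Measure.map fun (x : Fin n → ℝ) (i : Fin n) => x i - c) (hst n)
    rwa [Measure.map_map hs (measurable_pi_lambda _ fun i => hX _),
      Measure.map_map hs (measurable_pi_lambda _ fun i => hX _)] at this
  have hg := hYst.setIntegral_nonneg hYm hYi N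
  set A := {ω | 0 < maxSum N fun i => Y i ω} with hA
  have hAm : MeasurableSet A :=
    measurableSet_lt measurable_const ((measurable_maxSum N).comp (measurable_pi_lambda _ hYm))
  have hsub : {ω | ∃ n ≤ N, n * c < ∑ i ∈ Finset.range n, X i ω} ⊆ A := by
    rintro ω ⟨n, hn, h⟩
    refine lt_of_lt_of_le ?_ (sum_le_maxSum hn fun i => Y i ω)
    simp only [hY, Finset.sum_sub_distrib, Finset.sum_const, Finset.card_range, nsmul_eq_mul]
    linarith
  refine (measure_mono hsub).trans ?_
  rw [hY, integral_sub (hi 0).integrableOn (integrable_const c).integrableOn, setIntegral_const,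
    smul_eq_mul] at hg
  have h1 : ∫ ω in A, X 0 ω ∂P ≤ ∫ ω, X 0 ω ∂P :=
    setIntegral_le_integral (hi 0) (ae_of_all _ fun ω => h0 0 ω)
  have h2 : P.real A ≤ (∫ ω, X 0 ω ∂P) / c := by
    rw [le_div_iff₀ hc]; linarith
  rw [← ofReal_measureReal]
  exact ENNReal.ofReal_le_ofReal h2

/-! ### A strong law of large numbers for weakly correlated processes -/

/-- The strip |t - s| ≤ √T has area at most 2T√T and carries the trivial bound M; outside it the
kernel is at most C T^{-η/2}. Both contributions fit under T² T^{-min(1,η)/2}. -/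
theorem integral_prod_le_of_decay {C M η : ℝ} (hC : 0 ≤ C) (hη : 0 < η) {K : ℝ → ℝ → ℂ}
    (hM : ∀ s t, ‖K s t‖ ≤ M)
    (hK : ∀ s t, 0 ≤ s → 0 ≤ t → 1 ≤ |t - s| → ‖K s t‖ ≤ C * |t - s| ^ (-η)) {T : ℝ} (hT : 1 ≤ T) :
    ‖∫ s in (0 : ℝ)..T, ∫ t in (0 : ℝ)..T, K s t‖ ≤
      (2 * M + C) * T ^ 2 * T ^ (-(min 1 η / 2)) := by
  have hM0 : 0 ≤ M := (norm_nonneg _).trans (hM 0 0)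
  have hT0 : 0 < T := by linarith
  set L : ℝ := T ^ (1 / 2 : ℝ) with hL
  have hL1 : 1 ≤ L := Real.one_le_rpow hT (by norm_num)
  have hpt : ∀ s t, 0 ≤ s → 0 ≤ t →
      ‖K s t‖ ≤ (Ioc (s - L) (s + L)).indicator (fun _ => M) t + C * L ^ (-η) := by
    intro s t hs ht
    have h0 : 0 ≤ C * L ^ (-η) := by positivity
    by_cases h : t ∈ Ioc (s - L) (s + L)
    · rw [indicator_of_mem h]
      linarith [hM s t]
    · rw [indicator_of_notMem h, zero_add]
      have hd : L ≤ |t - s| := by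
        by_contra hlt
        rw [not_le, abs_lt] at hlt
        exact h ⟨by linarith, by linarith⟩
      refine (hK s t hs ht (hL1.trans hd)).trans (mul_le_mul_of_nonneg_left ?_ hC)
      exact Real.rpow_le_rpow_of_nonpos (by linarith) hd (by linarith)
  have hind : ∀ s, Integrable (fun t => (Ioc (s - L) (s + L)).indicator (fun _ => M) t) volume :=
    fun s => (integrable_indicator_iff measurableSet_Ioc).2 (integrableOn_const (by simp))
  have hinner : ∀ s, 0 ≤ s → ‖∫ t in (0 : ℝ)..T, K s t‖ ≤ 2 * L * M + T * (C * L ^ (-η)) := by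
    intro s hs
    have := intervalIntegral.norm_integral_le_of_norm_le (a := 0) (b := T) hT0.le
      (f := K s) (g := fun t => (Ioc (s - L) (s + L)).indicator (fun _ => M) t + C * L ^ (-η))
      (μ := volume) (ae_of_all _ fun t ht => hpt s t hs ht.1.le)
      ((hind s).intervalIntegrable.add intervalIntegrable_const)
    refine this.trans ?_
    rw [intervalIntegral.integral_add (hind s).intervalIntegrable intervalIntegrable_const,
      intervalIntegral.integral_const, sub_zero, smul_eq_mul]
    gcongr
    rw [intervalIntegral.integral_of_le hT0.le]
    refine (setIntegral_le_integral (hind s) (ae_of_all _ fun t => ?_)).trans ?_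
    · exact indicator_nonneg (fun _ _ => hM0) t
    · rw [integral_indicator measurableSet_Ioc, setIntegral_const, smul_eq_mul, measureReal_def,
        Real.volume_Ioc, ENNReal.toReal_ofReal (by linarith)]
      linarith
  have := intervalIntegral.norm_integral_le_of_norm_le_const (a := 0) (b := T)
    (f := fun s => ∫ t in (0 : ℝ)..T, K s t) (C := 2 * L * M + T * (C * L ^ (-η)))
    fun s hs => hinner s (by rw [uIoc_of_le hT0.le] at hs; exact hs.1.le)
  rw [sub_zero, abs_of_pos hT0] at this
  refine this.trans ?_
  set ζ := min 1 η / 2 with hζ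
  have e1 : L ≤ T * T ^ (-ζ) := by
    rw [hL]
    calc T ^ (1 / 2 : ℝ) ≤ T ^ (1 + -ζ) := Real.rpow_le_rpow_of_exponent_le hT (by
          have := min_le_left 1 η
          rw [hζ]; linarith)
      _ = _ := by rw [Real.rpow_add hT0, Real.rpow_one]
  have e2 : L ^ (-η) ≤ T ^ (-ζ) := by
    rw [hL, ← Real.rpow_mul hT0.le]
    refine Real.rpow_le_rpow_of_exponent_le hT ?_
    have := min_le_right 1 η
    rw [hζ]; linarith
  calc _ ≤ (2 * (T * T ^ (-ζ)) * M + T * (C * T ^ (-ζ))) * T := by gcongr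
    _ = _ := by ring

/-- By Fubini the second moment of the time integral is the double integral of the covariance, so
decay of correlations improves the trivial order T² by a power of T. -/
theorem integral_norm_sq_integral_le [IsProbabilityMeasure P] {G : ℝ → Ω → ℂ}
    (hG : Measurable fun p : ℝ × Ω => G p.1 p.2) {C M η : ℝ} (hC : 0 ≤ C) (hη : 0 < η)
    (hM : ∀ t ω, ‖G t ω‖ ≤ M)
    (hK : ∀ s t, 0 ≤ s → 0 ≤ t → 1 ≤ |t - s| →
      ‖∫ ω, G s ω * conj (G t ω) ∂P‖ ≤ C * |t - s| ^ (-η)) {T : ℝ} (hT : 1 ≤ T) :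
    ∫ ω, ‖∫ t in (0 : ℝ)..T, G t ω‖ ^ 2 ∂P ≤
      (2 * M ^ 2 + C) * T ^ 2 * T ^ (-(min 1 η / 2)) := by
  have hT0 : 0 ≤ T := by linarith
  have : IsFiniteMeasure (volume.restrict (uIoc (0 : ℝ) T)) := by
    rw [uIoc_of_le hT0]; infer_instance
  have hM0 : ∀ s t ω, ‖G s ω * conj (G t ω)‖ ≤ M ^ 2 := fun s t ω => by
    rw [norm_mul, RCLike.norm_conj, sq]
    exact mul_le_mul (hM _ _) (hM _ _) (norm_nonneg _) ((norm_nonneg _).trans (hM s ω))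
  have h := integral_prod_le_of_decay (K := fun s t => ∫ ω, G s ω * conj (G t ω) ∂P) (M := M ^ 2)
    hC hη (fun s t => by
      refine (norm_integral_le_of_norm_le_const (ae_of_all _ (hM0 s t))).trans ?_
      simp) hK hT
  have hGm : ∀ s, Measurable (G s) := fun s => hG.comp measurable_prodMk_left
  have hGt : ∀ ω, Measurable fun t => G t ω := fun ω => hG.comp measurable_prodMk_right
  have sw1 : ∀ s, ∫ t in (0 : ℝ)..T, ∫ ω, G s ω * conj (G t ω) ∂P =
      ∫ ω, G s ω * conj (∫ t in (0 : ℝ)..T, G t ω) ∂P := by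
    intro s
    rw [intervalIntegral_integral_swap]
    · refine integral_congr_ae (ae_of_all _ fun ω => ?_)
      simp only
      rw [intervalIntegral.integral_const_mul, intervalIntegral.integral_of_le hT0,
        intervalIntegral.integral_of_le hT0, integral_conj]
    · refine Integrable.of_bound (C := M ^ 2) (Measurable.aestronglyMeasurable ?_)
        (ae_of_all _ fun p => hM0 s p.1 p.2)
      exact ((hGm s).comp measurable_snd).mul
        (Complex.continuous_conj.measurable.comp hG)
  have hS : Measurable fun ω => ∫ t in (0 : ℝ)..T, G t ω := by
    simp_rw [intervalIntegral.integral_of_le hT0]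
    exact (hG.stronglyMeasurable.integral_prod_left (μ := volume.restrict (Ioc 0 T))).measurable
  have hSb : ∀ ω, ‖∫ t in (0 : ℝ)..T, G t ω‖ ≤ M * |T - 0| := fun ω =>
    intervalIntegral.norm_integral_le_of_norm_le_const fun t _ => hM t ω
  have sw2 : ∫ s in (0 : ℝ)..T, ∫ ω, G s ω * conj (∫ t in (0 : ℝ)..T, G t ω) ∂P =
      ∫ ω, (∫ t in (0 : ℝ)..T, G t ω) * conj (∫ t in (0 : ℝ)..T, G t ω) ∂P := by
    rw [intervalIntegral_integral_swap]
    · refine integral_congr_ae (ae_of_all _ fun ω => ?_)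
      simp only
      rw [intervalIntegral.integral_mul_const]
    · refine Integrable.of_bound (C := M * (M * |T - 0|)) (Measurable.aestronglyMeasurable ?_)
        (ae_of_all _ fun p => ?_)
      · exact hG.mul (Complex.continuous_conj.measurable.comp (hS.comp measurable_snd))
      · rw [Function.uncurry, norm_mul, RCLike.norm_conj]
        exact mul_le_mul (hM _ _) (hSb _) (norm_nonneg _) ((norm_nonneg _).trans (hM p.1 p.2))
  simp_rw [sw1] at h
  rw [sw2] at h
  simp_rw [Complex.mul_conj, Complex.normSq_eq_norm_sq] at h
  rw [integral_complex_ofReal, Complex.norm_real, Real.norm_of_nonneg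
    (integral_nonneg fun ω => by positivity)] at h
  exact h

end

end FracField

namespace FracField

/-! ### From mean square bounds to almost sure convergence of time averages. -/

section

variable {Ω : Type*} [MeasurableSpace Ω] {P : Measure Ω}

theorem ae_tendsto_of_integral_norm_sq_le {S : ℕ → Ω → ℂ} (hS : ∀ n, Measurable (S n)) {A : ℝ}
    (hi : ∀ n, Integrable (fun ω => ‖S n ω‖ ^ 2) P)
    (h : ∀ n : ℕ, ∫ ω, ‖S n ω‖ ^ 2 ∂P ≤ A / ((n : ℝ) + 1) ^ 2) :
    ∀ᵐ ω ∂P, Tendsto (fun n => S n ω) atTop (𝓝 0) := by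
  have hsum : Summable fun n : ℕ => A / ((n : ℝ) + 1) ^ 2 := by
    have := (summable_nat_add_iff 1).2 (Real.summable_one_div_nat_pow.2 one_lt_two)
    refine (this.mul_left A).congr fun n => ?_
    push_cast
    ring
  have hA : ∀ n : ℕ, 0 ≤ A / ((n : ℝ) + 1) ^ 2 := fun n =>
    (integral_nonneg fun ω => by positivity).trans (h n)
  have hfin : ∑' n, ∫⁻ ω, ENNReal.ofReal (‖S n ω‖ ^ 2) ∂P ≠ ∞ := by
    refine ne_top_of_le_ne_top ?_ (ENNReal.tsum_le_tsum fun n =>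
      (ofReal_integral_eq_lintegral_ofReal (hi n) (ae_of_all _ fun ω => by positivity)).symm.le.trans
        (ENNReal.ofReal_le_ofReal (h n)))
    rw [← ENNReal.ofReal_tsum_of_nonneg hA hsum]
    exact ENNReal.ofReal_ne_top
  have hm : ∀ n, Measurable fun ω => ENNReal.ofReal (‖S n ω‖ ^ 2) := fun n =>
    ((hS n).norm.pow_const 2).ennreal_ofReal
  rw [← lintegral_tsum fun n => (hm n).aemeasurable] at hfin
  filter_upwards [ae_lt_top (Measurable.tsum hm) hfin] with ω hω
  have h1 := ENNReal.tendsto_atTop_zero_of_tsum_ne_top hω.ne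
  have h2 : Tendsto (fun n => ‖S n ω‖ ^ 2) atTop (𝓝 0) := by
    have := (ENNReal.tendsto_toReal ENNReal.zero_ne_top).comp h1
    refine this.congr fun n => ENNReal.toReal_ofReal (by positivity)
  rw [tendsto_zero_iff_norm_tendsto_zero]
  have h3 := h2.sqrt
  simpa [Real.sqrt_sq] using h3

/-- Along the sparse times τ_n = (n+1)^p the second moments of the averages are summable, so these
averages tend to 0 almost surely. Between sampling times the bounded integrand changes the average
by at most M(τ_{n+1}/τ_n - 1), which tends to 0 since τ grows only polynomially. -/
theorem ae_tendsto_average_of_decay [IsProbabilityMeasure P] {G : ℝ → Ω → ℂ}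
    (hG : Measurable fun p : ℝ × Ω => G p.1 p.2) {C M η : ℝ} (hC : 0 ≤ C) (hη : 0 < η)
    (hM : ∀ t ω, ‖G t ω‖ ≤ M)
    (hK : ∀ s t, 0 ≤ s → 0 ≤ t → 1 ≤ |t - s| →
      ‖∫ ω, G s ω * conj (G t ω) ∂P‖ ≤ C * |t - s| ^ (-η)) :
    ∀ᵐ ω ∂P, Tendsto (fun T : ℝ => (T⁻¹ : ℂ) * ∫ t in (0 : ℝ)..T, G t ω) atTop (𝓝 0) := by
  set ζ := min 1 η / 2 with hζ
  have hζ0 : 0 < ζ := by have := lt_min one_pos hη; positivity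
  -- With pζ > 2 the decay τ_n^{-ζ} is at most (n+1)^{-2}.
  obtain ⟨p, hp⟩ := exists_nat_gt (2 / ζ)
  have hp0 : 0 < p := by
    have : (0 : ℝ) < p := lt_trans (by positivity) hp
    exact_mod_cast this
  rw [div_lt_iff₀ hζ0] at hp
  set τ : ℕ → ℝ := fun n => ((n : ℝ) + 1) ^ p with hτ
  have hτ1 : ∀ n, 1 ≤ τ n := fun n => one_le_pow₀ (by
    have : (0 : ℝ) ≤ n := n.cast_nonneg
    linarith)
  have hSm : ∀ T : ℝ, 0 ≤ T → Measurable fun ω => ∫ t in (0 : ℝ)..T, G t ω := fun T hT => by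
    simp_rw [intervalIntegral.integral_of_le hT]
    exact (hG.stronglyMeasurable.integral_prod_left (μ := volume.restrict (Ioc 0 T))).measurable
  have hSb : ∀ T ω, ‖∫ t in (0 : ℝ)..T, G t ω‖ ≤ M * |T - 0| := fun T ω =>
    intervalIntegral.norm_integral_le_of_norm_le_const fun t _ => hM t ω
  have hae := ae_tendsto_of_integral_norm_sq_le (P := P)
    (S := fun n ω => ((τ n)⁻¹ : ℂ) * ∫ t in (0 : ℝ)..τ n, G t ω) (A := 2 * M ^ 2 + C)
    (fun n => (hSm _ (by linarith [hτ1 n])).const_mul _) (fun n => by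
      refine Integrable.of_bound (C := (‖((τ n)⁻¹ : ℂ)‖ * (M * |τ n - 0|)) ^ 2)
        (((hSm _ (by linarith [hτ1 n])).const_mul _).norm.pow_const 2).aestronglyMeasurable
        (ae_of_all _ fun ω => ?_)
      rw [norm_pow, norm_norm, norm_mul]
      gcongr
      exact hSb _ _) (fun n => by
      have h := integral_norm_sq_integral_le hG hC hη hM hK (hτ1 n)
      have hn0 : 0 < τ n := by linarith [hτ1 n]
      have e : ∀ ω, ‖((τ n)⁻¹ : ℂ) * ∫ t in (0 : ℝ)..τ n, G t ω‖ ^ 2 =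
          (τ n ^ 2)⁻¹ * ‖∫ t in (0 : ℝ)..τ n, G t ω‖ ^ 2 := fun ω => by
        rw [norm_mul, mul_pow, norm_inv, Complex.norm_real, Real.norm_of_nonneg hn0.le, inv_pow]
      simp_rw [e]
      rw [integral_const_mul]
      refine (mul_le_mul_of_nonneg_left h (by positivity)).trans ?_
      have e2 : τ n ^ (-ζ) ≤ (((n : ℝ) + 1) ^ 2)⁻¹ := by
        rw [hτ]
        simp only
        have hn1 : (1 : ℝ) ≤ (n : ℝ) + 1 := by
          have : (0 : ℝ) ≤ n := n.cast_nonneg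
          linarith
        rw [← Real.rpow_natCast, ← Real.rpow_natCast, ← Real.rpow_neg (by linarith),
          ← Real.rpow_mul (by linarith)]
        refine Real.rpow_le_rpow_of_exponent_le hn1 ?_
        push_cast
        linarith
      rw [div_eq_mul_inv]
      calc _ = (2 * M ^ 2 + C) * τ n ^ (-ζ) := by rw [hζ]; field_simp
        _ ≤ _ := mul_le_mul_of_nonneg_left e2 (by positivity))
  filter_upwards [hae] with ω hω
  have hM0 : 0 ≤ M := (norm_nonneg _).trans (hM 0 ω)
  have hGi : ∀ a b, IntervalIntegrable (fun t => G t ω) volume a b := fun a b =>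
    (intervalIntegrable_const (c := M)).mono_fun
      (hG.comp measurable_prodMk_right).aestronglyMeasurable
      (ae_of_all _ fun t => (hM t ω).trans (le_abs_self M))
  -- the index of the last sampling time before `T`
  have hN : Tendsto (fun T : ℝ => ⌊T ^ (p : ℝ)⁻¹⌋₊ - 1) atTop atTop := by
    refine (tendsto_sub_atTop_nat 1).comp (tendsto_nat_floor_atTop.comp ?_)
    exact tendsto_rpow_atTop (by positivity)
  have hratio : Tendsto (fun n : ℕ => M * (τ (n + 1) / τ n - 1)) atTop (𝓝 0) := by
    have h1 : Tendsto (fun n : ℕ => 1 + ((n : ℝ) + 1)⁻¹) atTop (𝓝 (1 + 0)) :=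
      tendsto_const_nhds.add (tendsto_inv_atTop_zero.comp
        (tendsto_atTop_add_const_right _ _ tendsto_natCast_atTop_atTop))
    have h2 := ((h1.pow p).sub_const 1).const_mul M
    rw [add_zero, one_pow, sub_self, mul_zero] at h2
    refine h2.congr fun n => ?_
    have : (0 : ℝ) < (n : ℝ) + 1 := by positivity
    simp only [hτ]
    push_cast
    rw [← div_pow, show 1 + ((n : ℝ) + 1)⁻¹ = ((n : ℝ) + 1 + 1) / ((n : ℝ) + 1) by field_simp]
  have hbound : Tendsto (fun n : ℕ => ‖((τ n)⁻¹ : ℂ) * ∫ t in (0 : ℝ)..τ n, G t ω‖ +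
      M * (τ (n + 1) / τ n - 1)) atTop (𝓝 0) := by
    simpa using hω.norm.add hratio
  rw [tendsto_zero_iff_norm_tendsto_zero]
  refine squeeze_zero' (Eventually.of_forall fun _ => norm_nonneg _) ?_ (hbound.comp hN)
  filter_upwards [eventually_ge_atTop 1] with T hT
  have hT0 : 0 < T := by linarith
  set n := ⌊T ^ (p : ℝ)⁻¹⌋₊ - 1 with hn
  have hfl : 1 ≤ ⌊T ^ (p : ℝ)⁻¹⌋₊ := Nat.le_floor (by
    simpa using Real.one_le_rpow hT (by positivity))
  have hn1 : ((n : ℝ) + 1) = ⌊T ^ (p : ℝ)⁻¹⌋₊ := by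
    have : n + 1 = ⌊T ^ (p : ℝ)⁻¹⌋₊ := Nat.sub_add_cancel hfl
    exact_mod_cast this
  have hpow : (T ^ (p : ℝ)⁻¹) ^ p = T := Real.rpow_inv_natCast_pow hT0.le hp0.ne'
  have hlow : τ n ≤ T := by
    rw [hτ, ← hpow]
    simp only
    rw [hn1]
    exact pow_le_pow_left₀ (by positivity) (Nat.floor_le (by positivity)) p
  have hup : T ≤ τ (n + 1) := by
    rw [hτ]
    simp only
    push_cast
    rw [hn1]
    calc T = (T ^ (p : ℝ)⁻¹) ^ p := hpow.symm
      _ ≤ _ := pow_le_pow_left₀ (by positivity) (Nat.lt_floor_add_one _).le p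
  have hτ0 : 0 < τ n := by linarith [hτ1 n]
  have hsplit : ∫ t in (0 : ℝ)..T, G t ω = (∫ t in (0 : ℝ)..τ n, G t ω) +
      ∫ t in τ n..T, G t ω :=
    (intervalIntegral.integral_add_adjacent_intervals (hGi _ _) (hGi _ _)).symm
  have hrest : ‖∫ t in τ n..T, G t ω‖ ≤ M * |T - τ n| :=
    intervalIntegral.norm_integral_le_of_norm_le_const fun t _ => hM t ω
  rw [abs_of_nonneg (sub_nonneg.2 hlow)] at hrest
  simp only [Function.comp]
  rw [← hn, hsplit, norm_mul, norm_mul, norm_inv, norm_inv, Complex.norm_real, Complex.norm_real,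
    Real.norm_of_nonneg hT0.le, Real.norm_of_nonneg hτ0.le]
  have hinv : T⁻¹ ≤ (τ n)⁻¹ := inv_anti₀ hτ0 hlow
  calc T⁻¹ * ‖(∫ t in (0 : ℝ)..τ n, G t ω) + ∫ t in τ n..T, G t ω‖
      ≤ (τ n)⁻¹ * (‖∫ t in (0 : ℝ)..τ n, G t ω‖ + M * (τ (n + 1) - τ n)) := by
        refine mul_le_mul hinv ((norm_add_le _ _).trans ?_) (norm_nonneg _) (by positivity)
        have : M * (T - τ n) ≤ M * (τ (n + 1) - τ n) := by gcongr
        linarith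
    _ = _ := by field_simp

end

end FracField

namespace FracField

/-! ### The ergodic theorem -/

section

variable {Ω : Type*} [MeasurableSpace Ω] {P : Measure Ω} {S : Type*} [MeasurableSpace S]

/-- Invariance of the finite-dimensional distributions under time shifts. -/
def ShiftInvariant (P : Measure Ω) (φ : ℝ≥0 → Ω → S) : Prop :=
  ∀ (n : ℕ) (t : Fin n → ℝ≥0) (r : ℝ≥0),
    P.map (fun ω i => φ (t i + r) ω) = P.map fun ω i => φ (t i) ω

/-- `h(φ)` is continuous in mean at time zero. -/
def MeanContinuous {F : Type*} [NormedAddCommGroup F] (P : Measure Ω) (φ : ℝ≥0 → Ω → S)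
    (h : S → F) : Prop :=
  Tendsto (fun u => ∫⁻ ω, ‖h (φ u ω) - h (φ 0 ω)‖ₑ ∂P) (𝓝 0) (𝓝 0)

variable {φ : ℝ≥0 → Ω → S} (hφ : Measurable fun p : ℝ≥0 × Ω => φ p.1 p.2)

include hφ in
theorem measurable_slice (t : ℝ≥0) : Measurable (φ t) := hφ.comp measurable_prodMk_left

include hφ in
theorem ShiftInvariant.lintegral_eq (hst : ShiftInvariant P φ) {h : S → ℝ≥0∞} (hh : Measurable h)
    (t : ℝ≥0) : ∫⁻ ω, h (φ t ω) ∂P = ∫⁻ ω, h (φ 0 ω) ∂P := by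
  have key : ∀ s, ∫⁻ ω, h (φ s ω) ∂P =
      ∫⁻ x : Fin 1 → S, h (x 0) ∂P.map (fun ω _ => φ s ω) := fun s => by
    rw [lintegral_map (f := fun x : Fin 1 → S => h (x 0)) (hh.comp (measurable_pi_apply 0))
      (measurable_pi_lambda _ fun _ => measurable_slice hφ s)]
  have := hst 1 (fun _ => 0) t
  simp only [zero_add] at this
  rw [key, key 0, this]

include hφ in
theorem ShiftInvariant.lintegral_pair_eq (hst : ShiftInvariant P φ) {h : S × S → ℝ≥0∞}
    (hh : Measurable h) (u r : ℝ≥0) :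
    ∫⁻ ω, h (φ (u + r) ω, φ r ω) ∂P = ∫⁻ ω, h (φ u ω, φ 0 ω) ∂P := by
  have key : ∀ s : Fin 2 → ℝ≥0, ∫⁻ ω, h (φ (s 0) ω, φ (s 1) ω) ∂P =
      ∫⁻ x : Fin 2 → S, h (x 0, x 1) ∂P.map (fun ω i => φ (s i) ω) := fun s => by
    rw [lintegral_map (f := fun x : Fin 2 → S => h (x 0, x 1))
      (hh.comp ((measurable_pi_apply 0).prodMk (measurable_pi_apply 1)))
      (measurable_pi_lambda _ fun i => measurable_slice hφ (s i))]
  have h1 := key (fun i => (![u, 0] : Fin 2 → ℝ≥0) i + r)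
  have h2 := key ![u, 0]
  rw [hst 2 ![u, 0] r, ← h2] at h1
  simpa using h1

include hφ in
theorem ShiftInvariant.integrable_comp {F : Type*} [NormedAddCommGroup F] [MeasurableSpace F]
    [BorelSpace F] [SecondCountableTopology F] (hst : ShiftInvariant P φ) {h : S → F}
    (hh : Measurable h) (hi : Integrable (fun ω => h (φ 0 ω)) P) (t : ℝ≥0) :
    Integrable (fun ω => h (φ t ω)) P := by
  refine ⟨(hh.comp (measurable_slice hφ t)).aestronglyMeasurable, ?_⟩
  rw [hasFiniteIntegral_iff_enorm, hst.lintegral_eq hφ hh.enorm]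
  exact hi.2

theorem measurable_path {F : Type*} [MeasurableSpace F] {h : S → F} (hh : Measurable h)
    (hφ : Measurable fun p : ℝ≥0 × Ω => φ p.1 p.2) :
    Measurable fun p : ℝ × Ω => h (φ p.1.toNNReal p.2) :=
  hh.comp (hφ.comp ((measurable_real_toNNReal.comp measurable_fst).prodMk measurable_snd))

/-- By Tonelli and stationarity, the expected integral of |h(φ)| over a bounded interval is its
length times the mean of |h(φ 0)|; countably many intervals suffice. -/
theorem ShiftInvariant.ae_intervalIntegrable {F : Type*} [NormedAddCommGroup F] [MeasurableSpace F]
    [BorelSpace F] [SecondCountableTopology F] [SFinite P]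
    (hφ : Measurable fun p : ℝ≥0 × Ω => φ p.1 p.2) (hst : ShiftInvariant P φ) {h : S → F}
    (hh : Measurable h) (hi : Integrable (fun ω => h (φ 0 ω)) P) :
    ∀ᵐ ω ∂P, ∀ a b : ℝ, IntervalIntegrable (fun t : ℝ => h (φ t.toNNReal ω)) volume a b := by
  have hm := measurable_path hh hφ
  have key : ∀ n : ℕ, ∀ᵐ ω ∂P, IntegrableOn (fun t : ℝ => h (φ t.toNNReal ω)) (Icc (-n : ℝ) n) := by
    intro n
    have hfin : ∫⁻ ω, (∫⁻ t in Icc (-n : ℝ) n, ‖h (φ t.toNNReal ω)‖ₑ) ∂P ≠ ∞ := by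
      rw [lintegral_lintegral_swap (hm.comp measurable_swap).enorm.aemeasurable]
      simp_rw [hst.lintegral_eq hφ hh.enorm]
      rw [lintegral_const]
      exact ENNReal.mul_ne_top hi.2.ne (by simp)
    filter_upwards [ae_lt_top ((hm.comp measurable_swap).enorm.lintegral_prod_right') hfin]
      with ω hω
    exact ⟨(hm.comp measurable_prodMk_right).aestronglyMeasurable, hω⟩
  filter_upwards [ae_all_iff.2 key] with ω hω a b
  obtain ⟨n, hn⟩ := exists_nat_ge (max |a| |b|)
  have ha := abs_le.1 ((le_max_left _ _).trans hn)
  have hb := abs_le.1 ((le_max_right _ _).trans hn)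
  refine ⟨(hω n).mono_set fun x hx => ?_, (hω n).mono_set fun x hx => ?_⟩
  · exact ⟨ha.1.trans hx.1.le, hx.2.trans hb.2⟩
  · exact ⟨hb.1.trans hx.1.le, hx.2.trans ha.2⟩

/-- By stationarity of pairs, the error on each cell of length 1/j is governed by the mean modulus
of continuity at time zero. -/
theorem ShiftInvariant.lintegral_riemann_le [SFinite P]
    (hφ : Measurable fun p : ℝ≥0 × Ω => φ p.1 p.2) (hst : ShiftInvariant P φ) {h : S → ℝ}
    (hh : Measurable h) (hi : Integrable (fun ω => h (φ 0 ω)) P) {j : ℕ} (hj : 0 < j) {δ : ℝ≥0∞}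
    (hδ : ∀ u : ℝ≥0, u ≤ 1 / j → ∫⁻ ω, ‖h (φ u ω) - h (φ 0 ω)‖ₑ ∂P ≤ δ) (n : ℕ) :
    ∫⁻ ω, ‖(j : ℝ)⁻¹ * ∑ i ∈ Finset.range (n * j), h (φ ((i : ℝ≥0) / j) ω) -
      ∫ t in (0 : ℝ)..n, h (φ t.toNNReal ω)‖ₑ ∂P ≤ n * δ := by
  have hj' : (0 : ℝ) < j := by exact_mod_cast hj
  have hm := measurable_path hh hφ
  have hlen : ∀ i : ℕ, ((i + 1 : ℕ) : ℝ) / j - (i : ℝ) / j = (j : ℝ)⁻¹ := fun i => by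
    push_cast; field_simp; ring
  have hle : ∀ i : ℕ, (i : ℝ) / j ≤ ((i + 1 : ℕ) : ℝ) / j := fun i => by
    gcongr; exact i.le_succ
  have hdm : ∀ i : ℕ, Measurable fun p : Ω × ℝ =>
      ‖h (φ ((i : ℝ≥0) / j) p.1) - h (φ p.2.toNNReal p.1)‖ₑ := fun i =>
    (((hh.comp (measurable_slice hφ _)).comp measurable_fst).sub
      (hm.comp measurable_swap)).enorm
  have hpt : ∀ᵐ ω ∂P, ‖(j : ℝ)⁻¹ * ∑ i ∈ Finset.range (n * j), h (φ ((i : ℝ≥0) / j) ω) -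
      ∫ t in (0 : ℝ)..n, h (φ t.toNNReal ω)‖ₑ ≤ ∑ i ∈ Finset.range (n * j),
        ∫⁻ t in Ioc ((i : ℝ) / j) ((i + 1 : ℕ) / j),
          ‖h (φ ((i : ℝ≥0) / j) ω) - h (φ t.toNNReal ω)‖ₑ := by
    filter_upwards [hst.ae_intervalIntegrable hφ hh hi] with ω hω
    have e1 : ∫ t in (0 : ℝ)..n, h (φ t.toNNReal ω) = ∑ i ∈ Finset.range (n * j),
        ∫ t in ((i : ℝ) / j)..((i + 1 : ℕ) / j), h (φ t.toNNReal ω) := by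
      rw [intervalIntegral.sum_integral_adjacent_intervals (a := fun i : ℕ => (i : ℝ) / j)
        fun i _ => hω _ _]
      congr 1
      · simp
      · push_cast; field_simp
    rw [e1, Finset.mul_sum, ← Finset.sum_sub_distrib]
    refine (enorm_sum_le _ _).trans (Finset.sum_le_sum fun i _ => ?_)
    have e2 : (j : ℝ)⁻¹ * h (φ ((i : ℝ≥0) / j) ω) -
        ∫ t in ((i : ℝ) / j)..((i + 1 : ℕ) / j), h (φ t.toNNReal ω) =
        ∫ t in ((i : ℝ) / j)..((i + 1 : ℕ) / j), (h (φ ((i : ℝ≥0) / j) ω) - h (φ t.toNNReal ω)) := by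
      rw [intervalIntegral.integral_sub intervalIntegrable_const (hω _ _),
        intervalIntegral.integral_const, hlen, smul_eq_mul]
    rw [e2, intervalIntegral.integral_of_le (hle i)]
    exact enorm_integral_le_lintegral_enorm _
  refine (lintegral_mono_ae hpt).trans ?_
  rw [lintegral_finsetSum _ fun i _ => (hdm i).lintegral_prod_right']
  calc _ ≤ ∑ i ∈ Finset.range (n * j), δ * ENNReal.ofReal (j : ℝ)⁻¹ := by
        refine Finset.sum_le_sum fun i _ => ?_
        rw [lintegral_lintegral_swap (hdm i).aemeasurable]
        calc _ ≤ ∫⁻ t in Ioc ((i : ℝ) / j) ((i + 1 : ℕ) / j), δ := by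
              refine setLIntegral_mono measurable_const fun t ht => ?_
              have hti : (i : ℝ) / j ≤ t := ht.1.le
              have et : t.toNNReal = (t - i / j).toNNReal + (i : ℝ≥0) / j := by
                ext
                have h0 : (0 : ℝ) ≤ i / j := by positivity
                push_cast
                rw [Real.coe_toNNReal _ (h0.trans hti), Real.coe_toNNReal _ (sub_nonneg.2 hti)]
                ring
              have h2 := hst.lintegral_pair_eq hφ (h := fun p : S × S => ‖h p.2 - h p.1‖ₑ)
                ((hh.comp measurable_snd).sub (hh.comp measurable_fst)).enorm
                (t - i / j).toNNReal ((i : ℝ≥0) / j)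
              rw [← et] at h2
              simp only at h2
              rw [h2]
              simp_rw [enorm_sub_rev (h (φ 0 _))]
              refine hδ _ ?_
              rw [← NNReal.coe_le_coe, Real.coe_toNNReal _ (sub_nonneg.2 hti)]
              have := ht.2
              have := hlen i
              push_cast at *
              rw [one_div]
              linarith
          _ = _ := by rw [lintegral_const, Measure.restrict_apply_univ, Real.volume_Ioc, hlen]
    _ = n * δ := by
        rw [Finset.sum_const, Finset.card_range, nsmul_eq_mul, ENNReal.ofReal_inv_of_pos hj',
          ENNReal.ofReal_natCast]
        push_cast
        rw [mul_comm δ, ← mul_assoc, mul_assoc (n : ℝ≥0∞),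
          ENNReal.mul_inv_cancel (by exact_mod_cast hj.ne') (ENNReal.natCast_ne_top j), mul_one]

/-- The discrete maximal inequality is applied to the samples h(φ(i/j)). Mean continuity makes the
Riemann sums close to the integrals for finitely many n at once; halving c to absorb that error is
the source of the factor 2. -/
theorem ShiftInvariant.measure_exists_le [IsProbabilityMeasure P]
    (hφ : Measurable fun p : ℝ≥0 × Ω => φ p.1 p.2) (hst : ShiftInvariant P φ) {h : S → ℝ}
    (hh : Measurable h) (h0 : ∀ x, 0 ≤ h x) (hi : Integrable (fun ω => h (φ 0 ω)) P)
    (hc : MeanContinuous P φ h) {c : ℝ} (hcpos : 0 < c) :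
    P {ω | ∃ n : ℕ, 0 < n ∧ n * c < ∫ t in (0 : ℝ)..n, h (φ t.toNNReal ω)} ≤
      ENNReal.ofReal (2 * (∫ ω, h (φ 0 ω) ∂P) / c) := by
  have hm := measurable_path hh hφ
  have hIm : ∀ n : ℕ, Measurable fun ω => ∫ t in (0 : ℝ)..n, h (φ t.toNNReal ω) := fun n => by
    simp_rw [intervalIntegral.integral_of_le (Nat.cast_nonneg (α := ℝ) n)]
    exact (hm.stronglyMeasurable.integral_prod_left (μ := volume.restrict (Ioc 0 (n : ℝ)))).measurable
  set A : ℕ → Set Ω := fun N =>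
    {ω | ∃ n ≤ N, 0 < n ∧ n * c < ∫ t in (0 : ℝ)..n, h (φ t.toNNReal ω)} with hA
  have hmono : Monotone A := by
    rintro N N' hN ω ⟨n, hn, h1⟩
    exact ⟨n, hn.trans hN, h1⟩
  have hunion : {ω | ∃ n : ℕ, 0 < n ∧ n * c < ∫ t in (0 : ℝ)..n, h (φ t.toNNReal ω)} =
      ⋃ N, A N := by
    ext ω
    simp only [hA, mem_ofPred_eq, mem_iUnion]
    exact ⟨fun ⟨n, h1⟩ => ⟨n, n, le_rfl, h1⟩, fun ⟨_, n, _, h1⟩ => ⟨n, h1⟩⟩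
  rw [hunion, hmono.directed_le.measure_iUnion]
  refine iSup_le fun N => ENNReal.le_of_forall_pos_le_add fun ε hε _ => ?_
  -- choose the mesh
  obtain ⟨δ, hδ0, hδ⟩ : ∃ δ : ℝ≥0∞, 0 < δ ∧
      (N + 1 : ℕ) * ((N * δ) / ENNReal.ofReal (c / 2)) ≤ ε := by
    have hcc : ENNReal.ofReal (c / 2) ≠ 0 := (ENNReal.ofReal_pos.2 (half_pos hcpos)).ne'
    have ht : Tendsto (fun δ : ℝ≥0∞ => (N + 1 : ℕ) * ((N * δ) / ENNReal.ofReal (c / 2))) (𝓝 0)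
        (𝓝 ((N + 1 : ℕ) * ((N * 0) / ENNReal.ofReal (c / 2)))) := by
      refine ENNReal.Tendsto.const_mul (ENNReal.Tendsto.div_const
        (ENNReal.Tendsto.const_mul tendsto_id (Or.inr (ENNReal.natCast_ne_top _))) ?_)
        (Or.inr (ENNReal.natCast_ne_top _))
      exact Or.inr hcc
    rw [mul_zero, ENNReal.zero_div, mul_zero] at ht
    have h1 := ht.eventually (Iic_mem_nhds (by exact_mod_cast hε : (0 : ℝ≥0∞) < ε))
    have h2 : ∀ᶠ δ in 𝓝[>] (0 : ℝ≥0∞), (N + 1 : ℕ) * ((N * δ) / ENNReal.ofReal (c / 2)) ≤ ε :=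
      nhdsWithin_le_nhds h1
    obtain ⟨δ, h3, h4⟩ := (h2.and self_mem_nhdsWithin).exists
    exact ⟨δ, h4, h3⟩
  obtain ⟨j, hj0, hj⟩ : ∃ j : ℕ, 0 < j ∧ ∀ u : ℝ≥0, u ≤ 1 / j →
      ∫⁻ ω, ‖h (φ u ω) - h (φ 0 ω)‖ₑ ∂P ≤ δ := by
    obtain ⟨r, hr, hr'⟩ := Metric.eventually_nhds_iff.1 (hc.eventually (Iic_mem_nhds hδ0))
    obtain ⟨j, hj⟩ := exists_nat_one_div_lt hr
    refine ⟨j + 1, j.succ_pos, fun u hu => hr' ?_⟩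
    rw [NNReal.dist_eq, NNReal.coe_zero, sub_zero, abs_of_nonneg u.coe_nonneg]
    refine lt_of_le_of_lt ?_ hj
    have := NNReal.coe_le_coe.2 hu
    push_cast at this
    exact this
  have hj' : (0 : ℝ) < j := by exact_mod_cast hj0
  set X : ℕ → Ω → ℝ := fun i ω => h (φ ((i : ℝ≥0) / j) ω) with hX
  have hXm : ∀ i, Measurable (X i) := fun i => hh.comp (measurable_slice hφ _)
  have hXst : IsStationarySeq P X := fun n => by
    have hs : Measurable fun (x : Fin n → S) (i : Fin n) => h (x i) :=
      measurable_pi_lambda _ fun i => hh.comp (measurable_pi_apply i)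
    have := congr_arg (Measure.map fun (x : Fin n → S) (i : Fin n) => h (x i))
      (hst n (fun i => (i : ℝ≥0) / j) (1 / j))
    rw [Measure.map_map hs (measurable_pi_lambda _ fun i => measurable_slice hφ _),
      Measure.map_map hs (measurable_pi_lambda _ fun i => measurable_slice hφ _)] at this
    simp only [hX]
    push_cast
    simp_rw [add_div]
    exact this
  have hmax := hXst.measure_exists_le hXm
    (fun i => hst.integrable_comp hφ hh hi _) (fun i ω => h0 _) (half_pos hcpos) (N * j)
  set R : ℕ → Ω → ℝ := fun n ω => (j : ℝ)⁻¹ * ∑ i ∈ Finset.range (n * j), X i ω with hR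
  have hRm : ∀ n, Measurable (R n) := fun n =>
    (Finset.measurable_sum _ fun i _ => hXm i).const_mul _
  -- Either a Riemann sum misses its integral by at least c/2, or it exceeds nc - c/2 ≥ nc/2; the
  -- last step requires n ≥ 1.
  have hsub : A N ⊆ {ω | ∃ n ≤ N * j, n * (c / 2) < ∑ i ∈ Finset.range n, X i ω} ∪
      ⋃ n ∈ Finset.range (N + 1), {ω | ENNReal.ofReal (c / 2) ≤
        ‖R n ω - ∫ t in (0 : ℝ)..n, h (φ t.toNNReal ω)‖ₑ} := by
    rintro ω ⟨n, hn, hn0, hlt⟩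
    by_cases hd : c / 2 ≤ ‖R n ω - ∫ t in (0 : ℝ)..n, h (φ t.toNNReal ω)‖
    · refine Or.inr (mem_biUnion (Finset.mem_range.2 (Nat.lt_succ_of_le hn)) ?_)
      rw [mem_ofPred_eq, ← ofReal_norm]
      exact ENNReal.ofReal_le_ofReal hd
    · refine Or.inl ⟨n * j, Nat.mul_le_mul_right j hn, ?_⟩
      rw [not_le, Real.norm_eq_abs, abs_lt] at hd
      have hn1 : (1 : ℝ) ≤ n := by exact_mod_cast hn0
      have h3 : n * (c / 2) < R n ω := by nlinarith [hd.1]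
      rw [hR] at h3
      simp only at h3
      rw [inv_mul_eq_div, lt_div_iff₀ hj'] at h3
      push_cast
      nlinarith
  refine (measure_mono hsub).trans ((measure_union_le _ _).trans (add_le_add ?_ ?_))
  · refine hmax.trans (le_of_eq ?_)
    rw [hX]
    simp only [Nat.cast_zero, zero_div]
    congr 1
    field_simp
  · refine (measure_biUnion_finset_le _ _).trans (le_trans ?_ hδ)
    calc _ ≤ ∑ n ∈ Finset.range (N + 1), (N * δ) / ENNReal.ofReal (c / 2) := by
          refine Finset.sum_le_sum fun n hn => ?_
          refine (meas_ge_le_lintegral_div ((hRm n).sub (hIm n)).enorm.aemeasurable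
            (ENNReal.ofReal_pos.2 (half_pos hcpos)).ne' ENNReal.ofReal_ne_top).trans ?_
          gcongr
          refine (hst.lintegral_riemann_le hφ hh hi hj0 hj n).trans ?_
          gcongr
          exact Nat.lt_succ_iff.1 (Finset.mem_range.1 hn)
      _ = _ := by rw [Finset.sum_const, Finset.card_range, nsmul_eq_mul]

end

end FracField

namespace FracField

/-! ### The continuous time ergodic theorem for processes with decorrelating characters. -/

section

variable {Ω : Type*} [MeasurableSpace Ω] {P : Measure Ω} {E : Type*} [NormedAddCommGroup E]
  [InnerProductSpace ℂ E] [MeasurableSpace E] [BorelSpace E] {φ : ℝ≥0 → Ω → E}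

/-- Time averages of `f(φ)` converge almost surely to the mean. -/
def AveragesConverge (P : Measure Ω) (φ : ℝ≥0 → Ω → E) (f : E → ℂ) : Prop :=
  ∀ᵐ ω ∂P, Tendsto (fun T : ℝ => (T⁻¹ : ℂ) * ∫ t in (0 : ℝ)..T, f (φ t.toNNReal ω)) atTop
    (𝓝 (∫ ω', f (φ 0 ω') ∂P))

theorem averagesConverge_of_mem_trigPoly [IsProbabilityMeasure P]
    (hφ : Measurable fun p : ℝ≥0 × Ω => φ p.1 p.2)
    (h : ∀ v, AveragesConverge P φ (chi v)) {f : E → ℂ} (hf : f ∈ trigPoly E) :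
    AveragesConverge P φ f := by
  have hint : ∀ g ∈ trigPoly E, Integrable (fun ω => g (φ 0 ω)) P := fun g hg => by
    obtain ⟨hc, C, hC⟩ := trigPoly_bounded hg
    exact Integrable.of_bound (hc.measurable.comp (measurable_slice hφ 0)).aestronglyMeasurable C
      (ae_of_all _ fun ω => hC _)
  have hint' : ∀ g ∈ trigPoly E, ∀ ω a b,
      IntervalIntegrable (fun t : ℝ => g (φ t.toNNReal ω)) volume a b := fun g hg ω a b => by
    obtain ⟨hc, C, hC⟩ := trigPoly_bounded hg
    refine (intervalIntegrable_const (c := C)).mono_fun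
      ((measurable_path hc.measurable hφ).comp measurable_prodMk_right).aestronglyMeasurable
      (ae_of_all _ fun t => (hC _).trans (le_abs_self C))
  induction hf using Submodule.span_induction with
  | mem f hf =>
    obtain ⟨v, rfl⟩ := hf
    exact h v
  | zero =>
    refine ae_of_all _ fun ω => ?_
    simp
  | add f g hf hg h1 h2 =>
    filter_upwards [h1, h2] with ω h1 h2
    simp only [Pi.add_apply]
    rw [integral_add (hint f hf) (hint g hg)]
    refine (h1.add h2).congr fun T => ?_
    rw [intervalIntegral.integral_add (hint' f hf ω _ _) (hint' g hg ω _ _), mul_add]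
  | smul c f hf h1 =>
    filter_upwards [h1] with ω h1
    simp only [Pi.smul_apply, smul_eq_mul]
    rw [integral_const_mul]
    refine (h1.const_mul c).congr fun T => ?_
    rw [intervalIntegral.integral_const_mul]
    ring

theorem meanContinuous_of_mem_trigPoly (hφ : Measurable fun p : ℝ≥0 × Ω => φ p.1 p.2)
    (h : ∀ v, MeanContinuous P φ (chi (E := E) v)) {f : E → ℂ} (hf : f ∈ trigPoly E) :
    MeanContinuous P φ f := by
  induction hf using Submodule.span_induction with
  | mem f hf =>
    obtain ⟨v, rfl⟩ := hf
    exact h v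
  | zero => simp [MeanContinuous]
  | add f g hf hg h1 h2 =>
    have := Tendsto.add h1 h2
    rw [add_zero] at this
    refine tendsto_of_tendsto_of_tendsto_of_le_of_le tendsto_const_nhds this (fun _ => zero_le)
      fun u => ?_
    have hfm := (trigPoly_bounded hf).1.measurable
    simp only
    have hm : Measurable fun ω => ‖f (φ u ω) - f (φ 0 ω)‖ₑ :=
      ((hfm.comp (measurable_slice hφ u)).sub (hfm.comp (measurable_slice hφ 0))).enorm
    rw [← lintegral_add_left hm]
    refine lintegral_mono fun ω => ?_
    simp only [Pi.add_apply, add_sub_add_comm]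
    exact enorm_add_le _ _
  | smul c f hf h1 =>
    have := ENNReal.Tendsto.const_mul (a := ‖c‖ₑ) h1 (Or.inr enorm_ne_top)
    rw [mul_zero] at this
    refine this.congr fun u => ?_
    rw [← lintegral_const_mul' _ _ enorm_ne_top]
    refine lintegral_congr fun ω => ?_
    simp only [Pi.smul_apply, ← smul_sub]
    rw [enorm_smul]

/-- After centring at the common mean m, the covariance is exactly the quantity bounded by `hdec`,
and the law for weakly correlated bounded processes applies. -/
theorem averagesConverge_chi [IsProbabilityMeasure P]
    (hφ : Measurable fun p : ℝ≥0 × Ω => φ p.1 p.2) (hst : ShiftInvariant P φ) {v : E} {C η : ℝ}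
    (hC : 0 ≤ C) (hη : 0 < η)
    (hdec : ∀ s t : ℝ≥0, 1 ≤ |(t : ℝ) - s| →
      ‖∫ ω, chi v (φ s ω) * conj (chi v (φ t ω)) ∂P -
        (∫ ω, chi v (φ 0 ω) ∂P) * conj (∫ ω, chi v (φ 0 ω) ∂P)‖ ≤ C * |(t : ℝ) - s| ^ (-η)) :
    AveragesConverge P φ (chi v) := by
  set m := ∫ ω, chi v (φ 0 ω) ∂P with hm
  have hcm : Measurable (chi v) := (continuous_chi v).measurable
  have hbi : ∀ t, Integrable (fun ω => chi v (φ t ω)) P := fun t =>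
    Integrable.of_bound (hcm.comp (measurable_slice hφ t)).aestronglyMeasurable 1
      (ae_of_all _ fun ω => (norm_chi _ _).le)
  have hbi2 : ∀ s t, Integrable (fun ω => chi v (φ s ω) * conj (chi v (φ t ω))) P := fun s t =>
    Integrable.of_bound ((hcm.comp (measurable_slice hφ s)).mul
      (Complex.continuous_conj.measurable.comp
        (hcm.comp (measurable_slice hφ t)))).aestronglyMeasurable 1
      (ae_of_all _ fun ω => by simp [norm_chi])
  have hmt : ∀ t, ∫ ω, chi v (φ t ω) ∂P = m := fun t => by
    have key : ∀ s, ∫ ω, chi v (φ s ω) ∂P =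
        ∫ x : Fin 1 → E, chi v (x 0) ∂P.map (fun ω _ => φ s ω) := fun s => by
      rw [integral_map (measurable_pi_lambda _ fun _ => measurable_slice hφ s).aemeasurable
        (f := fun x : Fin 1 → E => chi v (x 0))
        (hcm.comp (measurable_pi_apply 0)).aestronglyMeasurable]
    have := hst 1 (fun _ => 0) t
    simp only [zero_add] at this
    rw [hm, key, key 0, this]
  have hm1 : ‖m‖ ≤ 1 := by
    refine (norm_integral_le_of_norm_le_const (C := 1)
      (ae_of_all _ fun ω => (norm_chi _ _).le)).trans ?_
    simp
  have hGm : Measurable fun p : ℝ × Ω => chi v (φ p.1.toNNReal p.2) - m :=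
    (measurable_path hcm hφ).sub_const m
  have hcov : ∀ s t, ∫ ω, (chi v (φ s ω) - m) * conj (chi v (φ t ω) - m) ∂P =
      ∫ ω, chi v (φ s ω) * conj (chi v (φ t ω)) ∂P - m * conj m := fun s t => by
    have e : ∀ ω, (chi v (φ s ω) - m) * conj (chi v (φ t ω) - m) =
        (chi v (φ s ω) * conj (chi v (φ t ω)) - chi v (φ s ω) * conj m) -
          (m * conj (chi v (φ t ω)) - m * conj m) := fun ω => by
      rw [map_sub]; ring
    have hci : Integrable (fun ω => conj (chi v (φ t ω))) P :=
      Complex.conjCLE.toContinuousLinearMap.integrable_comp (hbi t)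
    have i1 : Integrable (fun ω => chi v (φ s ω) * conj (chi v (φ t ω)) -
        chi v (φ s ω) * conj m) P := (hbi2 s t).sub ((hbi s).mul_const _)
    have i2 : Integrable (fun ω => m * conj (chi v (φ t ω)) - m * conj m) P :=
      (hci.const_mul m).sub (integrable_const _)
    simp_rw [e]
    rw [integral_sub i1 i2, integral_sub (hbi2 s t) ((hbi s).mul_const _),
      integral_sub (hci.const_mul m) (integrable_const _), integral_mul_const, integral_const_mul,
      integral_conj, hmt, hmt]
    simp
  have := ae_tendsto_average_of_decay (P := P)
    (G := fun t ω => chi v (φ t.toNNReal ω) - m) hGm hC hη (M := 2)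
    (fun t ω => (norm_sub_le _ _).trans (by rw [norm_chi]; linarith)) (fun s t hs ht h1 => by
      rw [hcov]
      have := hdec s.toNNReal t.toNNReal
      rw [Real.coe_toNNReal _ hs, Real.coe_toNNReal _ ht] at this
      exact this h1)
  filter_upwards [this] with ω hω
  have h2 := hω.add_const m
  rw [zero_add] at h2
  refine h2.congr' ?_
  filter_upwards [eventually_gt_atTop 0] with T hT
  have hci : IntervalIntegrable (fun t : ℝ => chi v (φ t.toNNReal ω)) volume 0 T :=
    (intervalIntegrable_const (c := (1 : ℝ))).mono_fun
      ((measurable_path hcm hφ).comp measurable_prodMk_right).aestronglyMeasurable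
      (ae_of_all _ fun t => by simp [norm_chi])
  rw [intervalIntegral.integral_sub hci intervalIntegrable_const, intervalIntegral.integral_const,
    sub_zero, Complex.real_smul, mul_sub, ← mul_assoc,
    inv_mul_cancel₀ (by exact_mod_cast hT.ne'), one_mul]
  ring

omit [NormedAddCommGroup E] [InnerProductSpace ℂ E] [BorelSpace E] in
-- An ε/3 argument: stationarity makes the approximation error at time u equal to the error at time
-- 0. No continuity of ρ itself is involved.
theorem MeanContinuous.of_approx [IsProbabilityMeasure P]
    (hφ : Measurable fun p : ℝ≥0 × Ω => φ p.1 p.2) (hst : ShiftInvariant P φ) {ρ : E → ℂ}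
    (hρ : Measurable ρ)
    (h : ∀ ε : ℝ≥0∞, ε ≠ 0 → ∃ f : E → ℂ, Measurable f ∧ MeanContinuous P φ f ∧
      ∫⁻ ω, ‖ρ (φ 0 ω) - f (φ 0 ω)‖ₑ ∂P ≤ ε) :
    MeanContinuous P φ ρ := by
  rw [MeanContinuous, ENNReal.tendsto_nhds_zero]
  intro ε hε
  obtain ⟨f, hfm, hfc, hf⟩ := h (ε / 3) (ENNReal.div_pos hε.ne' (by norm_num)).ne'
  have h3 : (0 : ℝ≥0∞) < ε / 3 := ENNReal.div_pos hε.ne' (by norm_num)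
  filter_upwards [(ENNReal.tendsto_nhds_zero.1 hfc) (ε / 3) h3] with u hu
  have hm1 : Measurable fun x => ‖ρ x - f x‖ₑ := (hρ.sub hfm).enorm
  have hu' := hst.lintegral_eq hφ hm1 u
  have hms := fun t => measurable_slice hφ t
  calc ∫⁻ ω, ‖ρ (φ u ω) - ρ (φ 0 ω)‖ₑ ∂P
      ≤ ∫⁻ ω, (‖ρ (φ u ω) - f (φ u ω)‖ₑ + ‖f (φ u ω) - f (φ 0 ω)‖ₑ +
          ‖ρ (φ 0 ω) - f (φ 0 ω)‖ₑ) ∂P := by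
        refine lintegral_mono fun ω => ?_
        have e : ρ (φ u ω) - ρ (φ 0 ω) = (ρ (φ u ω) - f (φ u ω)) + (f (φ u ω) - f (φ 0 ω)) +
          -(ρ (φ 0 ω) - f (φ 0 ω)) := by ring
        rw [e]
        refine (enorm_add_le _ _).trans ?_
        rw [enorm_neg]
        exact add_le_add (enorm_add_le _ _) le_rfl
    _ = ∫⁻ ω, ‖ρ (φ u ω) - f (φ u ω)‖ₑ ∂P + ∫⁻ ω, ‖f (φ u ω) - f (φ 0 ω)‖ₑ ∂P +
          ∫⁻ ω, ‖ρ (φ 0 ω) - f (φ 0 ω)‖ₑ ∂P := by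
        have ha : ∀ t, Measurable fun ω => ‖ρ (φ t ω) - f (φ t ω)‖ₑ := fun t => hm1.comp (hms t)
        rw [lintegral_add_right _ (ha 0), lintegral_add_left (ha u)]
    _ ≤ ε / 3 + ε / 3 + ε / 3 := by
        gcongr
        rw [hu']; exact hf
    _ = ε := ENNReal.add_thirds ε

omit [NormedAddCommGroup E] [InnerProductSpace ℂ E] [BorelSpace E] in
theorem MeanContinuous.norm_sub (hφ : Measurable fun p : ℝ≥0 × Ω => φ p.1 p.2) {ρ f : E → ℂ}
    (hρm : Measurable ρ) (hρ : MeanContinuous P φ ρ) (hf : MeanContinuous P φ f) :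
    MeanContinuous P φ fun x => ‖ρ x - f x‖ := by
  have := Tendsto.add hρ hf
  rw [add_zero] at this
  refine tendsto_of_tendsto_of_tendsto_of_le_of_le tendsto_const_nhds this (fun _ => zero_le)
    fun u => ?_
  simp only
  have hm : Measurable fun ω => ‖ρ (φ u ω) - ρ (φ 0 ω)‖ₑ :=
    ((hρm.comp (measurable_slice hφ u)).sub (hρm.comp (measurable_slice hφ 0))).enorm
  rw [← lintegral_add_left hm]
  refine lintegral_mono fun ω => ?_
  have h1 := abs_norm_sub_norm_le (ρ (φ u ω) - f (φ u ω)) (ρ (φ 0 ω) - f (φ 0 ω))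
  have h2 : ‖(ρ (φ u ω) - f (φ u ω)) - (ρ (φ 0 ω) - f (φ 0 ω))‖ₑ ≤
      ‖ρ (φ u ω) - ρ (φ 0 ω)‖ₑ + ‖f (φ u ω) - f (φ 0 ω)‖ₑ := by
    rw [sub_sub_sub_comm]; exact enorm_sub_le
  refine le_trans ?_ h2
  rw [← ofReal_norm, ← ofReal_norm]
  exact ENNReal.ofReal_le_ofReal h1

/-- The ergodic theorem for a stationary process whose characters decorrelate. -/
theorem ergodic_theorem [IsProbabilityMeasure P] [CompleteSpace E] [SecondCountableTopology E]
    (hφ : Measurable fun p : ℝ≥0 × Ω => φ p.1 p.2) (hst : ShiftInvariant P φ)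
    (hcont : ∀ v, MeanContinuous P φ (chi (E := E) v))
    (hav : ∀ v, AveragesConverge P φ (chi v)) {ρ : E → ℂ} (hρ : Measurable ρ)
    (hi : Integrable (fun ω => ρ (φ 0 ω)) P) : AveragesConverge P φ ρ := by
  have hφ0 := measurable_slice hφ 0
  have hprob : IsProbabilityMeasure (P.map (φ 0)) :=
    Measure.isProbabilityMeasure_map hφ0.aemeasurable
  have hiμ : Integrable ρ (P.map (φ 0)) :=
    (integrable_map_measure hρ.aestronglyMeasurable hφ0.aemeasurable).2 hi
  have happ : ∀ ε : ℝ≥0∞, ε ≠ 0 → ∃ f ∈ trigPoly E,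
      ∫⁻ ω, ‖ρ (φ 0 ω) - f (φ 0 ω)‖ₑ ∂P ≤ ε := fun ε hε => by
    obtain ⟨f, hf, h⟩ := exists_trigPoly_lintegral_sub_le hiμ hε
    have hm : Measurable fun x => ‖ρ x - f x‖ₑ := (hρ.sub (trigPoly_bounded hf).1.measurable).enorm
    rw [lintegral_map hm hφ0] at h
    exact ⟨f, hf, h⟩
  have hρc : MeanContinuous P φ ρ := MeanContinuous.of_approx hφ hst hρ fun ε hε => by
    obtain ⟨f, hf, h⟩ := happ ε hε
    exact ⟨f, (trigPoly_bounded hf).1.measurable, meanContinuous_of_mem_trigPoly hφ hcont hf, h⟩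
  -- Approximation errors 4^{-j} against thresholds 2^{-j} make the maximal inequality give
  -- probabilities at most 2·2^{-j}, which are summable.
  choose f hf hfε using fun j : ℕ => happ (ENNReal.ofReal ((1 / 4) ^ j))
    (ENNReal.ofReal_pos.2 (by positivity)).ne'
  have hfm : ∀ j, Measurable (f j) := fun j => (trigPoly_bounded (hf j)).1.measurable
  have hfi : ∀ j, Integrable (fun ω => f j (φ 0 ω)) P := fun j => by
    obtain ⟨hc, C, hC⟩ := trigPoly_bounded (hf j)
    exact Integrable.of_bound ((hfm j).comp hφ0).aestronglyMeasurable C (ae_of_all _ fun ω => hC _)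
  have hhi : ∀ j, Integrable (fun ω => ‖ρ (φ 0 ω) - f j (φ 0 ω)‖) P := fun j =>
    (hi.sub (hfi j)).norm
  have hhm : ∀ j, Measurable fun x => ‖ρ x - f j x‖ := fun j => (hρ.sub (hfm j)).norm
  have hh1 : ∀ j, ∫ ω, ‖ρ (φ 0 ω) - f j (φ 0 ω)‖ ∂P ≤ (1 / 4) ^ j := fun j => by
    have h1 : AEStronglyMeasurable (fun ω => ρ (φ 0 ω) - f j (φ 0 ω)) P := (hi.sub (hfi j)).1
    rw [integral_norm_eq_lintegral_enorm h1]
    exact ENNReal.toReal_le_of_le_ofReal (by positivity) (hfε j)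
  have hBC : ∀ᵐ ω ∂P, ∀ᶠ j in atTop, ω ∉ {ω | ∃ n : ℕ, 0 < n ∧
      n * ((1 / 2 : ℝ) ^ j) < ∫ t in (0 : ℝ)..n, ‖ρ (φ t.toNNReal ω) - f j (φ t.toNNReal ω)‖} := by
    refine ae_eventually_notMem ?_
    refine ne_top_of_le_ne_top (b := ∑' j : ℕ, ENNReal.ofReal (2 * (1 / 2) ^ j)) ?_
      (ENNReal.tsum_le_tsum fun j => ?_)
    · rw [← ENNReal.ofReal_tsum_of_nonneg (fun j => by positivity)
        (summable_geometric_two.mul_left 2)]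
      exact ENNReal.ofReal_ne_top
    · refine (hst.measure_exists_le hφ (hhm j) (fun x => norm_nonneg _) (hhi j)
        (MeanContinuous.norm_sub hφ hρ hρc (meanContinuous_of_mem_trigPoly hφ hcont (hf j)))
        (show (0 : ℝ) < (1 / 2) ^ j by positivity)).trans (ENNReal.ofReal_le_ofReal ?_)
      rw [div_le_iff₀ (by positivity)]
      have e : (1 / 4 : ℝ) ^ j = (1 / 2) ^ j * (1 / 2) ^ j := by rw [← mul_pow]; norm_num
      nlinarith [hh1 j]
  filter_upwards [hBC, ae_all_iff.2 fun j => averagesConverge_of_mem_trigPoly hφ hav (hf j),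
    hst.ae_intervalIntegrable hφ hρ hi,
    ae_all_iff.2 fun j => hst.ae_intervalIntegrable hφ (hfm j) (hfi j)] with ω h1 h2 h3 h4
  rw [Metric.tendsto_atTop']
  intro ε hε
  have hsmall : Tendsto (fun j : ℕ => 2 * (1 / 2 : ℝ) ^ j + (1 / 4) ^ j) atTop (𝓝 0) := by
    have a := (tendsto_pow_atTop_nhds_zero_of_lt_one (r := (1 / 2 : ℝ)) (by norm_num)
      (by norm_num)).const_mul 2
    have b := tendsto_pow_atTop_nhds_zero_of_lt_one (r := (1 / 4 : ℝ)) (by norm_num) (by norm_num)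
    simpa using a.add b
  obtain ⟨j, hj1, hj2⟩ := (h1.and (hsmall.eventually (gt_mem_nhds (half_pos hε)))).exists
  obtain ⟨T₀, hT₀⟩ := (Metric.tendsto_atTop'.1 (h2 j)) (ε / 2) (half_pos hε)
  refine ⟨max T₀ 1, fun T hT => ?_⟩
  have hT1 : 1 < T := (le_max_right _ _).trans_lt hT
  have hT0 : 0 < T := by linarith
  have hfT := hT₀ T ((le_max_left _ _).trans_lt hT)
  set D : ℝ := ∫ t in (0 : ℝ)..T, ‖ρ (φ t.toNNReal ω) - f j (φ t.toNNReal ω)‖ with hD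
  -- The maximal inequality covers integer horizons only. For real T > 1 one passes to ⌈T⌉ ≤ 2T,
  -- using that the integrand is nonnegative.
  have hDle : D ≤ 2 * T * (1 / 2) ^ j := by
    have hn0 : 0 < ⌈T⌉₊ := Nat.ceil_pos.2 hT0
    have hcl : (⌈T⌉₊ : ℝ) ≤ 2 * T := by
      have := (Nat.ceil_lt_add_one hT0.le).le
      linarith
    have hnot : ∫ t in (0 : ℝ)..⌈T⌉₊, ‖ρ (φ t.toNNReal ω) - f j (φ t.toNNReal ω)‖ ≤
        ⌈T⌉₊ * (1 / 2 : ℝ) ^ j := not_lt.1 fun hlt => hj1 ⟨⌈T⌉₊, hn0, hlt⟩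
    refine (intervalIntegral.integral_mono_interval le_rfl hT0.le (Nat.le_ceil T)
      (ae_of_all _ fun t => norm_nonneg _) ((h3 _ _).sub (h4 j _ _)).norm).trans ?_
    refine hnot.trans ?_
    gcongr
  have e1 : ‖(T⁻¹ : ℂ) * (∫ t in (0 : ℝ)..T, ρ (φ t.toNNReal ω)) -
      (T⁻¹ : ℂ) * ∫ t in (0 : ℝ)..T, f j (φ t.toNNReal ω)‖ ≤ 2 * (1 / 2) ^ j := by
    rw [← mul_sub, ← intervalIntegral.integral_sub (h3 _ _) (h4 j _ _), norm_mul, norm_inv,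
      Complex.norm_real, Real.norm_of_nonneg hT0.le, inv_mul_le_iff₀ hT0]
    refine (intervalIntegral.norm_integral_le_integral_norm hT0.le).trans (hDle.trans (le_of_eq ?_))
    ring
  have e2 : ‖(∫ ω', f j (φ 0 ω') ∂P) - ∫ ω', ρ (φ 0 ω') ∂P‖ ≤ (1 / 4) ^ j := by
    rw [← integral_sub (hfi j) hi]
    refine (norm_integral_le_integral_norm _).trans ?_
    simp_rw [norm_sub_rev (f j (φ 0 _))]
    exact hh1 j
  rw [dist_eq_norm] at hfT ⊢
  refine (norm_sub_le_norm_sub_add_norm_sub _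
    ((T⁻¹ : ℂ) * ∫ t in (0 : ℝ)..T, f j (φ t.toNNReal ω)) _).trans_lt ?_
  have e3 := norm_sub_le_norm_sub_add_norm_sub
    ((T⁻¹ : ℂ) * ∫ t in (0 : ℝ)..T, f j (φ t.toNNReal ω)) (∫ ω', f j (φ 0 ω') ∂P)
    (∫ ω', ρ (φ 0 ω') ∂P)
  linarith

end

end FracField

namespace FracField

/-! ### Moments and Gaussian laws of complex fractional Brownian motion. -/

section

variable {Ω : Type*} [MeasurableSpace Ω] {P : Measure Ω} {H : ℝ}

local notation "⟪" x ", " y "⟫" => inner ℂ x y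

theorem sqrt_two_inv_mul (x : ℝ) : (√2)⁻¹ * (√2 * x) = x := by
  rw [inv_mul_cancel_left₀ (by positivity)]

/-- A real process which is a fractional Brownian motion up to the factor `√2`. -/
theorem IsFBM.facts {X : ℝ → Ω → ℝ} (h : IsFBM H (fun t ω => √2 * X t ω) P) :
    (∀ t, Measurable (X t)) ∧ IsGaussianProcess X P ∧ (∀ t, ∫ ω, X t ω ∂P = 0) ∧
      ∀ s t, ∫ ω, X s ω * X t ω ∂P = fbmCov H s t / 2 := by
  refine ⟨fun t => ?_, ?_, fun t => ?_, fun s t => ?_⟩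
  · simpa only [sqrt_two_inv_mul] using (h.measurable t).const_mul (√2)⁻¹
  · simpa only [smul_eq_mul, sqrt_two_inv_mul] using h.gaussian.smul fun _ => (√2)⁻¹
  · have := h.mean t
    rw [integral_const_mul] at this
    exact (mul_eq_zero.1 this).resolve_left (by positivity)
  · have e : ∀ ω, √2 * X t ω * (√2 * X s ω) = 2 * (X s ω * X t ω) := fun ω => by
      rw [mul_mul_mul_comm, Real.mul_self_sqrt (by norm_num), mul_comm (X t ω)]
    have := h.cov s t
    simp_rw [e] at this
    rw [integral_const_mul] at this
    rw [fbmCov]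
    linarith

section ComplexFBM

variable {b : ℝ → Ω → ℂ} (hb : IsComplexFBM H b P)
include hb

theorem IsComplexFBM.measurable (t : ℝ) : Measurable (b t) := by
  have h1 := hb.re.facts.1 t
  have h2 := hb.im.facts.1 t
  have : b t = fun ω => ((b t ω).re : ℂ) + ((b t ω).im : ℂ) * Complex.I :=
    funext fun ω => (Complex.re_add_im _).symm
  rw [this]
  exact (Complex.measurable_ofReal.comp h1).add ((Complex.measurable_ofReal.comp h2).mul_const _)

theorem IsComplexFBM.memLp (t : ℝ) : MemLp (b t) 2 P := by
  have h1 := (hb.re.facts.2.1.hasGaussianLaw_eval t).memLp_two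
  have h2 := (hb.im.facts.2.1.hasGaussianLaw_eval t).memLp_two
  have : b t = fun ω => ((b t ω).re : ℂ) + ((b t ω).im : ℂ) * Complex.I :=
    funext fun ω => (Complex.re_add_im _).symm
  rw [this]
  have h3 : MemLp (fun ω => ((b t ω).re : ℂ)) 2 P := h1.ofReal
  have h4 : MemLp (fun ω => ((b t ω).im : ℂ)) 2 P := h2.ofReal
  exact h3.add (h4.mul_const Complex.I)

theorem IsComplexFBM.indepFun (s t : ℝ) :
    IndepFun (fun ω => (b s ω).re) (fun ω => (b t ω).im) P :=
  hb.indep.comp (measurable_pi_apply s) (measurable_pi_apply t)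

theorem IsComplexFBM.integral_re_mul_im (s t : ℝ) : ∫ ω, (b s ω).re * (b t ω).im ∂P = 0 := by
  rw [(hb.indepFun s t).integral_fun_mul_eq_mul_integral (hb.re.facts.1 s).aestronglyMeasurable
    (hb.im.facts.1 t).aestronglyMeasurable, hb.re.facts.2.2.1 s, zero_mul]

theorem IsComplexFBM.integral_im_mul_re (s t : ℝ) : ∫ ω, (b s ω).im * (b t ω).re ∂P = 0 := by
  simp_rw [mul_comm (b s _).im]
  exact hb.integral_re_mul_im t s

theorem IsComplexFBM.integral_eq_zero [IsProbabilityMeasure P] (t : ℝ) : ∫ ω, b t ω ∂P = 0 := by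
  have hi : Integrable (b t) P := (hb.memLp t).integrable one_le_two
  apply Complex.ext
  · have := integral_re hi
    simp only [Complex.zero_re]
    rw [← hb.re.facts.2.2.1 t]; exact this.symm
  · have := integral_im hi
    simp only [Complex.zero_im]
    rw [← hb.im.facts.2.2.1 t]; exact this.symm

/-- One computation serves two purposes: c = 1 gives the covariance E[conj b(s) b(t)], and c = -1
gives the pseudo-covariance E[b(s) b(t)], which vanishes because real and imaginary parts have equal
covariances and are uncorrelated. -/
theorem IsComplexFBM.integral_mul (c : ℝ) (s t : ℝ) :
    ∫ ω, (((b s ω).re : ℂ) - c * (b s ω).im * Complex.I) * b t ω ∂P =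
      ((fbmCov H s t * (1 + c) / 2 : ℝ) : ℂ) := by
  have hr := fun t => (hb.re.facts.2.1.hasGaussianLaw_eval t).memLp_two
  have hi := fun t => (hb.im.facts.2.1.hasGaussianLaw_eval t).memLp_two
  have e : ∀ ω, (((b s ω).re : ℂ) - c * (b s ω).im * Complex.I) * b t ω =
      (((b s ω).re * (b t ω).re + c * ((b s ω).im * (b t ω).im) : ℝ) : ℂ) +
      (((b s ω).re * (b t ω).im - c * ((b s ω).im * (b t ω).re) : ℝ) : ℂ) * Complex.I := fun ω => by
    conv_lhs => rw [← Complex.re_add_im (b t ω)]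
    push_cast
    linear_combination (-(c : ℂ) * (b s ω).im * (b t ω).im) * Complex.I_sq
  have i1 : Integrable (fun ω => (b s ω).re * (b t ω).re) P := (hr s).integrable_mul (hr t)
  have i2 : Integrable (fun ω => (b s ω).im * (b t ω).im) P := (hi s).integrable_mul (hi t)
  have i3 : Integrable (fun ω => (b s ω).re * (b t ω).im) P := (hr s).integrable_mul (hi t)
  have i4 : Integrable (fun ω => (b s ω).im * (b t ω).re) P := (hi s).integrable_mul (hr t)
  have i5 := i1.add (i2.const_mul c)
  have i6 := i3.sub (i4.const_mul c)
  simp_rw [e]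
  rw [integral_add i5.ofReal (i6.ofReal.mul_const _), integral_mul_const, integral_complex_ofReal,
    integral_complex_ofReal, integral_add i1 (i2.const_mul c), integral_sub i3 (i4.const_mul c),
    integral_const_mul, integral_const_mul, hb.integral_re_mul_im, hb.integral_im_mul_re,
    hb.re.facts.2.2.2, hb.im.facts.2.2.2]
  push_cast
  ring

theorem IsComplexFBM.integral_conj_mul (s t : ℝ) :
    ∫ ω, conj (b s ω) * b t ω ∂P = (fbmCov H s t : ℂ) := by
  have h := hb.integral_mul 1 s t
  rw [show fbmCov H s t * (1 + 1) / 2 = fbmCov H s t by ring] at h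
  rw [← h]
  congr 1 with ω
  congr 1
  apply Complex.ext <;> simp

theorem IsComplexFBM.integral_mul_self (s t : ℝ) : ∫ ω, b s ω * b t ω ∂P = 0 := by
  have h := hb.integral_mul (-1) s t
  rw [show fbmCov H s t * (1 + -1) / 2 = 0 by ring, Complex.ofReal_zero] at h
  rw [← h]
  congr 1 with ω
  congr 1
  apply Complex.ext <;> simp

theorem IsComplexFBM.hasGaussianLaw_re_sum (J : Finset ℝ) (c : ℝ → ℂ) :
    HasGaussianLaw (fun ω => (∑ t ∈ J, c t * b t ω).re) P := by
  have h1 := (hb.re.facts.2.1.smul fun t => (c t).re).hasGaussianLaw_fun_sum (I := J)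
  have h2 := (hb.im.facts.2.1.smul fun t => -(c t).im).hasGaussianLaw_fun_sum (I := J)
  have hind : IndepFun (fun ω => ∑ t ∈ J, (c t).re • (b t ω).re)
      (fun ω => ∑ t ∈ J, (-(c t).im) • (b t ω).im) P := by
    refine hb.indep.comp (φ := fun x : ℝ → ℝ => ∑ t ∈ J, (c t).re • x t)
      (ψ := fun x : ℝ → ℝ => ∑ t ∈ J, (-(c t).im) • x t) ?_ ?_ <;> fun_prop
  refine (iIndepFun.hasGaussianLaw_fun_add h1 h2 hind).congr (ae_of_all _ fun ω => ?_)
  simp only [Complex.re_sum, Complex.mul_re, ← Finset.sum_add_distrib, smul_eq_mul]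
  exact Finset.sum_congr rfl fun t _ => by ring

end ComplexFBM

end

end FracField

namespace FracField

/-! ### The Gaussian space generated by the noise. -/

section

variable {Ω : Type*} [MeasurableSpace Ω] {P : Measure Ω} {H : ℝ}

local notation "⟪" x ", " y "⟫" => inner ℂ x y

theorem ModeIndex.neg_neg (k : ModeIndex) : -(-k) = k := Subtype.ext (_root_.neg_neg k.1)

theorem ModeIndex.neg_ne (k : ModeIndex) : -k ≠ k := fun h => k.2 <| by
  have h1 : -k.1 = k.1 := congrArg Subtype.val h
  funext i
  have := congrFun h1 i
  simp only [Pi.neg_apply, Pi.zero_apply] at this ⊢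
  omega

/-- The reflection of the index set. -/
def negEquiv : ModeIndex ≃ ModeIndex := ⟨Neg.neg, Neg.neg, ModeIndex.neg_neg, ModeIndex.neg_neg⟩

/-- A half of the index set: one of `k`, `-k`. -/
def IsUpper (k : ModeIndex) : Prop := 0 < k.1 0 ∨ (k.1 0 = 0 ∧ 0 < k.1 1)

theorem isUpper_neg (k : ModeIndex) : IsUpper (-k) ↔ ¬ IsUpper k := by
  have h : ¬ (k.1 0 = 0 ∧ k.1 1 = 0) := fun h => k.2 (by
    funext i; fin_cases i; exacts [h.1, h.2])
  have e : ∀ i, (-k).1 i = -(k.1 i) := fun i => rfl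
  simp only [IsUpper, e]
  omega

open Classical in
theorem sum_eq_sum_upper {M : Type*} [AddCommMonoid M] {F : Finset ModeIndex}
    (hF : ∀ k ∈ F, -k ∈ F) (f : ModeIndex → M) :
    ∑ k ∈ F, f k = ∑ k ∈ F.filter IsUpper, (f k + f (-k)) := by
  rw [← Finset.sum_filter_add_sum_filter_not F IsUpper, Finset.sum_add_distrib]
  congr 1
  refine Finset.sum_nbij' (fun k => -k) (fun k => -k) ?_ ?_ ?_ ?_ ?_
  · intro k hk
    rw [Finset.mem_filter] at hk ⊢
    exact ⟨hF k hk.1, (isUpper_neg k).2 hk.2⟩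
  · intro k hk
    rw [Finset.mem_filter] at hk ⊢
    exact ⟨hF k hk.1, fun h => (isUpper_neg k).1 h hk.2⟩
  · exact fun k _ => ModeIndex.neg_neg k
  · exact fun k _ => ModeIndex.neg_neg k
  · exact fun k _ => by rw [ModeIndex.neg_neg]

variable {β : ModeIndex → ℝ → Ω → ℂ} (hβ : IsFBMFamily H β P)

/-- The random variables of the noise, as vectors in `L²`. -/
noncomputable def IsFBMFamily.vec (k : ModeIndex) (t : ℝ) : Lp ℂ 2 P :=
  ((hβ.fbm k).memLp t).toLp (β k t)

theorem IsFBMFamily.coeFn_vec (k : ModeIndex) (t : ℝ) : hβ.vec k t =ᵐ[P] β k t :=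
  ((hβ.fbm k).memLp t).coeFn_toLp

theorem IsFBMFamily.inner_vec (k l : ModeIndex) (s t : ℝ) :
    ⟪hβ.vec k s, hβ.vec l t⟫ = ∫ ω, conj (β k s ω) * β l t ω ∂P := by
  rw [L2.inner_def]
  refine integral_congr_ae ?_
  filter_upwards [hβ.coeFn_vec k s, hβ.coeFn_vec l t] with ω h1 h2
  rw [h1, h2, RCLike.inner_apply, mul_comm]

theorem IsFBMFamily.isFBMCurve (k : ModeIndex) : IsFBMCurve H (hβ.vec k) := fun s t => by
  rw [hβ.inner_vec, (hβ.fbm k).integral_conj_mul]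

/-- For l ≠ ±k this is independence. For k = -l the variables are conjugate to each other, far from
independent, but their inner product is the vanishing pseudo-covariance. -/
theorem IsFBMFamily.inner_eq_zero [IsProbabilityMeasure P] {k l : ModeIndex} (hkl : k ≠ l)
    (s t : ℝ) : ⟪hβ.vec k s, hβ.vec l t⟫ = 0 := by
  rw [hβ.inner_vec]
  by_cases h : k = -l
  · subst h
    rw [← (hβ.fbm l).integral_mul_self s t]
    refine integral_congr_ae ?_
    filter_upwards [hβ.conj_symm l] with ω hω
    rw [hω s, Complex.conj_conj]
  · have hS : ∀ x ∈ ({k, l} : Set ModeIndex), -x ∉ ({k, l} : Set ModeIndex) := by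
      rintro x (rfl | rfl) (h1 | h1)
      · exact x.neg_ne h1
      · exact h (by rw [← h1, ModeIndex.neg_neg])
      · exact h h1.symm
      · exact x.neg_ne h1
    have hi := (hβ.indep {k, l} hS).indepFun
      (i := ⟨k, by simp⟩) (j := ⟨l, by simp⟩) (fun h => hkl (congrArg Subtype.val h))
    have hi2 : IndepFun (fun ω => conj (β k s ω)) (fun ω => β l t ω) P :=
      hi.comp (φ := fun x : ℝ → ℂ => conj (x s)) (ψ := fun x : ℝ → ℂ => x t)
        (Complex.continuous_conj.measurable.comp (measurable_pi_apply s)) (measurable_pi_apply t)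
    rw [hi2.integral_fun_mul_eq_mul_integral
      (Complex.continuous_conj.measurable.comp ((hβ.fbm k).measurable s)).aestronglyMeasurable
      ((hβ.fbm l).measurable t).aestronglyMeasurable, (hβ.fbm l).integral_eq_zero, mul_zero]

include hβ in
theorem IsFBMFamily.hasGaussianLaw_re_sum [IsProbabilityMeasure P] (F : Finset ModeIndex)
    (J : Finset ℝ) (c : ModeIndex → ℝ → ℂ) :
    HasGaussianLaw (fun ω => (∑ k ∈ F, ∑ t ∈ J, c k t * β k t ω).re) P := by
  classical
  -- Only a half set of modes is independent, so the index set is symmetrized in order to fold k and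
  -- -k together.
  set F' : Finset ModeIndex := F ∪ F.image Neg.neg with hF'
  have hsymm : ∀ k ∈ F', -k ∈ F' := fun k hk => by
    rw [hF', Finset.mem_union, Finset.mem_image] at hk ⊢
    rcases hk with hk | ⟨l, hl, rfl⟩
    · exact Or.inr ⟨k, hk, rfl⟩
    · exact Or.inl (by rwa [ModeIndex.neg_neg])
  set c' : ModeIndex → ℝ → ℂ := fun k t => if k ∈ F then c k t else 0 with hc'
  have hsum : ∀ ω, ∑ k ∈ F, ∑ t ∈ J, c k t * β k t ω = ∑ k ∈ F', ∑ t ∈ J, c' k t * β k t ω :=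
    fun ω => by
      rw [← Finset.sum_subset (Finset.subset_union_left (s₂ := F.image Neg.neg))]
      · exact Finset.sum_congr rfl fun k hk => by simp [hc', hk]
      · intro k _ hk
        simp [hc', hk]
  set S : Finset ModeIndex := F'.filter IsUpper with hS
  -- Since Re(c · conj z) = Re(conj c · z), the term of -k contributes the conjugate coefficient to
  -- mode k.
  set d : ModeIndex → ℝ → ℂ := fun k t => c' k t + conj (c' (-k) t) with hd
  have hupper : ∀ k ∈ (S : Set ModeIndex), -k ∉ (S : Set ModeIndex) := fun k hk h => by
    rw [Finset.mem_coe, hS, Finset.mem_filter] at hk h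
    exact (isUpper_neg k).1 h.2 hk.2
  have hind := (hβ.indep S hupper).comp
    (fun k (x : ℝ → ℂ) => (∑ t ∈ J, d k t * x t).re) (fun k => by fun_prop)
  have hg := hind.hasGaussianLaw_fun_sum
    fun k : S => (hβ.fbm k).hasGaussianLaw_re_sum J (d k)
  refine hg.congr ?_
  filter_upwards [ae_all_iff.2 hβ.conj_symm] with ω hω
  rw [hsum, sum_eq_sum_upper hsymm, Complex.re_sum, ← Finset.sum_coe_sort S]
  refine Finset.sum_congr rfl fun k _ => ?_
  simp only [← Finset.sum_add_distrib, Complex.re_sum]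
  refine Finset.sum_congr rfl fun t _ => ?_
  rw [hω]
  simp only [hd, Complex.add_re, Complex.mul_re, Complex.add_im, Complex.conj_re, Complex.conj_im]
  ring

/-- The closed linear span of the noise in `L²`. -/
noncomputable def IsFBMFamily.gaussSpan : Submodule ℂ (Lp ℂ 2 P) :=
  (Submodule.span ℂ (range fun p : ModeIndex × ℝ => hβ.vec p.1 p.2)).topologicalClosure

/-- The real part of a random variable. -/
noncomputable def reL (P : Measure Ω) : Lp ℂ 2 P →L[ℝ] Lp ℝ 2 P := Complex.reCLM.compLpL 2 P

theorem coeFn_reL (U : Lp ℂ 2 P) : reL P U =ᵐ[P] fun ω => (U ω).re :=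
  Complex.reCLM.coeFn_compLpL U

theorem norm_reL_sq (U : Lp ℂ 2 P) : ‖reL P U‖ ^ 2 = ∫ ω, (U ω).re ^ 2 ∂P := by
  rw [← real_inner_self_eq_norm_sq, L2.inner_def]
  refine integral_congr_ae ?_
  filter_upwards [coeFn_reL U] with ω h
  rw [h, real_inner_self_eq_norm_sq, Real.norm_eq_abs, sq_abs]

/-- The map is 1-Lipschitz for the L² norm; this lets the Gaussian formula pass from finite
combinations to the closed span. -/
theorem continuous_integral_exp_re [IsProbabilityMeasure P] :
    Continuous fun U : Lp ℂ 2 P => ∫ ω, Complex.exp ((U ω).re * Complex.I) ∂P := by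
  have hb : ∀ U : Lp ℂ 2 P, Integrable (fun ω => Complex.exp ((U ω).re * Complex.I)) P := fun U => by
    refine Integrable.of_bound ?_ 1 (ae_of_all _ fun ω => (Complex.norm_exp_ofReal_mul_I _).le)
    have := Lp.aestronglyMeasurable U
    fun_prop
  refine LipschitzWith.continuous (K := 1) (LipschitzWith.of_dist_le_mul fun U W => ?_)
  rw [NNReal.coe_one, one_mul, dist_eq_norm, dist_eq_norm, ← integral_sub (hb U) (hb W)]
  refine (norm_integral_le_integral_norm _).trans ?_
  have h1 : ∀ᵐ ω ∂P, ‖Complex.exp ((U ω).re * Complex.I) - Complex.exp ((W ω).re * Complex.I)‖ ≤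
      ‖(U - W) ω‖ := by
    filter_upwards [Lp.coeFn_sub U W] with ω h
    rw [h, Pi.sub_apply]
    refine le_trans ?_ (Complex.abs_re_le_norm _)
    rw [Complex.sub_re]
    have e : Complex.exp ((U ω).re * Complex.I) - Complex.exp ((W ω).re * Complex.I) =
        Complex.exp ((W ω).re * Complex.I) *
          (Complex.exp (Complex.I * ((U ω).re - (W ω).re : ℝ)) - 1) := by
      rw [mul_sub, ← Complex.exp_add, mul_one]
      congr 2
      push_cast
      ring
    rw [e, norm_mul, Complex.norm_exp_ofReal_mul_I, one_mul]
    exact Real.norm_exp_I_mul_ofReal_sub_one_le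
  have hi : Integrable (fun ω => ‖(U - W) ω‖) P := ((Lp.memLp (U - W)).integrable one_le_two).norm
  refine (integral_mono_ae ((hb U).sub (hb W)).norm hi h1).trans ?_
  rw [Lp.norm_def, integral_norm_eq_lintegral_enorm (Lp.aestronglyMeasurable _),
    ← eLpNorm_one_eq_lintegral_enorm]
  exact ENNReal.toReal_mono (Lp.eLpNorm_ne_top _)
    (eLpNorm_le_eLpNorm_of_exponent_le one_le_two (Lp.aestronglyMeasurable _))

/-- The characteristic function of a Gaussian variable. -/
theorem IsFBMFamily.integral_exp_re [IsProbabilityMeasure P] {U : Lp ℂ 2 P}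
    (hU : U ∈ hβ.gaussSpan) :
    ∫ ω, Complex.exp ((U ω).re * Complex.I) ∂P = Real.exp (-(‖reL P U‖ ^ 2 / 2)) := by
  have hclosed : IsClosed {U : Lp ℂ 2 P | ∫ ω, Complex.exp ((U ω).re * Complex.I) ∂P =
      Real.exp (-(‖reL P U‖ ^ 2 / 2))} :=
    isClosed_eq continuous_integral_exp_re
      (Complex.continuous_ofReal.comp (by fun_prop))
  have hsub : (Submodule.span ℂ (range fun p : ModeIndex × ℝ => hβ.vec p.1 p.2) : Set (Lp ℂ 2 P)) ⊆
      {U : Lp ℂ 2 P | ∫ ω, Complex.exp ((U ω).re * Complex.I) ∂P =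
        Real.exp (-(‖reL P U‖ ^ 2 / 2))} := by
    intro U hU
    classical
    obtain ⟨c, rfl⟩ := Finsupp.mem_span_range_iff_exists_finsupp.1 hU
    set U := c.sum fun i a => a • hβ.vec i.1 i.2 with hUdef
    have hUae : U =ᵐ[P] fun ω => ∑ k ∈ c.support.image Prod.fst, ∑ t ∈ c.support.image Prod.snd,
        c (k, t) * β k t ω := by
      have h1 : U = ∑ p ∈ (c.support.image Prod.fst) ×ˢ (c.support.image Prod.snd),
          c p • hβ.vec p.1 p.2 := by
        refine Finset.sum_subset (fun p hp => ?_) fun p _ hp => ?_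
        · exact Finset.mem_product.2 ⟨Finset.mem_image_of_mem _ hp, Finset.mem_image_of_mem _ hp⟩
        · simp only [Finsupp.notMem_support_iff.1 hp, zero_smul]
      have h2 : ∀ p, (c p • hβ.vec p.1 p.2 : Lp ℂ 2 P) =ᵐ[P] fun ω => c p * β p.1 p.2 ω := fun p => by
        filter_upwards [Lp.coeFn_smul (c p) (hβ.vec p.1 p.2), hβ.coeFn_vec p.1 p.2] with ω h3 h4
        rw [h3, Pi.smul_apply, h4, smul_eq_mul]
      rw [h1]
      filter_upwards [Lp.coeFn_finsetSum ((c.support.image Prod.fst) ×ˢ (c.support.image Prod.snd))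
        (fun p => c p • hβ.vec p.1 p.2), (Finset.eventually_all _).2 fun p _ => h2 p] with ω h3 h4
      rw [h3, Finset.sum_apply, ← Finset.sum_product']
      exact Finset.sum_congr rfl fun p hp => h4 p hp
    have hg : HasGaussianLaw (fun ω => (U ω).re) P :=
      (hβ.hasGaussianLaw_re_sum _ _ fun k t => c (k, t)).congr
        (hUae.mono fun ω h => by simp only; rw [h])
    have hmean : ∫ ω, (U ω).re ∂P = 0 := by
      have hi : Integrable U P := (Lp.memLp U).integrable one_le_two
      have h0 : ∫ ω, U ω ∂P = 0 := by
        rw [integral_congr_ae hUae, integral_finsetSum _ fun k _ => integrable_finsetSum _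
          fun t _ => (((hβ.fbm k).memLp t).integrable one_le_two).const_mul _]
        refine Finset.sum_eq_zero fun k _ => ?_
        rw [integral_finsetSum _ fun t _ =>
          (((hβ.fbm k).memLp t).integrable one_le_two).const_mul _]
        refine Finset.sum_eq_zero fun t _ => ?_
        rw [integral_const_mul, (hβ.fbm k).integral_eq_zero, mul_zero]
      have := integral_re hi
      rw [h0] at this
      exact this
    have hvar : Var[fun ω => (U ω).re; P] = ‖reL P U‖ ^ 2 := by
      rw [variance_of_integral_eq_zero hg.aemeasurable hmean, norm_reL_sq]
    have hm : AEMeasurable (fun ω => (U ω).re) P := hg.aemeasurable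
    have h1 : ∫ ω, Complex.exp ((U ω).re * Complex.I) ∂P =
        charFun (P.map fun ω => (U ω).re) 1 := by
      rw [charFun_apply_real, integral_map hm (by fun_prop)]
      simp
    rw [mem_ofPred_eq, h1, hg.map_eq_gaussianReal, charFun_gaussianReal, hvar, hmean,
      Real.coe_toNNReal _ (by positivity)]
    push_cast
    congr 1
    ring
  exact closure_minimal hsub hclosed hU

end

end FracField

namespace FracField

/-! ### Gaussian moments. -/

section

variable {Ω : Type*} [MeasurableSpace Ω] {P : Measure Ω} {H : ℝ}
  {β : ModeIndex → ℝ → Ω → ℂ} (hβ : IsFBMFamily H β P)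

theorem norm_reL_le (U : Lp ℂ 2 P) : ‖reL P U‖ ≤ ‖U‖ := by
  refine Lp.norm_le_norm_of_ae_le ?_
  filter_upwards [coeFn_reL U] with ω h
  rw [h]
  exact Complex.abs_re_le_norm _

theorem IsFBMFamily.map_re [IsProbabilityMeasure P] {U : Lp ℂ 2 P} (hU : U ∈ hβ.gaussSpan) :
    P.map (fun ω => (U ω).re) = (gaussianReal 0 1).map (‖reL P U‖ * ·) := by
  have hm : AEMeasurable (fun ω => (U ω).re) P :=
    Complex.measurable_re.comp_aemeasurable (Lp.aestronglyMeasurable U).aemeasurable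
  have := Measure.isProbabilityMeasure_map hm
  rw [gaussianReal_map_const_mul]
  refine Measure.ext_of_charFun (funext fun r => ?_)
  have hr := hβ.integral_exp_re (Submodule.smul_mem _ (r : ℂ) hU)
  have h1 : ∫ ω, Complex.exp (((((r : ℂ) • U : Lp ℂ 2 P) ω).re : ℂ) * Complex.I) ∂P =
      ∫ ω, Complex.exp ((r : ℂ) * (U ω).re * Complex.I) ∂P := by
    refine integral_congr_ae ?_
    filter_upwards [Lp.coeFn_smul (r : ℂ) U] with ω h
    rw [h, Pi.smul_apply, smul_eq_mul, Complex.re_ofReal_mul, Complex.ofReal_mul]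
  have h2 : reL P ((r : ℂ) • U) = r • reL P U := by
    rw [← map_smul]
    congr 1
  rw [charFun_apply_real, integral_map hm (by fun_prop), ← h1, hr, h2, charFun_gaussianReal,
    norm_smul, Real.norm_eq_abs, mul_pow, sq_abs]
  push_cast
  congr 1
  ring

/-- The real part of U is distributed as its L² norm times a standard normal variable, so M is the
p-th absolute moment of the latter and does not depend on U. -/
theorem IsFBMFamily.lintegral_re_pow_le [IsProbabilityMeasure P] (p : ℕ) :
    ∃ M : ℝ≥0, ∀ U ∈ hβ.gaussSpan,
      ∫⁻ ω, ‖(U ω).re‖ₑ ^ p ∂P ≤ M * ENNReal.ofReal (‖reL P U‖ ^ p) := by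
  have hfin : ∫⁻ x : ℝ, ‖x‖ₑ ^ p ∂gaussianReal 0 1 ≠ ∞ := by
    have := (memLp_id_gaussianReal (μ := 0) (v := 1) p).integrable_norm_pow'
    have h2 := this.2
    rw [HasFiniteIntegral] at h2
    refine (lt_of_le_of_lt (lintegral_mono fun x => ?_) h2).ne
    simp
  lift ∫⁻ x : ℝ, ‖x‖ₑ ^ p ∂gaussianReal 0 1 to ℝ≥0 using hfin with M hM
  refine ⟨M, fun U hU => ?_⟩
  have hm : AEMeasurable (fun ω => (U ω).re) P :=
    Complex.measurable_re.comp_aemeasurable (Lp.aestronglyMeasurable U).aemeasurable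
  have hf : Measurable fun x : ℝ => ‖x‖ₑ ^ p := by fun_prop
  rw [← lintegral_map' hf.aemeasurable hm, hβ.map_re hU, lintegral_map hf (by fun_prop), hM]
  rw [← lintegral_mul_const' _ _ ENNReal.ofReal_ne_top]
  refine lintegral_mono fun x => le_of_eq ?_
  rw [enorm_mul, mul_pow, mul_comm, ENNReal.ofReal_pow (norm_nonneg _), ofReal_norm, enorm_norm]

/-- For Gaussian fields a Hölder bound in mean square upgrades to all moments, which allows chaining
with every exponent below θ. -/
theorem IsFBMFamily.hasMomentBound [IsProbabilityMeasure P] {T : Type*} [PseudoMetricSpace T]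
    {Y : T → Ω → ℝ} {W : T → Lp ℂ 2 P} (hW : ∀ x, W x ∈ hβ.gaussSpan)
    (hY : ∀ x, Y x =ᵐ[P] fun ω => (W x ω).re) {C θ : ℝ} (hC : 0 ≤ C)
    (h : ∀ x y, ‖W x - W y‖ ≤ C * dist x y ^ θ) : HasMomentBound P Y θ := by
  intro p
  obtain ⟨M, hM⟩ := hβ.lintegral_re_pow_le p
  refine ⟨M * (C ^ p).toNNReal, fun x y => ?_⟩
  have h1 : ∫⁻ ω, ‖Y x ω - Y y ω‖ₑ ^ p ∂P = ∫⁻ ω, ‖((W x - W y : Lp ℂ 2 P) ω).re‖ₑ ^ p ∂P := by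
    refine lintegral_congr_ae ?_
    filter_upwards [hY x, hY y, Lp.coeFn_sub (W x) (W y)] with ω h1 h2 h3
    rw [h1, h2, h3, Pi.sub_apply, Complex.sub_re]
  rw [h1]
  refine (hM _ (Submodule.sub_mem _ (hW x) (hW y))).trans ?_
  rw [ENNReal.coe_mul, mul_assoc]
  gcongr
  rw [← ENNReal.ofReal, ← ENNReal.ofReal_mul (by positivity)]
  refine ENNReal.ofReal_le_ofReal ?_
  refine (pow_le_pow_left₀ (norm_nonneg _) ((norm_reL_le _).trans (h x y)) p).trans (le_of_eq ?_)
  rw [mul_pow, Real.rpow_mul dist_nonneg, Real.rpow_natCast]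

end

/-! ### Time inversion. -/

section

variable {E : Type*} [NormedAddCommGroup E] [InnerProductSpace ℂ E] {H : ℝ} {b : ℝ → E}

/-- Time inversion: `s² b(±1/s)` is Hölder continuous on the unit interval. -/
theorem IsFBMCurve.norm_inversion_sub_le (hH : H ∈ Ioo (0 : ℝ) 1) (hb : IsFBMCurve H b) {σ : ℝ}
    (hσ : |σ| = 1) {s s' : ℝ} (h0 : 0 ≤ s') (hs : s' ≤ s) (h1 : s ≤ 1) :
    ‖((s ^ 2 : ℝ) : ℂ) • b (σ * s⁻¹) - ((s' ^ 2 : ℝ) : ℂ) • b (σ * s'⁻¹)‖ ≤ 3 * (s - s') ^ H := by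
  have hb0 : ∀ t, ‖b t‖ = |t| ^ H := fun t => by
    have := hb.norm_sub hH.1 0 t
    rwa [hb.zero hH.1, sub_zero, sub_zero] at this
  rcases h0.eq_or_lt with rfl | h0
  · have hz : ((0 ^ 2 : ℝ) : ℂ) • b (σ * 0⁻¹) = 0 := by simp
    rw [hz, sub_zero, sub_zero, norm_smul, hb0, abs_mul, hσ, one_mul, Complex.norm_real,
      Real.norm_of_nonneg (by positivity), abs_of_nonneg (by positivity)]
    rcases hs.eq_or_lt with rfl | hs
    · simp [Real.zero_rpow hH.1.ne']
    rw [Real.inv_rpow hs.le, ← Real.rpow_neg hs.le, ← Real.rpow_natCast s 2, ← Real.rpow_add hs]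
    have := Real.rpow_le_rpow_of_exponent_ge hs h1 (show H ≤ (2 : ℕ) + -H by
      push_cast; linarith [hH.2])
    have h2 : 0 ≤ s ^ H := by positivity
    linarith
  · have hs0 : 0 < s := h0.trans_le hs
    have hd : 0 ≤ s - s' := sub_nonneg.2 hs
    have hd1 : s - s' ≤ 1 := by linarith
    -- The increment of b is paired with the smaller weight s'² and the increment of the weight with
    -- the smaller vector, b at ±1/s; each part is then of order (s - s')^H.
    have e : ((s ^ 2 : ℝ) : ℂ) • b (σ * s⁻¹) - ((s' ^ 2 : ℝ) : ℂ) • b (σ * s'⁻¹) =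
        ((s' ^ 2 : ℝ) : ℂ) • (b (σ * s⁻¹) - b (σ * s'⁻¹)) +
          ((s ^ 2 - s' ^ 2 : ℝ) : ℂ) • b (σ * s⁻¹) := by
      push_cast
      module
    have hi : |σ * s⁻¹ - σ * s'⁻¹| = (s - s') * s'⁻¹ * s⁻¹ := by
      rw [← mul_sub, abs_mul, hσ, one_mul, abs_sub_comm, abs_of_nonneg]
      · field_simp
      · exact sub_nonneg.2 (inv_anti₀ h0 hs)
    have hsH : s⁻¹ ^ H ≤ s'⁻¹ ^ H := Real.rpow_le_rpow (by positivity) (inv_anti₀ h0 hs) hH.1.le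
    have k1 : s' ^ 2 * ((s - s') * s'⁻¹ * s⁻¹) ^ H ≤ (s - s') ^ H := by
      rw [Real.mul_rpow (by positivity) (by positivity), Real.mul_rpow hd (by positivity)]
      have : s' ^ 2 * (s'⁻¹ ^ H * s'⁻¹ ^ H) ≤ 1 := by
        rw [← Real.rpow_natCast s' 2, Real.inv_rpow h0.le, ← Real.rpow_neg h0.le,
          ← Real.rpow_add h0, ← Real.rpow_add h0]
        exact Real.rpow_le_one h0.le (hs.trans h1) (by push_cast; linarith [hH.2])
      have h3 : 0 ≤ (s - s') ^ H := by positivity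
      calc s' ^ 2 * ((s - s') ^ H * s'⁻¹ ^ H * s⁻¹ ^ H)
          ≤ s' ^ 2 * ((s - s') ^ H * s'⁻¹ ^ H * s'⁻¹ ^ H) := by gcongr
        _ = (s - s') ^ H * (s' ^ 2 * (s'⁻¹ ^ H * s'⁻¹ ^ H)) := by ring
        _ ≤ (s - s') ^ H := mul_le_of_le_one_right h3 this
    have k2 : (s ^ 2 - s' ^ 2) * s⁻¹ ^ H ≤ 2 * (s - s') ^ H := by
      have a1 : s * s⁻¹ ^ H ≤ 1 := by
        rw [Real.inv_rpow hs0.le, ← Real.rpow_neg hs0.le]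
        nth_rewrite 1 [← Real.rpow_one s]
        rw [← Real.rpow_add hs0]
        exact Real.rpow_le_one hs0.le h1 (by linarith [hH.2])
      have a2 : s - s' ≤ (s - s') ^ H := by
        have := Real.rpow_le_rpow_of_exponent_ge' hd hd1 hH.1.le hH.2.le
        rwa [Real.rpow_one] at this
      have a3 : 0 ≤ s⁻¹ ^ H := by positivity
      calc (s ^ 2 - s' ^ 2) * s⁻¹ ^ H = (s - s') * ((s + s') * s⁻¹ ^ H) := by ring
        _ ≤ (s - s') * ((s + s) * s⁻¹ ^ H) := by gcongr
        _ = (s - s') * (2 * (s * s⁻¹ ^ H)) := by ring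
        _ ≤ (s - s') * (2 * 1) := by gcongr
        _ ≤ 2 * (s - s') ^ H := by linarith
    rw [e]
    refine (norm_add_le _ _).trans ?_
    rw [norm_smul, norm_smul, hb.norm_sub hH.1, hb0, hi, abs_mul, hσ, one_mul, Complex.norm_real,
      Complex.norm_real, Real.norm_of_nonneg (by positivity),
      Real.norm_of_nonneg (by nlinarith), abs_of_nonneg (inv_nonneg.2 hs0.le)]
    linarith

end

/-! ### Growth of the noise paths. -/

section

variable {Ω : Type*} [MeasurableSpace Ω] {P : Measure Ω} [IsProbabilityMeasure P] {H : ℝ}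
  {β : ModeIndex → ℝ → Ω → ℂ} (hβ : IsFBMFamily H β P)

theorem abs_floor_mul_div_sub_le (n : ℕ) (x : ℝ) :
    |(⌊(2 : ℝ) ^ n * x⌋ : ℝ) / 2 ^ n - x| ≤ (1 / 2) ^ n := by
  have h2 : (0 : ℝ) < 2 ^ n := by positivity
  have e : (⌊(2 : ℝ) ^ n * x⌋ : ℝ) / 2 ^ n - x = -(Int.fract ((2 : ℝ) ^ n * x) / 2 ^ n) := by
    rw [← Int.self_sub_floor]
    field_simp
    ring
  rw [e, abs_neg, abs_of_nonneg (div_nonneg (Int.fract_nonneg _) h2.le), one_div_pow]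
  gcongr
  exact (Int.fract_lt_one _).le

/-- Almost surely, a Gaussian process with the covariance of fractional Brownian motion and
continuous paths grows at most quadratically. -/
theorem IsFBMFamily.ae_growth (hH : H ∈ Ioo (0 : ℝ) 1) {X : ℝ → Ω → ℝ} (hX : ∀ t, Measurable (X t))
    (hc : ∀ᵐ ω ∂P, Continuous fun t => X t ω) {b : ℝ → Lp ℂ 2 P} (hb : IsFBMCurve H b)
    (hbm : ∀ t, b t ∈ hβ.gaussSpan) (hXb : ∀ t, X t =ᵐ[P] fun ω => (b t ω).re) {σ : ℝ}
    (hσ : |σ| = 1) : ∀ᵐ ω ∂P, ∃ C : ℝ, ∀ u : ℝ, 1 ≤ u → |X (σ * u) ω| ≤ C * u ^ 2 := by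
  -- Clamping to [0,1] defines the inverted process on the whole line, so that dyadic rounding never
  -- leaves its domain.
  set q : ℝ → ℝ := fun s => (projIcc (0 : ℝ) 1 zero_le_one s : ℝ) with hq
  have hq01 : ∀ s, 0 ≤ q s ∧ q s ≤ 1 := fun s => (projIcc (0 : ℝ) 1 zero_le_one s).2
  have hqid : ∀ s ∈ Icc (0 : ℝ) 1, q s = s := fun s hs => by simp [hq, projIcc_of_mem _ hs]
  have hqd : ∀ s s', |q s - q s'| ≤ |s - s'| := fun s s' =>
    abs_projIcc_sub_projIcc zero_le_one
  set Y : ℝ → Ω → ℝ := fun s ω => q s ^ 2 * X (σ * (q s)⁻¹) ω with hY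
  set W : ℝ → Lp ℂ 2 P := fun s => ((q s ^ 2 : ℝ) : ℂ) • b (σ * (q s)⁻¹) with hW
  have hYm : ∀ s, Measurable (Y s) := fun s => (hX _).const_mul _
  have hYW : ∀ s, Y s =ᵐ[P] fun ω => (W s ω).re := fun s => by
    filter_upwards [hXb (σ * (q s)⁻¹), Lp.coeFn_smul (((q s ^ 2 : ℝ) : ℂ)) (b (σ * (q s)⁻¹))]
      with ω h1 h2
    simp only [hY, hW]
    rw [h2, h1, Pi.smul_apply, smul_eq_mul, Complex.re_ofReal_mul]
  have hWd : ∀ s s', ‖W s - W s'‖ ≤ 3 * dist s s' ^ H := by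
    have key : ∀ s s', q s' ≤ q s → ‖W s - W s'‖ ≤ 3 * dist s s' ^ H := fun s s' h => by
      refine (hb.norm_inversion_sub_le hH hσ (hq01 s').1 h (hq01 s).2).trans ?_
      exact mul_le_mul_of_nonneg_left (Real.rpow_le_rpow (sub_nonneg.2 h)
        ((le_abs_self _).trans (hqd s s')) hH.1.le) (by norm_num)
    intro s s'
    rcases le_total (q s') (q s) with h | h
    · exact key s s' h
    · rw [norm_sub_rev, dist_comm]; exact key s' s h
  have hmom := hβ.hasMomentBound (fun s => Submodule.smul_mem _ _ (hbm _)) hYW (by norm_num) hWd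
  have hhol := ae_holder_of_momentBound hYm hH.1 hmom
    (π := fun n x => (⌊(2 : ℝ) ^ n * x⌋ : ℝ) / 2 ^ n)
    (fun n x => by rw [Real.dist_eq]; exact abs_floor_mul_div_sub_le n x) (B := Icc 0 1)
    (d := 1) (C := 2) (fun n => by
      classical
      refine ⟨(Finset.range (2 ^ n + 1)).image fun j : ℕ => (j : ℝ) / 2 ^ n, fun x hx => ?_,
        Finset.card_image_le.trans ?_⟩
      · have h0 : 0 ≤ ⌊(2 : ℝ) ^ n * x⌋ := Int.floor_nonneg.2 (mul_nonneg (by positivity) hx.1)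
        refine Finset.mem_image.2 ⟨⌊(2 : ℝ) ^ n * x⌋.toNat, ?_, ?_⟩
        · rw [Finset.mem_range, Int.toNat_lt h0]
          have : ⌊(2 : ℝ) ^ n * x⌋ ≤ ⌊(2 : ℝ) ^ n⌋ :=
            Int.floor_le_floor (mul_le_of_le_one_right (by positivity) hx.2)
          have e : ⌊(2 : ℝ) ^ n⌋ = 2 ^ n := by exact_mod_cast Int.floor_intCast (R := ℝ) (2 ^ n)
          push_cast
          omega
        · congr 1
          exact_mod_cast congrArg (Int.cast : ℤ → ℝ) (Int.toNat_of_nonneg h0)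
      · rw [Finset.card_range, one_mul]
        have : 1 ≤ 2 ^ n := Nat.one_le_two_pow
        omega)
  filter_upwards [hhol, hc] with ω h1 h2
  have hH2 : 0 < H / 2 := half_pos hH.1
  obtain ⟨C, hC⟩ := h1.2 (H / 2).toNNReal (Real.toNNReal_pos.2 hH2)
    (by rw [Real.coe_toNNReal _ hH2.le]; exact half_lt_self hH.1)
  set L : ℝ → ℝ := fun x => limsup (fun n : ℕ => Y ((⌊(2 : ℝ) ^ n * x⌋ : ℝ) / 2 ^ n) ω) atTop with hL
  -- Away from 0 the inverted path is itself continuous, so the chaining limit is the path and not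
  -- merely a version of it. A Hölder function on [0,1] is bounded, and boundedness of s²X(σ/s) is
  -- the claim with u = 1/s.
  have hlim : ∀ s ∈ Ioc (0 : ℝ) 1, L s = Y s ω := fun s hs => by
    refine Tendsto.limsup_eq ?_
    have hcont : ContinuousAt (fun x => Y x ω) s := by
      have hqc : Continuous q := continuous_subtype_val.comp continuous_projIcc
      have hqs : q s ≠ 0 := by rw [hqid s ⟨hs.1.le, hs.2⟩]; exact hs.1.ne'
      have a1 : ContinuousAt (fun x => σ * (q x)⁻¹) s :=
        continuousAt_const.mul (hqc.continuousAt.inv₀ hqs)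
      exact (hqc.continuousAt.pow 2).mul (h2.continuousAt.comp a1)
    refine hcont.tendsto.comp ?_
    refine tendsto_iff_dist_tendsto_zero.2 (squeeze_zero (fun _ => dist_nonneg) (fun n => ?_)
      (tendsto_pow_atTop_nhds_zero_of_lt_one (r := (1 / 2 : ℝ)) (by norm_num) (by norm_num)))
    rw [Real.dist_eq]; exact abs_floor_mul_div_sub_le n s
  refine ⟨C + |L 1|, fun u hu => ?_⟩
  have hu0 : 0 < u := by linarith
  have hs : u⁻¹ ∈ Ioc (0 : ℝ) 1 := ⟨by positivity, inv_le_one_of_one_le₀ hu⟩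
  have h3 := hC.dist_le (show u⁻¹ ∈ Icc (0 : ℝ) 1 from ⟨hs.1.le, hs.2⟩)
    (show (1 : ℝ) ∈ Icc (0 : ℝ) 1 from ⟨zero_le_one, le_rfl⟩)
  have h4 : (dist u⁻¹ 1) ^ ((H / 2).toNNReal : ℝ) ≤ 1 := by
    refine Real.rpow_le_one dist_nonneg ?_ (NNReal.coe_nonneg _)
    rw [Real.dist_eq, abs_sub_comm, abs_of_nonneg (by linarith [hs.2])]
    linarith [hs.1]
  have h5 : |L u⁻¹| ≤ C + |L 1| := by
    have h6 : |L u⁻¹ - L 1| ≤ C := by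
      rw [← Real.dist_eq]
      refine h3.trans ?_
      exact mul_le_of_le_one_right C.2 h4
    have h7 := abs_sub_abs_le_abs_sub (L u⁻¹) (L 1)
    linarith
  rw [hlim _ hs] at h5
  simp only [hY] at h5
  rw [hqid _ ⟨hs.1.le, hs.2⟩, inv_inv, abs_mul, abs_of_nonneg (by positivity), inv_pow,
    inv_mul_le_iff₀ (by positivity)] at h5
  linarith

end

end FracField

namespace FracField

/-! ### Regular paths, and agreement of pathwise and mean square integrals. -/

section

variable {Ω : Type*} [MeasurableSpace Ω] {P : Measure Ω} {H : ℝ}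
  {β : ModeIndex → ℝ → Ω → ℂ}

/-- A modification of the noise all of whose paths are well behaved. -/
structure IsRegularVersion (P : Measure Ω) (β β' : ModeIndex → ℝ → Ω → ℂ) : Prop where
  measurable : ∀ k t, Measurable (β' k t)
  cont : ∀ k ω, Continuous fun t => β' k t ω
  growth : ∀ k ω, PolyGrowth fun t => β' k t ω
  conj_symm : ∀ k t ω, β' (-k) t ω = conj (β' k t ω)
  ae_eq : ∀ᵐ ω ∂P, ∀ k t, β' k t ω = β k t ω

theorem polyGrowth_of_bounds {g : ℝ → ℂ} (hg : Continuous g) {C : Fin 4 → ℝ}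
    (h0 : ∀ u, 1 ≤ u → |(g (1 * u)).re| ≤ C 0 * u ^ 2)
    (h1 : ∀ u, 1 ≤ u → |(g (-1 * u)).re| ≤ C 1 * u ^ 2)
    (h2 : ∀ u, 1 ≤ u → |(g (1 * u)).im| ≤ C 2 * u ^ 2)
    (h3 : ∀ u, 1 ≤ u → |(g (-1 * u)).im| ≤ C 3 * u ^ 2) : PolyGrowth g := by
  obtain ⟨M, hM⟩ := (isCompact_Icc (a := (-1 : ℝ)) (b := 1)).exists_bound_of_continuousOn
    hg.continuousOn
  have hM0 : 0 ≤ M := (norm_nonneg _).trans (hM 0 (by simp))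
  have hC : ∀ i, 0 ≤ C i := by
    intro i
    fin_cases i
    · simpa using (abs_nonneg _).trans (h0 1 le_rfl)
    · simpa using (abs_nonneg _).trans (h1 1 le_rfl)
    · simpa using (abs_nonneg _).trans (h2 1 le_rfl)
    · simpa using (abs_nonneg _).trans (h3 1 le_rfl)
  refine ⟨M + C 0 + C 1 + C 2 + C 3, fun u => ?_⟩
  have hc0 := hC 0
  have hc1 := hC 1
  have hc2 := hC 2
  have hc3 := hC 3
  have hu := sq_nonneg u
  have hn := Complex.norm_le_abs_re_add_abs_im (g u)
  rcases le_or_gt |u| 1 with h | h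
  · refine (hM u (abs_le.1 h)).trans ?_
    nlinarith [mul_nonneg hM0 hu, mul_nonneg hc0 hu, mul_nonneg hc1 hu, mul_nonneg hc2 hu,
      mul_nonneg hc3 hu]
  · rcases le_or_gt 0 u with h' | h'
    · rw [abs_of_nonneg h'] at h
      have a := h0 u h.le
      have b := h2 u h.le
      rw [one_mul] at a b
      nlinarith [mul_nonneg hM0 hu, mul_nonneg hc0 hu, mul_nonneg hc1 hu, mul_nonneg hc2 hu,
        mul_nonneg hc3 hu]
    · rw [abs_of_neg h'] at h
      have a := h1 (-u) h.le
      have b := h3 (-u) h.le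
      rw [neg_mul_neg, one_mul, neg_sq] at a b
      nlinarith [mul_nonneg hM0 hu, mul_nonneg hc0 hu, mul_nonneg hc1 hu, mul_nonneg hc2 hu,
        mul_nonneg hc3 hu]

theorem IsFBMFamily.vec_mem (hβ : IsFBMFamily H β P) (k : ModeIndex) (t : ℝ) :
    hβ.vec k t ∈ hβ.gaussSpan :=
  Submodule.le_topologicalClosure _ (Submodule.subset_span ⟨(k, t), rfl⟩)

theorem IsFBMFamily.ae_polyGrowth [IsProbabilityMeasure P] (hβ : IsFBMFamily H β P)
    (hH : H ∈ Ioo (0 : ℝ) 1) (k : ModeIndex) :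
    ∀ᵐ ω ∂P, Continuous (fun t => β k t ω) ∧ PolyGrowth fun t => β k t ω := by
  have h2 : √2 ≠ 0 := by positivity
  have hcr : ∀ᵐ ω ∂P, Continuous fun t => (β k t ω).re := by
    filter_upwards [(hβ.fbm k).re.cont] with ω h
    have h' : Continuous fun t => (√2)⁻¹ * (√2 * (β k t ω).re) := continuous_const.mul h
    simpa only [sqrt_two_inv_mul] using h'
  have hci : ∀ᵐ ω ∂P, Continuous fun t => (β k t ω).im := by
    filter_upwards [(hβ.fbm k).im.cont] with ω h
    have h' : Continuous fun t => (√2)⁻¹ * (√2 * (β k t ω).im) := continuous_const.mul h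
    simpa only [sqrt_two_inv_mul] using h'
  have hr := (hβ.fbm k).re.facts.1
  have hi := (hβ.fbm k).im.facts.1
  have hrb : ∀ t, (fun ω => (β k t ω).re) =ᵐ[P] fun ω => (hβ.vec k t ω).re := fun t => by
    filter_upwards [hβ.coeFn_vec k t] with ω h
    rw [h]
  -- The imaginary part is the real part of -iβ, whose L² curve has the same covariance, so the
  -- growth estimate applies to it too.
  have hib : ∀ t, (fun ω => (β k t ω).im) =ᵐ[P]
      fun ω => (((-Complex.I) • hβ.vec k t : Lp ℂ 2 P) ω).re := fun t => by
    filter_upwards [hβ.coeFn_vec k t, Lp.coeFn_smul (-Complex.I) (hβ.vec k t)] with ω h h'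
    rw [h', Pi.smul_apply, h]
    simp
  have hbi : IsFBMCurve H fun t => (-Complex.I) • hβ.vec k t := fun s t => by
    rw [inner_smul_left, inner_smul_right, hβ.isFBMCurve k, ← mul_assoc]
    simp
  have hbm : ∀ t, (-Complex.I) • hβ.vec k t ∈ hβ.gaussSpan := fun t =>
    Submodule.smul_mem _ _ (hβ.vec_mem k t)
  have s1 : |(1 : ℝ)| = 1 := abs_one
  have s2 : |(-1 : ℝ)| = 1 := by rw [abs_neg, abs_one]
  filter_upwards [hcr, hci,
    hβ.ae_growth hH hr hcr (hβ.isFBMCurve k) (hβ.vec_mem k) hrb s1,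
    hβ.ae_growth hH hr hcr (hβ.isFBMCurve k) (hβ.vec_mem k) hrb s2,
    hβ.ae_growth hH hi hci hbi hbm hib s1,
    hβ.ae_growth hH hi hci hbi hbm hib s2] with ω c1 c2 ⟨C0, h0⟩ ⟨C1, h1⟩ ⟨C2, h2⟩ ⟨C3, h3⟩
  have hc : Continuous fun t => β k t ω := by
    have : (fun t => β k t ω) = fun t => ((β k t ω).re : ℂ) + ((β k t ω).im : ℂ) * Complex.I :=
      funext fun t => (Complex.re_add_im _).symm
    rw [this]
    fun_prop
  exact ⟨hc, polyGrowth_of_bounds hc (C := ![C0, C1, C2, C3]) h0 h1 h2 h3⟩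

/-- On a measurable null set containing all bad paths the noise is replaced by zero, which is
continuous, of polynomial growth and conjugation symmetric. -/
theorem IsFBMFamily.exists_regularVersion [IsProbabilityMeasure P] (hβ : IsFBMFamily H β P)
    (hH : H ∈ Ioo (0 : ℝ) 1) : ∃ β', IsRegularVersion P β β' := by
  classical
  have hgood : ∀ᵐ ω ∂P, ∀ k, (Continuous (fun t => β k t ω) ∧ PolyGrowth fun t => β k t ω) ∧
      ∀ t, β (-k) t ω = conj (β k t ω) :=
    ae_all_iff.2 fun k => (hβ.ae_polyGrowth hH k).and (hβ.conj_symm k)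
  rw [ae_iff] at hgood
  set N := {ω | ¬ ∀ k, (Continuous (fun t => β k t ω) ∧ PolyGrowth fun t => β k t ω) ∧
      ∀ t, β (-k) t ω = conj (β k t ω)} with hN
  set B := toMeasurable P N with hB
  have hBm : MeasurableSet B := measurableSet_toMeasurable P N
  have hB0 : P B = 0 := by rw [hB, measure_toMeasurable, hgood]
  have hnot : ∀ ω, ω ∉ B → ∀ k, (Continuous (fun t => β k t ω) ∧ PolyGrowth fun t => β k t ω) ∧
      ∀ t, β (-k) t ω = conj (β k t ω) := fun ω hω => by
    by_contra h
    exact hω (subset_toMeasurable P N h)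
  refine ⟨fun k t ω => if ω ∈ B then 0 else β k t ω, fun k t => ?_, fun k ω => ?_, fun k ω => ?_,
    fun k t ω => ?_, ?_⟩
  · exact Measurable.ite hBm measurable_const ((hβ.fbm k).measurable t)
  · by_cases h : ω ∈ B
    · simpa only [h, if_true] using continuous_const
    · simpa only [h, if_false] using (hnot ω h k).1.1
  · by_cases h : ω ∈ B
    · simp only [h, if_true]
      exact ⟨0, fun u => by simp⟩
    · simpa only [h, if_false] using (hnot ω h k).1.2
  · by_cases h : ω ∈ B
    · simp [h]
    · simpa only [h, if_false] using (hnot ω h k).2 t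
  · have : ∀ᵐ ω ∂P, ω ∉ B := measure_eq_zero_iff_ae_notMem.1 hB0
    filter_upwards [this] with ω h k t
    simp [h]

variable {β' : ModeIndex → ℝ → Ω → ℂ} (hr : IsRegularVersion P β β')

section
include hr

theorem IsRegularVersion.measurable_uncurry (k : ModeIndex) :
    Measurable fun p : ℝ × Ω => β' k p.1 p.2 :=
  measurable_uncurry_of_continuous_of_measurable (u := fun t ω => β' k t ω)
    (hr.cont k) (hr.measurable k)

theorem IsRegularVersion.measurable_pathOU (k : ModeIndex) (κ : ℝ) :
    Measurable fun p : ℝ × Ω => pathOU κ (fun u => β' k u p.2) p.1 := by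
  have h := hr.measurable_uncurry k
  refine h.sub (Measurable.const_mul ?_ _)
  have h1 : Measurable fun q : (ℝ × Ω) × ℝ =>
      (Real.exp (-(κ * q.2)) : ℂ) * β' k (q.1.1 - q.2) q.1.2 := by
    refine Measurable.mul (by fun_prop) (h.comp (f := fun q : (ℝ × Ω) × ℝ =>
      (q.1.1 - q.2, q.1.2)) (by fun_prop))
  exact (h1.stronglyMeasurable.integral_prod_right (ν := volume.restrict (Ioi 0))).measurable

theorem IsRegularVersion.pathOU_conj (k : ModeIndex) (κ t : ℝ) (ω : Ω) :
    pathOU κ (fun u => β' (-k) u ω) t = conj (pathOU κ (fun u => β' k u ω) t) := by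
  simp only [pathOU, hr.conj_symm, map_sub, map_mul, Complex.conj_ofReal, ← integral_conj]

/-- The bridge between the Bochner integral in L² and the pathwise integral. Both are tested against
indicators of events: the inner product passes through the Bochner integral, and Fubini handles the
pathwise one. -/
theorem IsRegularVersion.pathOU_ae_eq [IsProbabilityMeasure P] (hβ : IsFBMFamily H β P) (hH : 0 < H)
    (k : ModeIndex) {κ : ℝ} (hκ : 0 < κ) (t : ℝ) :
    (ouVec κ (hβ.vec k) t : Lp ℂ 2 P) =ᵐ[P] fun ω => pathOU κ (fun u => β' k u ω) t := by
  have hb := hβ.isFBMCurve k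
  have hv : ∀ u, hβ.vec k u =ᵐ[P] β' k u := fun u => by
    filter_upwards [hβ.coeFn_vec k u, hr.ae_eq] with ω h1 h2
    rw [h1, h2]
  have hi := hb.integrableOn hH hκ t
  set I : Lp ℂ 2 P := ∫ v in Ioi (0 : ℝ), (Real.exp (-(κ * v)) : ℂ) • hβ.vec k (t - v) with hI
  have hjm : Measurable fun q : ℝ × Ω => (Real.exp (-(κ * q.1)) : ℂ) * β' k (t - q.1) q.2 :=
    Measurable.mul (by fun_prop) ((hr.measurable_uncurry k).comp
      (f := fun q : ℝ × Ω => (t - q.1, q.2)) (by fun_prop))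
  have hint1 : ∀ u, Integrable (β' k u) P := fun u =>
    ((Lp.memLp (hβ.vec k u)).integrable one_le_two).congr (hv u)
  have hprod : Integrable (fun q : ℝ × Ω => (Real.exp (-(κ * q.1)) : ℂ) * β' k (t - q.1) q.2)
      ((volume.restrict (Ioi 0)).prod P) := by
    rw [integrable_prod_iff hjm.aestronglyMeasurable]
    refine ⟨ae_of_all _ fun v => (hint1 (t - v)).const_mul
      ((Real.exp (-(κ * v)) : ℝ) : ℂ), ?_⟩
    refine hi.norm.mono' (hjm.norm.stronglyMeasurable.integral_prod_right).aestronglyMeasurable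
      (ae_of_all _ fun v => ?_)
    rw [Real.norm_of_nonneg (integral_nonneg fun _ => norm_nonneg _), norm_smul]
    simp only [norm_mul]
    rw [integral_const_mul]
    gcongr
    have e : ∫ ω, ‖β' k (t - v) ω‖ ∂P = ∫ ω, ‖hβ.vec k (t - v) ω‖ ∂P :=
      integral_congr_ae ((hv (t - v)).mono fun ω h => by simp only; rw [h])
    rw [e, Lp.norm_def, integral_norm_eq_lintegral_enorm (Lp.aestronglyMeasurable _),
      ← eLpNorm_one_eq_lintegral_enorm]
    exact ENNReal.toReal_mono (Lp.eLpNorm_ne_top _)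
      (eLpNorm_le_eLpNorm_of_exponent_le one_le_two (Lp.aestronglyMeasurable _))
  have hIae : I =ᵐ[P] fun ω => ∫ v in Ioi (0 : ℝ), (Real.exp (-(κ * v)) : ℂ) * β' k (t - v) ω := by
    refine Integrable.ae_eq_of_forall_setIntegral_eq _ _ ((Lp.memLp I).integrable one_le_two)
      hprod.integral_prod_right fun s hs _ => ?_
    have h1 : ∫ ω in s, I ω ∂P = inner ℂ (indicatorConstLp 2 hs (measure_ne_top P s) (1 : ℂ)) I :=
      (L2.inner_indicatorConstLp_one hs (measure_ne_top P s) I).symm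
    rw [h1, hI, ← integral_inner hi]
    have hprod' : Integrable (fun q : ℝ × Ω => (Real.exp (-(κ * q.1)) : ℂ) * β' k (t - q.1) q.2)
        ((volume.restrict (Ioi 0)).prod (P.restrict s)) :=
      hprod.mono_measure (Measure.prod_mono le_rfl Measure.restrict_le_self)
    rw [← integral_integral_swap (f := fun v ω => (Real.exp (-(κ * v)) : ℂ) * β' k (t - v) ω) hprod']
    refine integral_congr_ae (ae_of_all _ fun v => ?_)
    simp only
    rw [inner_smul_right, L2.inner_indicatorConstLp_one, integral_const_mul]
    congr 1
    exact integral_congr_ae (ae_restrict_of_ae (hv (t - v)))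
  have hou : ouVec κ (hβ.vec k) t = hβ.vec k t - (κ : ℂ) • I := rfl
  rw [hou]
  filter_upwards [Lp.coeFn_sub (hβ.vec k t) ((κ : ℂ) • I), Lp.coeFn_smul (κ : ℂ) I, hIae, hv t]
    with ω h1 h2 h3 h4
  rw [h1, Pi.sub_apply, h2, Pi.smul_apply, h3, h4, pathOU, smul_eq_mul]

end

end

end FracField

namespace FracField

/-! ### Series of Ornstein–Uhlenbeck coordinates and their covariances. -/

section

variable {Ω : Type*} [MeasurableSpace Ω] {P : Measure Ω} [IsProbabilityMeasure P] {H : ℝ}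
  {β : ModeIndex → ℝ → Ω → ℂ}

local notation "⟪" x ", " y "⟫" => inner ℂ x y

/-- The conjugate of a random variable. -/
noncomputable def conjL (P : Measure Ω) : Lp ℂ 2 P →L[ℝ] Lp ℂ 2 P :=
  (Complex.conjCLE : ℂ →L[ℝ] ℂ).compLpL 2 P

omit [IsProbabilityMeasure P] in
theorem coeFn_conjL (U : Lp ℂ 2 P) : conjL P U =ᵐ[P] fun ω => conj (U ω) :=
  (Complex.conjCLE : ℂ →L[ℝ] ℂ).coeFn_compLpL U

omit [IsProbabilityMeasure P] in
theorem conjL_smul (c : ℂ) (U : Lp ℂ 2 P) : conjL P (c • U) = conj c • conjL P U := by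
  refine Lp.ext ?_
  filter_upwards [coeFn_conjL (c • U), Lp.coeFn_smul c U, Lp.coeFn_smul (conj c) (conjL P U),
    coeFn_conjL U] with ω h1 h2 h3 h4
  rw [h1, h2, h3, Pi.smul_apply, Pi.smul_apply, h4, smul_eq_mul, smul_eq_mul, map_mul]

omit [IsProbabilityMeasure P] in
-- Covariances of real parts are rewritten through (U + conj U)/2, so that orthogonality of the
-- complex modes can be used.
theorem real_inner_reL (U W : Lp ℂ 2 P) : inner ℝ (reL P U) (reL P W) =
    (⟪(2⁻¹ : ℂ) • (U + conjL P U), (2⁻¹ : ℂ) • (W + conjL P W)⟫).re := by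
  have key : ∀ U : Lp ℂ 2 P,
      ((2⁻¹ : ℂ) • (U + conjL P U) : Lp ℂ 2 P) =ᵐ[P] fun ω => ((reL P U ω : ℝ) : ℂ) := fun U => by
    filter_upwards [Lp.coeFn_smul (2⁻¹ : ℂ) (U + conjL P U), Lp.coeFn_add U (conjL P U),
      coeFn_conjL U, coeFn_reL U] with ω h1 h2 h3 h4
    rw [h1, Pi.smul_apply, h2, Pi.add_apply, h3, h4, smul_eq_mul, Complex.add_conj]
    push_cast
    ring
  rw [L2.inner_def, L2.inner_def]
  have e : ∫ ω, ⟪((2⁻¹ : ℂ) • (U + conjL P U) : Lp ℂ 2 P) ω,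
      ((2⁻¹ : ℂ) • (W + conjL P W) : Lp ℂ 2 P) ω⟫ ∂P =
      ∫ ω, ((inner ℝ (reL P U ω) (reL P W ω) : ℝ) : ℂ) ∂P := by
    refine integral_congr_ae ?_
    filter_upwards [key U, key W] with ω h1 h2
    rw [h1, h2]
    simp
  rw [e, integral_complex_ofReal, Complex.ofReal_re]

variable (hβ : IsFBMFamily H β P) (κ : ModeIndex → ℝ)

/-- The stationary Ornstein–Uhlenbeck coordinates. -/
noncomputable def IsFBMFamily.ou (k : ModeIndex) (t : ℝ) : Lp ℂ 2 P := ouVec (κ k) (hβ.vec k) t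

/-- The random variables `∑ w_k c_k(t)`. -/
noncomputable def IsFBMFamily.series (w : ModeIndex → ℂ) (t : ℝ) : Lp ℂ 2 P :=
  ∑' k, w k • hβ.ou κ k t

/-- Admissible coefficients. -/
def Admissible (H : ℝ) (κ : ModeIndex → ℝ) (w : ModeIndex → ℂ) : Prop :=
  Summable fun k => ‖w k‖ ^ 2 * κ k ^ (-(2 * H))

/-- Coefficients of the real part. -/
noncomputable def reSym (w : ModeIndex → ℂ) (k : ModeIndex) : ℂ := 2⁻¹ * (w k + conj (w (-k)))

omit [IsProbabilityMeasure P] in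
theorem IsFBMFamily.ou_mem (k : ModeIndex) (t : ℝ) : hβ.ou κ k t ∈ hβ.gaussSpan :=
  ouVec_mem (Submodule.isClosed_topologicalClosure _) (fun u _ => hβ.vec_mem k u) _

theorem IsFBMFamily.inner_ou_eq_zero {k l : ModeIndex} (h : k ≠ l) (s t : ℝ) :
    ⟪hβ.ou κ k s, hβ.ou κ l t⟫ = 0 :=
  inner_ouVec_eq_zero (hβ.inner_eq_zero h) _ _ _ _

variable {κ}

theorem norm_add_sq_le {E : Type*} [SeminormedAddCommGroup E] (x y : E) :
    ‖x + y‖ ^ 2 ≤ 2 * (‖x‖ ^ 2 + ‖y‖ ^ 2) := by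
  have h := norm_add_le x y
  nlinarith [norm_nonneg (x + y), sq_nonneg (‖x‖ - ‖y‖), norm_nonneg x, norm_nonneg y]

theorem Admissible.of_le {w : ModeIndex → ℂ} (hκ : ∀ k, 0 < κ k) {f : ModeIndex → ℝ}
    (hf : Summable f) (h : ∀ k, ‖w k‖ ^ 2 * κ k ^ (-(2 * H)) ≤ f k) : Admissible H κ w :=
  hf.of_nonneg_of_le (fun k => mul_nonneg (by positivity) (Real.rpow_nonneg (hκ k).le _)) h

theorem Admissible.reSym (hκ : ∀ k, 0 < κ k) (hκs : ∀ k, κ (-k) = κ k) {w : ModeIndex → ℂ}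
    (hw : Admissible H κ w) : Admissible H κ (reSym w) := by
  have h2 : Summable fun k => ‖w (-k)‖ ^ 2 * κ k ^ (-(2 * H)) := by
    have := negEquiv.summable_iff.2 hw
    refine this.congr fun k => ?_
    change ‖w (-k)‖ ^ 2 * κ (-k) ^ (-(2 * H)) = _
    rw [hκs]
  refine Admissible.of_le hκ (hw.add h2) fun k => ?_
  have h := norm_add_sq_le (w k) (conj (w (-k)))
  rw [RCLike.norm_conj] at h
  have e : ‖FracField.reSym w k‖ ^ 2 = ‖w k + conj (w (-k))‖ ^ 2 / 4 := by
    rw [FracField.reSym, norm_mul, mul_pow]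
    norm_num
    ring
  rw [e]
  have hp := Real.rpow_nonneg (hκ k).le (-(2 * H))
  nlinarith [mul_nonneg (sq_nonneg ‖w k‖) hp, mul_nonneg (sq_nonneg ‖w (-k)‖) hp]

/-- With H = 0 and κ = 1 admissibility is plain square summability. -/
theorem summable_norm_reSym {w : ModeIndex → ℂ} (hw : Summable fun k => ‖w k‖ ^ 2) :
    Summable fun k => ‖FracField.reSym w k‖ ^ 2 := by
  have := Admissible.reSym (H := 0) (κ := fun _ => 1) (fun _ => one_pos) (fun _ => rfl)
    (w := w) (by simpa [Admissible] using hw)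
  simpa [Admissible] using this

variable (hH : H ∈ Ioo (0 : ℝ) 1) (hκ : ∀ k, 0 < κ k)

section
include hH hκ

omit [IsProbabilityMeasure P] in
theorem IsFBMFamily.norm_ou_sq_le (k : ModeIndex) (t : ℝ) :
    ‖hβ.ou κ k t‖ ^ 2 ≤ Real.Gamma (H + 1) ^ 2 * κ k ^ (-(2 * H)) := by
  have h := (hβ.isFBMCurve k).norm_ouVec_le hH.1 (hκ k) t
  refine (pow_le_pow_left₀ (norm_nonneg _) h 2).trans (le_of_eq ?_)
  rw [mul_pow, ← Real.rpow_natCast (κ k ^ (-H)), ← Real.rpow_mul (hκ k).le]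
  congr 2
  push_cast
  ring

omit [IsProbabilityMeasure P] in
theorem IsFBMFamily.summable_norm_series {w : ModeIndex → ℂ} (hw : Admissible H κ w) (t : ℝ) :
    Summable fun k => ‖w k • hβ.ou κ k t‖ ^ 2 := by
  refine (hw.mul_left (Real.Gamma (H + 1) ^ 2)).of_nonneg_of_le (fun _ => by positivity) fun k => ?_
  rw [norm_smul, mul_pow]
  have := hβ.norm_ou_sq_le hH hκ k t
  nlinarith [sq_nonneg ‖w k‖]

theorem IsFBMFamily.summable_series {w : ModeIndex → ℂ} (hw : Admissible H κ w) (t : ℝ) :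
    Summable fun k => w k • hβ.ou κ k t := by
  refine summable_of_orthogonal (fun k l hkl => ?_) (hβ.summable_norm_series hH hκ hw t)
  beta_reduce
  rw [inner_smul_left, inner_smul_right, hβ.inner_ou_eq_zero κ hkl, mul_zero, mul_zero]

omit hH hκ [IsProbabilityMeasure P] in
theorem IsFBMFamily.series_mem (w : ModeIndex → ℂ) (t : ℝ) : hβ.series κ w t ∈ hβ.gaussSpan := by
  rw [IsFBMFamily.series]
  by_cases h : Summable fun k => w k • hβ.ou κ k t
  · exact (Submodule.isClosed_topologicalClosure _).mem_of_tendsto h.hasSum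
      (Eventually.of_forall fun F => Submodule.sum_mem _ fun k _ =>
        Submodule.smul_mem _ _ (hβ.ou_mem κ k t))
  · rw [tsum_eq_zero_of_not_summable h]
    exact Submodule.zero_mem _

theorem IsFBMFamily.hasSum_inner_series {w w' : ModeIndex → ℂ} (hw : Admissible H κ w)
    (hw' : Admissible H κ w') (s t : ℝ) :
    HasSum (fun k => conj (w k) * w' k * ⟪hβ.ou κ k s, hβ.ou κ k t⟫)
      ⟪hβ.series κ w s, hβ.series κ w' t⟫ := by
  have := inner_tsum_tsum (hβ.summable_series hH hκ hw s) (hβ.summable_series hH hκ hw' t)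
    fun k l hkl => by
      rw [inner_smul_left, inner_smul_right, hβ.inner_ou_eq_zero κ hkl, mul_zero, mul_zero]
  simp only [inner_smul_left, inner_smul_right] at this
  refine this.congr_fun fun k => ?_
  ring

theorem IsFBMFamily.inner_series_add {w w' : ModeIndex → ℂ} (hw : Admissible H κ w)
    (hw' : Admissible H κ w') (s t r : ℝ) :
    ⟪hβ.series κ w (s + r), hβ.series κ w' (t + r)⟫ = ⟪hβ.series κ w s, hβ.series κ w' t⟫ := by
  rw [← (hβ.hasSum_inner_series hH hκ hw hw' s t).tsum_eq,
    ← (hβ.hasSum_inner_series hH hκ hw hw' (s + r) (t + r)).tsum_eq]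
  refine tsum_congr fun k => ?_
  rw [IsFBMFamily.ou, IsFBMFamily.ou, (hβ.isFBMCurve k).inner_ouVec_add hH.1 (hκ k)]
  rfl

theorem IsFBMFamily.hasSum_norm_series_sub {w w' : ModeIndex → ℂ} (hw : Admissible H κ w)
    (hw' : Admissible H κ w') (s t : ℝ) :
    HasSum (fun k => ‖w k • hβ.ou κ k s - w' k • hβ.ou κ k t‖ ^ 2)
      (‖hβ.series κ w s - hβ.series κ w' t‖ ^ 2) := by
  have h1 := hβ.summable_series hH hκ hw s
  have h2 := hβ.summable_series hH hκ hw' t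
  rw [IsFBMFamily.series, IsFBMFamily.series, ← h1.tsum_sub h2]
  refine norm_tsum_sq (h1.sub h2) fun k l hkl => ?_
  simp only [inner_sub_left, inner_sub_right, inner_smul_left, inner_smul_right,
    hβ.inner_ou_eq_zero κ hkl, mul_zero, sub_zero]

theorem IsFBMFamily.conjL_ou (hκs : ∀ k, κ (-k) = κ k) (k : ModeIndex) (t : ℝ) :
    conjL P (hβ.ou κ k t) = hβ.ou κ (-k) t := by
  obtain ⟨β', hr⟩ := hβ.exists_regularVersion hH
  refine Lp.ext ?_
  filter_upwards [coeFn_conjL (hβ.ou κ k t), hr.pathOU_ae_eq hβ hH.1 k (hκ k) t,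
    hr.pathOU_ae_eq hβ hH.1 (-k) (hκ (-k)) t] with ω h1 h2 h3
  rw [h1, IsFBMFamily.ou, h2, IsFBMFamily.ou, h3, hκs, hr.pathOU_conj]

theorem IsFBMFamily.re_series (hκs : ∀ k, κ (-k) = κ k) {w : ModeIndex → ℂ}
    (hw : Admissible H κ w) (t : ℝ) :
    (2⁻¹ : ℂ) • (hβ.series κ w t + conjL P (hβ.series κ w t)) = hβ.series κ (reSym w) t := by
  have h1 := (hβ.summable_series hH hκ hw t).hasSum
  have h2 := h1.mapL (conjL P)
  have h3 : HasSum (fun k => conj (w (-k)) • hβ.ou κ k t) (conjL P (hβ.series κ w t)) := by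
    refine (negEquiv.hasSum_iff.2 h2).congr_fun fun k => ?_
    change conj (w (-k)) • hβ.ou κ k t = conjL P (w (-k) • hβ.ou κ (-k) t)
    rw [conjL_smul, hβ.conjL_ou hH hκ hκs, ModeIndex.neg_neg]
  refine ((h1.add h3).const_smul (2⁻¹ : ℂ)).tsum_eq.symm.trans ?_
  rw [IsFBMFamily.series]
  refine tsum_congr fun k => ?_
  rw [← add_smul, smul_smul, FracField.reSym]

theorem IsFBMFamily.real_inner_series (hκs : ∀ k, κ (-k) = κ k) {w w' : ModeIndex → ℂ}
    (hw : Admissible H κ w) (hw' : Admissible H κ w') (s t : ℝ) :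
    inner ℝ (reL P (hβ.series κ w s)) (reL P (hβ.series κ w' t)) =
      (⟪hβ.series κ (reSym w) s, hβ.series κ (reSym w') t⟫).re := by
  rw [real_inner_reL, hβ.re_series hH hκ hκs hw, hβ.re_series hH hκ hκs hw']

theorem IsFBMFamily.real_inner_series_add (hκs : ∀ k, κ (-k) = κ k) {w w' : ModeIndex → ℂ}
    (hw : Admissible H κ w) (hw' : Admissible H κ w') (s t r : ℝ) :
    inner ℝ (reL P (hβ.series κ w (s + r))) (reL P (hβ.series κ w' (t + r))) =
      inner ℝ (reL P (hβ.series κ w s)) (reL P (hβ.series κ w' t)) := by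
  rw [hβ.real_inner_series hH hκ hκs hw hw', hβ.real_inner_series hH hκ hκs hw hw',
    hβ.inner_series_add hH hκ (hw.reSym hκ hκs) (hw'.reSym hκ hκs)]

/-- These norms are the variances in the joint characteristic functions of the solution; their shift
invariance is its strict stationarity. -/
theorem IsFBMFamily.norm_reL_sum_series_add (hκs : ∀ k, κ (-k) = κ k) {n : ℕ}
    {w : Fin n → ModeIndex → ℂ} (hw : ∀ i, Admissible H κ (w i)) (t : Fin n → ℝ) (r : ℝ) :
    ‖reL P (∑ i, hβ.series κ (w i) (t i + r))‖ ^ 2 = ‖reL P (∑ i, hβ.series κ (w i) (t i))‖ ^ 2 := by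
  simp only [map_sum, ← real_inner_self_eq_norm_sq, sum_inner, inner_sum]
  refine Finset.sum_congr rfl fun i _ => Finset.sum_congr rfl fun j _ => ?_
  exact hβ.real_inner_series_add hH hκ hκs (hw _) (hw _) _ _ _

/-- Decay is uniform over the modes because the rates are bounded below by κ₀; summing it requires
square summable coefficients, not just admissible ones. -/
theorem IsFBMFamily.abs_inner_series_le (hκs : ∀ k, κ (-k) = κ k) {κ₀ : ℝ} (h0 : 0 < κ₀)
    (hκ0 : ∀ k, κ₀ ≤ κ k) {w : ModeIndex → ℂ} (hw : Admissible H κ w)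
    (hw2 : Summable fun k => ‖w k‖ ^ 2) {s t : ℝ} (hst : s + 1 ≤ t) :
    |inner ℝ (reL P (hβ.series κ w s)) (reL P (hβ.series κ w t))| ≤
      decayConst H κ₀ * (∑' k, ‖reSym w k‖ ^ 2) * (t - s) ^ (2 * H - 2) := by
  rw [hβ.real_inner_series hH hκ hκs hw hw]
  refine (Complex.abs_re_le_norm _).trans ?_
  have h := hβ.hasSum_inner_series hH hκ (hw.reSym hκ hκs) (hw.reSym hκ hκs) s t
  have hd : 0 ≤ (t - s) ^ (2 * H - 2) := Real.rpow_nonneg (by linarith) _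
  have hs := ((summable_norm_reSym hw2).mul_left (decayConst H κ₀)).mul_right
    ((t - s) ^ (2 * H - 2))
  have hle : ∀ k, ‖conj (reSym w k) * reSym w k * ⟪hβ.ou κ k s, hβ.ou κ k t⟫‖ ≤
      decayConst H κ₀ * ‖reSym w k‖ ^ 2 * (t - s) ^ (2 * H - 2) := fun k => by
    rw [norm_mul, norm_mul, RCLike.norm_conj]
    have h1 : ‖⟪hβ.ou κ k s, hβ.ou κ k t⟫‖ ≤ decayConst H κ₀ * (t - s) ^ (2 * H - 2) :=
      ((hβ.isFBMCurve k).norm_inner_ouVec_le hH (hκ k) hst).trans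
        (mul_le_mul_of_nonneg_right (decayConst_anti hH.1 h0 (hκ0 k)) hd)
    calc ‖reSym w k‖ * ‖reSym w k‖ * ‖⟪hβ.ou κ k s, hβ.ou κ k t⟫‖
        ≤ ‖reSym w k‖ * ‖reSym w k‖ * (decayConst H κ₀ * (t - s) ^ (2 * H - 2)) := by gcongr
      _ = _ := by ring
  rw [← h.tsum_eq]
  refine (tsum_of_norm_bounded hs.hasSum hle).trans (le_of_eq ?_)
  rw [tsum_mul_right, tsum_mul_left]

theorem IsFBMFamily.norm_series_sub_le {w : ModeIndex → ℂ} (hw : Admissible H κ w)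
    (hw2 : Summable fun k => ‖w k‖ ^ 2) (s t : ℝ) :
    ‖hβ.series κ w s - hβ.series κ w t‖ ^ 2 ≤ (∑' k, ‖w k‖ ^ 2) * (2 * |s - t| ^ H) ^ 2 := by
  have h := hβ.hasSum_norm_series_sub hH hκ hw hw s t
  rw [← h.tsum_eq, ← tsum_mul_right]
  refine h.summable.tsum_le_tsum (fun k => ?_) (hw2.mul_right _)
  rw [← smul_sub, norm_smul, mul_pow]
  have := (hβ.isFBMCurve k).norm_ouVec_sub_le hH.1 (hκ k) t s
  exact mul_le_mul_of_nonneg_left (pow_le_pow_left₀ (norm_nonneg _) this 2) (sq_nonneg _)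

end

/-- Gaussian characters decorrelate with the covariance. -/
theorem IsFBMFamily.norm_covariance_exp_le {U W : Lp ℂ 2 P} (hU : U ∈ hβ.gaussSpan)
    (hW : W ∈ hβ.gaussSpan) :
    ‖∫ ω, Complex.exp ((U ω).re * Complex.I) * conj (Complex.exp ((W ω).re * Complex.I)) ∂P -
      (∫ ω, Complex.exp ((U ω).re * Complex.I) ∂P) *
        conj (∫ ω, Complex.exp ((W ω).re * Complex.I) ∂P)‖ ≤
      |inner ℝ (reL P U) (reL P W)| := by
  have h1 : ∫ ω, Complex.exp ((U ω).re * Complex.I) * conj (Complex.exp ((W ω).re * Complex.I)) ∂P =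
      ∫ ω, Complex.exp (((U - W : Lp ℂ 2 P) ω).re * Complex.I) ∂P := by
    refine integral_congr_ae ?_
    filter_upwards [Lp.coeFn_sub U W] with ω h
    rw [h, ← Complex.exp_conj, ← Complex.exp_add, Pi.sub_apply, Complex.sub_re]
    congr 1
    simp
    ring
  rw [h1, hβ.integral_exp_re (Submodule.sub_mem _ hU hW), hβ.integral_exp_re hU,
    hβ.integral_exp_re hW, Complex.conj_ofReal, ← Complex.ofReal_mul, ← Complex.ofReal_sub,
    Complex.norm_real, Real.norm_eq_abs, ← Real.exp_add, map_sub, norm_sub_sq_real]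
  set a := ‖reL P U‖
  set b := ‖reL P W‖
  set c := inner ℝ (reL P U) (reL P W) with hc
  have hcab : |c| ≤ a * b := abs_real_inner_le_norm _ _
  have e1 : -((a ^ 2 - 2 * c + b ^ 2) / 2) = c - (a ^ 2 + b ^ 2) / 2 := by ring
  have e2 : -(a ^ 2 / 2) + -(b ^ 2 / 2) = -((a ^ 2 + b ^ 2) / 2) := by ring
  rw [e1, e2]
  -- The claim is |e^{c-d} - e^{-d}| ≤ |c|; it holds because |c| ≤ d keeps both exponents
  -- nonpositive.
  set d := (a ^ 2 + b ^ 2) / 2 with hd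
  have hcd : |c| ≤ d := hcab.trans (by nlinarith [sq_nonneg (a - b)])
  have hd0 : 0 ≤ d := (abs_nonneg c).trans hcd
  rcases le_total 0 c with h | h
  · rw [abs_of_nonneg h] at hcd ⊢
    have h2 : Real.exp (-d) ≤ Real.exp (c - d) := Real.exp_le_exp.2 (by linarith)
    rw [abs_of_nonneg (by linarith)]
    have h3 : Real.exp (-d) = Real.exp (c - d) * Real.exp (-c) := by
      rw [← Real.exp_add]; ring_nf
    have h4 := Real.add_one_le_exp (-c)
    have h5 : Real.exp (c - d) ≤ 1 := Real.exp_le_one_iff.2 (by linarith)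
    have h6 := Real.exp_pos (c - d)
    rw [h3]
    nlinarith
  · rw [abs_of_nonpos h] at hcd ⊢
    have h2 : Real.exp (c - d) ≤ Real.exp (-d) := Real.exp_le_exp.2 (by linarith)
    rw [abs_of_nonpos (by linarith)]
    have h3 : Real.exp (c - d) = Real.exp (-d) * Real.exp c := by
      rw [← Real.exp_add]; ring_nf
    have h4 := Real.add_one_le_exp c
    have h5 : Real.exp (-d) ≤ 1 := Real.exp_le_one_iff.2 (by linarith)
    have h6 := Real.exp_pos (-d)
    rw [h3]
    nlinarith

end

end FracField

namespace FracField

/-! ### The Fourier basis of `V` and the semigroup. -/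

section

local notation "⟪" x ", " y "⟫" => inner ℂ x y

/-- The inner product of `V` as a Hilbert space. -/
noncomputable instance instInnerV : Inner ℂ V := InnerProductSpace.toInner

theorem inner_v_smul_right (v f : V) (c : ℂ) : ⟪v, c • f⟫ = c * ⟪v, f⟫ :=
  inner_smul_right (𝕜 := ℂ) (E := V) v f c

theorem inner_v_smul_left (v f : V) (c : ℂ) : ⟪c • v, f⟫ = conj c * ⟪v, f⟫ :=
  inner_smul_left (𝕜 := ℂ) (E := V) v f c

theorem inner_v_self (f : V) : ⟪f, f⟫ = ((‖f‖ ^ 2 : ℝ) : ℂ) := by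
  rw [inner_self_eq_norm_sq_to_K]
  push_cast
  rfl

/-- The Fourier monomials in `L²` of the torus. -/
noncomputable def monomial (n : Fin 2 → ℤ) : Lp ℂ 2 torusMeasure :=
  ContinuousMap.toLp (E := ℂ) 2 torusMeasure ℂ (mFourier n)

theorem orthonormal_monomial : Orthonormal ℂ monomial := orthonormal_mFourier (d := Fin 2)

theorem mFourierCoeff_eq_inner (f : Lp ℂ 2 torusMeasure) (n : Fin 2 → ℤ) :
    mFourierCoeff f n = ⟪monomial n, f⟫ := by
  have h1 := mFourierBasis_repr (d := Fin 2) f n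
  have h2 := mFourierBasis.repr_apply_apply (𝕜 := ℂ) f n
  rw [coe_mFourierBasis] at h2
  exact h1.symm.trans h2

theorem ext_mFourierCoeff {f g : Lp ℂ 2 torusMeasure}
    (h : ∀ n, mFourierCoeff f n = mFourierCoeff g n) : f = g := by
  refine (mFourierBasis (d := Fin 2)).repr.injective (lp.ext (funext fun n => ?_))
  exact (mFourierBasis_repr (d := Fin 2) f n).trans
    ((h n).trans (mFourierBasis_repr (d := Fin 2) g n).symm)

theorem mem_meanZero_iff (f : Lp ℂ 2 torusMeasure) : f ∈ meanZero ↔ mFourierCoeff f 0 = 0 := by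
  rw [mFourierCoeff, neg_zero]
  simp only [mFourier_zero, ContinuousMap.one_apply, one_smul]
  rfl

theorem isClosed_meanZero : IsClosed (meanZero : Set (Lp ℂ 2 torusMeasure)) := by
  have h : (meanZero : Set (Lp ℂ 2 torusMeasure)) =
      {f | ⟪monomial 0, f⟫ = 0} := by
    ext f
    rw [mem_ofPred_eq, ← mFourierCoeff_eq_inner]
    exact mem_meanZero_iff f
  rw [h]
  exact isClosed_eq (by fun_prop) continuous_const

instance : CompleteSpace V := isClosed_meanZero.completeSpace_coe

instance : SecondCountableTopology V := by
  have h : DenseRange (ContinuousMap.toLp (E := ℂ) 2 torusMeasure ℂ) :=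
    ContinuousMap.toLp_denseRange ℂ torusMeasure ℂ (by norm_num)
  have h1 : TopologicalSpace.SeparableSpace (Lp ℂ 2 torusMeasure) :=
    h.separableSpace (ContinuousLinearMap.continuous _)
  have h2 : SecondCountableTopology (Lp ℂ 2 torusMeasure) :=
    UniformSpace.secondCountable_of_separable _
  exact inferInstanceAs (SecondCountableTopology (meanZero : Set (Lp ℂ 2 torusMeasure)))

theorem inner_e (k : ModeIndex) (f : V) :
    ⟪e k, f⟫ = mFourierCoeff (f : Lp ℂ 2 torusMeasure) k.1 :=
  (mFourierCoeff_eq_inner _ _).symm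

theorem orthonormal_e : Orthonormal ℂ e := by
  have h := orthonormal_monomial.comp (Subtype.val : ModeIndex → Fin 2 → ℤ)
    Subtype.val_injective
  refine ⟨fun k => h.1 k, fun k l hkl => h.2 hkl⟩

theorem span_e_orthogonal : (Submodule.span ℂ (range e))ᗮ = ⊥ := by
  rw [Submodule.eq_bot_iff]
  intro f hf
  have h1 : ∀ n : Fin 2 → ℤ, mFourierCoeff (f : Lp ℂ 2 torusMeasure) n = 0 := fun n => by
    by_cases hn : n = 0
    · rw [hn]; exact (mem_meanZero_iff _).1 f.2
    · rw [← inner_e ⟨n, hn⟩]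
      exact (Submodule.mem_orthogonal _ _).1 hf _ (Submodule.subset_span ⟨⟨n, hn⟩, rfl⟩)
  refine Subtype.ext (ext_mFourierCoeff fun n => ?_)
  rw [h1, mFourierCoeff_eq_inner, Submodule.coe_zero, inner_zero_right]

/-- The Fourier basis of `V`. -/
noncomputable def vBasis : HilbertBasis ModeIndex ℂ V :=
  HilbertBasis.mkOfOrthogonalEqBot orthonormal_e span_e_orthogonal

theorem coe_vBasis : ⇑vBasis = e := HilbertBasis.coe_mkOfOrthogonalEqBot _ _

theorem hasSum_norm_sq (f : V) : HasSum (fun k => ‖⟪e k, f⟫‖ ^ 2) (‖f‖ ^ 2) := by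
  have h := vBasis.hasSum_inner_mul_inner f f
  rw [coe_vBasis, inner_v_self] at h
  have h2 : ∀ k, ⟪f, e k⟫ * ⟪e k, f⟫ = ((‖⟪e k, f⟫‖ ^ 2 : ℝ) : ℂ) := fun k => by
    rw [← inner_conj_symm, Complex.conj_mul']
    push_cast; rfl
  simp only [h2] at h
  exact_mod_cast h

theorem enorm_sq_eq_tsum (f : V) : ‖f‖ₑ ^ 2 = ∑' k, ‖⟪e k, f⟫‖ₑ ^ 2 := by
  have h := hasSum_norm_sq f
  have e1 : ∀ z : ℂ, ‖z‖ₑ ^ 2 = ENNReal.ofReal (‖z‖ ^ 2) := fun z => by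
    rw [ENNReal.ofReal_pow (norm_nonneg _), ofReal_norm]
  simp only [e1]
  rw [← ENNReal.ofReal_tsum_of_nonneg (fun _ => by positivity) h.summable, h.tsum_eq,
    ENNReal.ofReal_pow (norm_nonneg _), ofReal_norm]

theorem inner_e_tsum {c : ModeIndex → ℂ} (hc : Summable fun k => ‖c k‖ ^ 2) :
    Summable (fun k => c k • e k) ∧ ∀ k, ⟪e k, ∑' l, c l • e l⟫ = c k := by
  have hs : Summable fun k => c k • e k := by
    refine summable_of_orthogonal (fun k l hkl => ?_) (hc.congr fun k => ?_)
    · beta_reduce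
      rw [inner_v_smul_left, inner_v_smul_right, orthonormal_e.2 hkl, mul_zero, mul_zero]
    · rw [norm_smul, orthonormal_e.1, mul_one]
  refine ⟨hs, fun k => ?_⟩
  have h := hs.hasSum.mapL (innerSL ℂ (e k))
  simp only [innerSL_apply_apply, inner_v_smul_right] at h
  rw [← h.tsum_eq, tsum_eq_single k fun l hl => by rw [orthonormal_e.2 hl.symm, mul_zero],
    inner_v_self, orthonormal_e.1]
  simp

theorem hasSum_inner_e (v f : V) : HasSum (fun k => ⟪v, e k⟫ * ⟪e k, f⟫) ⟪v, f⟫ := by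
  have h := vBasis.hasSum_inner_mul_inner v f
  rwa [coe_vBasis] at h

theorem inner_e_sum [DecidableEq ModeIndex] (F : Finset ModeIndex) (c : ModeIndex → ℂ)
    (k : ModeIndex) : ⟪e k, ∑ l ∈ F, c l • e l⟫ = if k ∈ F then c k else 0 := by
  rw [inner_sum]
  simp only [inner_v_smul_right, orthonormal_iff_ite.1 orthonormal_e, mul_ite, mul_one, mul_zero]
  exact Finset.sum_ite_eq F k c

theorem enorm_sub_sum_sq (f : V) (F : Finset ModeIndex) :
    ‖f - ∑ k ∈ F, ⟪e k, f⟫ • e k‖ₑ ^ 2 = ∑' k : {k // k ∉ F}, ‖⟪e (k : ModeIndex), f⟫‖ₑ ^ 2 := by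
  classical
  have h := tsum_subtype {k | k ∉ F} fun k => ‖⟪e k, f⟫‖ₑ ^ 2
  refine Eq.trans ?_ h.symm
  rw [enorm_sq_eq_tsum]
  refine tsum_congr fun k => ?_
  rw [inner_sub_right, inner_e_sum, indicator_apply]
  by_cases hk : k ∈ F <;> simp [hk]

section semigroup

variable {ν : ℝ} {α : ModeIndex → ℝ} {t : ℝ}

theorem inner_e_semigroup (h : ∀ k, 0 ≤ t * ν * α k) (f : V) (k : ModeIndex) :
    ⟪e k, semigroup ν α t f⟫ = (Real.exp (-(t * ν * α k)) : ℂ) * ⟪e k, f⟫ := by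
  refine (inner_e_tsum ?_).2 k
  refine (hasSum_norm_sq f).summable.of_nonneg_of_le (fun _ => by positivity) fun k => ?_
  rw [norm_mul, Complex.norm_real, Real.norm_eq_abs, Real.abs_exp]
  gcongr
  exact mul_le_of_le_one_left (norm_nonneg _) (Real.exp_le_one_iff.2 (by linarith [h k]))

/-- Every Fourier coefficient of the difference is multiplied by at most e^{-c}, and Parseval sums
up. This contraction drives uniqueness. -/
theorem norm_semigroup_sub_le {c : ℝ} (hc : 0 ≤ c) (h : ∀ k, c ≤ t * ν * α k) (f g : V) :
    ‖semigroup ν α t f - semigroup ν α t g‖ ≤ Real.exp (-c) * ‖f - g‖ := by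
  refine le_of_sq_le_sq ?_ (by positivity)
  have h0 : ∀ k, 0 ≤ t * ν * α k := fun k => hc.trans (h k)
  have h1 := hasSum_norm_sq (semigroup ν α t f - semigroup ν α t g)
  have h2 := (hasSum_norm_sq (f - g)).mul_left (Real.exp (-c) ^ 2)
  rw [mul_pow]
  refine hasSum_le (fun k => ?_) h1 h2
  rw [inner_sub_right, inner_e_semigroup h0, inner_e_semigroup h0, ← mul_sub, ← inner_sub_right,
    norm_mul, Complex.norm_real, Real.norm_eq_abs, Real.abs_exp, mul_pow]
  gcongr
  exact h k

theorem continuous_semigroup (h : ∀ k, 0 ≤ t * ν * α k) : Continuous (semigroup ν α t) := by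
  refine LipschitzWith.continuous (K := 1) (LipschitzWith.of_dist_le_mul fun f g => ?_)
  rw [dist_eq_norm, dist_eq_norm, NNReal.coe_one]
  simpa using norm_semigroup_sub_le le_rfl h f g

end semigroup

end

section RandomSeries

variable {Ω : Type*} [MeasurableSpace Ω] {P : Measure Ω}

local notation "⟪" x ", " y "⟫" => inner ℂ x y

/-- Expansions of random elements of `V` with square summable coefficients converge in `L²`. -/
theorem tendsto_eLpNorm_sub_sum {Φ : Ω → V} {d : ModeIndex → Ω → ℂ}
    (hd : ∀ k, AEMeasurable (d k) P) (hsum : ∑' k, ∫⁻ ω, ‖d k ω‖ₑ ^ 2 ∂P ≠ ∞)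
    (hΦ : ∀ᵐ ω ∂P, ∀ k, ⟪e k, Φ ω⟫ = d k ω) :
    Tendsto (fun F : Finset ModeIndex => eLpNorm (fun ω => Φ ω - ∑ k ∈ F, d k ω • e k) 2 P) atTop
      (𝓝 0) := by
  have h1 : ∀ F : Finset ModeIndex, eLpNorm (fun ω => Φ ω - ∑ k ∈ F, d k ω • e k) 2 P =
      (∑' k : {k // k ∉ F}, ∫⁻ ω, ‖d k ω‖ₑ ^ 2 ∂P) ^ (1 / 2 : ℝ) := fun F => by
    rw [eLpNorm_eq_lintegral_rpow_enorm_toReal (by norm_num) (by norm_num)]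
    simp only [ENNReal.toReal_ofNat, ENNReal.rpow_ofNat]
    congr 1
    rw [← lintegral_tsum fun k : {k // k ∉ F} => (hd k).enorm.pow_const 2]
    refine lintegral_congr_ae ?_
    filter_upwards [hΦ] with ω hω
    simp only [← hω]
    exact enorm_sub_sum_sq _ F
  simp only [h1]
  have h2 := (ENNReal.tendsto_tsum_compl_atTop_zero hsum)
  have h3 := (ENNReal.continuous_rpow_const (y := 1 / 2)).tendsto 0
  rw [ENNReal.zero_rpow_of_pos (by norm_num)] at h3
  exact h3.comp h2

theorem ae_summable_of_tsum_ne_top {d : ModeIndex → Ω → ℂ} (hd : ∀ k, AEMeasurable (d k) P)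
    (hsum : ∑' k, ∫⁻ ω, ‖d k ω‖ₑ ^ 2 ∂P ≠ ∞) : ∀ᵐ ω ∂P, Summable fun k => ‖d k ω‖ ^ 2 := by
  rw [← lintegral_tsum fun k => ((hd k).enorm.pow_const 2)] at hsum
  filter_upwards [ae_lt_top' (AEMeasurable.tsum fun k => (hd k).enorm.pow_const 2) hsum] with ω h
  have := ENNReal.summable_toReal h.ne
  refine this.congr fun k => ?_
  simp

/-- Where the coefficients are square summable the sum is a limit along one sequence of finite sets;
elsewhere it is 0 by convention. The measurable space is arbitrary, so the result also applies to
the σ-algebra of the past. -/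
theorem measurable_tsum_smul_e {T : Type*} [MeasurableSpace T] {d : ModeIndex → T → ℂ}
    (hd : ∀ k, Measurable (d k)) : Measurable fun p => ∑' k, d k p • e k := by
  classical
  obtain ⟨F, hF⟩ := exists_seq_tendsto (atTop : Filter (Finset ModeIndex))
  set G : Set T := {p | ∑' k, ‖d k p‖ₑ ^ 2 < ∞} with hG
  have hGm : MeasurableSet G :=
    measurableSet_lt (Measurable.tsum fun k => (hd k).enorm.pow_const 2) measurable_const
  have hs : ∀ p, p ∈ G → Summable fun k => d k p • e k := fun p hp => by
    refine (inner_e_tsum ((ENNReal.summable_toReal (mem_ofPred_eq ▸ hp : _ < ∞).ne).congr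
      fun k => ?_)).1
    simp
  -- Conversely, a summable family has square summable coefficients by Parseval, so off G the family
  -- cannot be summable.
  have hn : ∀ p, p ∉ G → ∑' k, d k p • e k = 0 := fun p hp => by
    refine tsum_eq_zero_of_not_summable fun h => hp ?_
    set f := ∑' k, d k p • e k with hf
    have hk : ∀ k, ⟪e k, f⟫ = d k p := fun k => by
      have h' := h.hasSum.mapL (innerSL ℂ (e k))
      simp only [innerSL_apply_apply, inner_v_smul_right] at h'
      rw [hf, ← h'.tsum_eq, tsum_eq_single k fun l hl => by
        rw [orthonormal_e.2 hl.symm, mul_zero], inner_v_self, orthonormal_e.1]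
      simp
    rw [hG, mem_ofPred_eq]
    simp only [← hk]
    rw [← enorm_sq_eq_tsum]
    exact ENNReal.pow_lt_top enorm_lt_top
  refine measurable_of_tendsto_metrizable (f := fun n p => G.indicator
    (fun p => ∑ k ∈ F n, d k p • e k) p) (fun n => ?_) ?_
  · refine Measurable.indicator (Finset.measurable_fun_sum _ fun k _ => ?_) hGm
    exact (hd k).smul_const _
  · refine tendsto_pi_nhds.2 fun p => ?_
    by_cases hp : p ∈ G
    · simp only [indicator_of_mem hp]
      exact (hs p hp).hasSum.comp hF
    · simp only [indicator_of_notMem hp, hn p hp]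
      exact tendsto_const_nhds

/-- A series of random variables has the same sum in `L²` and almost surely. -/
theorem coeFn_tsum_ae_eq {x : ModeIndex → Lp ℂ 2 P} (hx : Summable x) {y : ModeIndex → Ω → ℂ}
    (hxy : ∀ k, x k =ᵐ[P] y k) {f : Ω → ℂ} (hf : ∀ᵐ ω ∂P, HasSum (fun k => y k ω) (f ω)) :
    (∑' k, x k : Lp ℂ 2 P) =ᵐ[P] f := by
  obtain ⟨F, hF⟩ := exists_seq_tendsto (atTop : Filter (Finset ModeIndex))
  have h1 : Tendsto (fun n => ∑ k ∈ F n, x k) atTop (𝓝 (∑' k, x k)) := hx.hasSum.comp hF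
  obtain ⟨ns, hns, h2⟩ := (tendstoInMeasure_of_tendsto_Lp h1).exists_seq_tendsto_ae
  have h3 : ∀ n, (∑ k ∈ F n, x k : Lp ℂ 2 P) =ᵐ[P] fun ω => ∑ k ∈ F n, y k ω := fun n => by
    filter_upwards [Lp.coeFn_finsetSum (F n) x, ae_all_iff.2 hxy] with ω h4 h5
    rw [h4, Finset.sum_apply]
    exact Finset.sum_congr rfl fun k _ => h5 k
  filter_upwards [h2, ae_all_iff.2 h3, hf] with ω h4 h5 h6
  refine tendsto_nhds_unique h4 ?_
  simp only [h5]
  exact (h6.comp hF).comp hns.tendsto_atTop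

end RandomSeries

end FracField

namespace FracField

/-! ### The stationary solution: characteristic functions, stationarity, adaptedness. -/

section

variable {Ω : Type*} [MeasurableSpace Ω] {P : Measure Ω} {H : ℝ}
  {β β' : ModeIndex → ℝ → Ω → ℂ}

local notation "⟪" x ", " y "⟫" => inner ℂ x y

/-- The pathwise stationary Ornstein–Uhlenbeck coordinates. -/
noncomputable def ouPath (κ : ModeIndex → ℝ) (β' : ModeIndex → ℝ → Ω → ℂ) (k : ModeIndex) (t : ℝ)
    (ω : Ω) : ℂ := pathOU (κ k) (fun u => β' k u ω) t

/-- The stationary solution with diagonal noise coefficients `a`. -/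
noncomputable def solution (κ a : ModeIndex → ℝ) (β' : ModeIndex → ℝ → Ω → ℂ) (t : ℝ) (ω : Ω) : V :=
  ∑' k, ((a k : ℂ) * ouPath κ β' k t ω) • e k

variable {κ a : ModeIndex → ℝ}

theorem lintegral_enorm_sq (U : Lp ℂ 2 P) : ∫⁻ ω, ‖U ω‖ₑ ^ 2 ∂P = ENNReal.ofReal (‖U‖ ^ 2) := by
  rw [ENNReal.ofReal_pow (norm_nonneg _), ofReal_norm, Lp.enorm_def,
    eLpNorm_eq_lintegral_rpow_enorm_toReal (by norm_num) (by norm_num), ← ENNReal.rpow_natCast,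
    ← ENNReal.rpow_mul]
  norm_num

theorem tsum_lintegral_ne_top {x : ModeIndex → Lp ℂ 2 P} (hx : Summable fun k => ‖x k‖ ^ 2)
    {d : ModeIndex → Ω → ℂ} (hd : ∀ k, x k =ᵐ[P] d k) : ∑' k, ∫⁻ ω, ‖d k ω‖ₑ ^ 2 ∂P ≠ ∞ := by
  have h : ∀ k, ∫⁻ ω, ‖d k ω‖ₑ ^ 2 ∂P = ENNReal.ofReal (‖x k‖ ^ 2) := fun k => by
    rw [← lintegral_enorm_sq]
    refine lintegral_congr_ae ?_
    filter_upwards [hd k] with ω h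
    rw [h]
  simp only [h]
  rw [← ENNReal.ofReal_tsum_of_nonneg (fun _ => by positivity) hx]
  exact ENNReal.ofReal_ne_top

theorem IsRegularVersion.measurable_ouPath (hr : IsRegularVersion P β β') (k : ModeIndex) :
    Measurable fun p : ℝ × Ω => ouPath κ β' k p.1 p.2 := hr.measurable_pathOU k (κ k)

theorem IsRegularVersion.measurable_ouPath_apply (hr : IsRegularVersion P β β') (k : ModeIndex)
    (t : ℝ) : Measurable (ouPath κ β' k t) :=
  (hr.measurable_ouPath k).comp measurable_prodMk_left

theorem IsRegularVersion.measurable_solution (hr : IsRegularVersion P β β') :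
    Measurable fun p : ℝ × Ω => solution κ a β' p.1 p.2 :=
  measurable_tsum_smul_e fun k => (hr.measurable_ouPath k).const_mul _

theorem IsRegularVersion.measurable_solution_apply (hr : IsRegularVersion P β β') (t : ℝ) :
    Measurable (solution κ a β' t) :=
  measurable_tsum_smul_e fun k => (hr.measurable_ouPath_apply k t).const_mul _

variable [IsProbabilityMeasure P] (hr : IsRegularVersion P β β') (hβ : IsFBMFamily H β P)
  (hH : H ∈ Ioo (0 : ℝ) 1) (hκ : ∀ k, 0 < κ k) (ha : Admissible H κ fun k => (a k : ℂ))

include hr hβ hH hκ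

theorem IsRegularVersion.ou_ae_eq (k : ModeIndex) (t : ℝ) :
    hβ.ou κ k t =ᵐ[P] ouPath κ β' k t := hr.pathOU_ae_eq hβ hH.1 k (hκ k) t

theorem IsRegularVersion.smul_ou_ae_eq (c : ModeIndex → ℂ) (k : ModeIndex) (t : ℝ) :
    (c k • hβ.ou κ k t : Lp ℂ 2 P) =ᵐ[P] fun ω => c k * ouPath κ β' k t ω := by
  filter_upwards [hr.ou_ae_eq hβ hH hκ k t, Lp.coeFn_smul (c k) (hβ.ou κ k t)] with ω h1 h2
  rw [h2, Pi.smul_apply, h1, smul_eq_mul]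

theorem IsRegularVersion.tsum_lintegral_ne_top {w : ModeIndex → ℂ} (hw : Admissible H κ w) (t : ℝ) :
    ∑' k, ∫⁻ ω, ‖w k * ouPath κ β' k t ω‖ₑ ^ 2 ∂P ≠ ∞ :=
  FracField.tsum_lintegral_ne_top (hβ.summable_norm_series hH hκ hw t)
    fun k => hr.smul_ou_ae_eq hβ hH hκ w k t

include ha

theorem IsRegularVersion.inner_e_solution (t : ℝ) :
    ∀ᵐ ω ∂P, ∀ k, ⟪e k, solution κ a β' t ω⟫ = (a k : ℂ) * ouPath κ β' k t ω := by
  filter_upwards [ae_summable_of_tsum_ne_top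
    (fun k => ((hr.measurable_ouPath_apply k t).const_mul (a k : ℂ)).aemeasurable)
    (hr.tsum_lintegral_ne_top hβ hH hκ ha t)] with ω hω
  exact (inner_e_tsum hω).2

theorem IsRegularVersion.tendsto_solution (t : ℝ) :
    Tendsto (fun F : Finset ModeIndex => eLpNorm (fun ω => solution κ a β' t ω -
      ∑ k ∈ F, ((a k : ℂ) * ouPath κ β' k t ω) • e k) 2 P) atTop (𝓝 0) :=
  tendsto_eLpNorm_sub_sum
    (fun k => ((hr.measurable_ouPath_apply k t).const_mul (a k : ℂ)).aemeasurable)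
    (hr.tsum_lintegral_ne_top hβ hH hκ ha t) (hr.inner_e_solution hβ hH hκ ha t)

/-- The scalar projections of the solution. -/
theorem IsRegularVersion.inner_solution_ae_eq {v : V}
    (hw : Admissible H κ fun k => ⟪v, e k⟫ * a k) (t : ℝ) :
    (hβ.series κ (fun k => ⟪v, e k⟫ * a k) t : Lp ℂ 2 P) =ᵐ[P]
      fun ω => ⟪v, solution κ a β' t ω⟫ := by
  refine coeFn_tsum_ae_eq (hβ.summable_series hH hκ hw t)
    (fun k => hr.smul_ou_ae_eq hβ hH hκ (fun k => ⟪v, e k⟫ * a k) k t) ?_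
  filter_upwards [hr.inner_e_solution hβ hH hκ ha t] with ω hω
  refine (hasSum_inner_e v _).congr_fun fun k => ?_
  rw [hω]
  ring

omit hr hβ hH [IsProbabilityMeasure P] in
theorem Admissible.inner_mul (v : V) : Admissible H κ fun k => ⟪v, e k⟫ * a k := by
  refine Admissible.of_le hκ (ha.mul_left (‖v‖ ^ 2)) fun k => ?_
  have h := norm_inner_le_norm (𝕜 := ℂ) v (e k)
  rw [orthonormal_e.1, mul_one] at h
  rw [norm_mul, mul_pow, mul_assoc]
  have := Real.rpow_nonneg (hκ k).le (-(2 * H))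
  gcongr

/-- Joint characteristic functions of the solution. -/
theorem IsRegularVersion.integral_prod_chi_solution {n : ℕ} (v : Fin n → V) (t : Fin n → ℝ) :
    ∫ ω, ∏ i, chi (v i) (solution κ a β' (t i) ω) ∂P =
      Real.exp (-(‖reL P (∑ i, hβ.series κ (fun k => ⟪v i, e k⟫ * a k) (t i))‖ ^ 2 / 2)) := by
  rw [← hβ.integral_exp_re (Submodule.sum_mem _ fun i _ => hβ.series_mem _ _)]
  refine integral_congr_ae ?_
  filter_upwards [Lp.coeFn_finsetSum Finset.univ
      (fun i => hβ.series κ (fun k => ⟪v i, e k⟫ * a k) (t i)),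
    ae_all_iff.2 fun i => hr.inner_solution_ae_eq hβ hH hκ ha (ha.inner_mul hκ (v i)) (t i)]
    with ω h1 h2
  rw [h1, Finset.sum_apply, Complex.re_sum, Complex.ofReal_sum, Finset.sum_mul, Complex.exp_sum]
  refine Finset.prod_congr rfl fun i _ => ?_
  rw [h2]
  rfl

/-- The joint characteristic function is the exponential of minus half a variance, and that variance
does not change under a common time shift. -/
theorem IsRegularVersion.isStrictlyStationary (hκs : ∀ k, κ (-k) = κ k) :
    IsStrictlyStationary P fun t : ℝ≥0 => solution κ a β' t := by
  intro n t r
  have hm : ∀ t : Fin n → ℝ≥0, Measurable fun ω i => solution κ a β' (t i) ω := fun t =>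
    measurable_pi_lambda _ fun i => hr.measurable_solution_apply _
  have hp : ∀ t : Fin n → ℝ≥0,
      IsProbabilityMeasure (fdd P (fun t : ℝ≥0 => solution κ a β' t) t) := fun t =>
    Measure.isProbabilityMeasure_map (hm t).aemeasurable
  have h1 := hp t
  have h2 := hp fun i => t i + r
  refine measure_pi_ext_of_chi fun v => ?_
  have hc : Measurable fun x : Fin n → V => ∏ i, chi (v i) (x i) :=
    Finset.measurable_fun_prod _ fun i _ =>
      (continuous_chi (v i)).measurable.comp (measurable_pi_apply i)
  rw [fdd, fdd, integral_map (hm _).aemeasurable hc.aestronglyMeasurable,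
    integral_map (hm _).aemeasurable hc.aestronglyMeasurable,
    hr.integral_prod_chi_solution hβ hH hκ ha, hr.integral_prod_chi_solution hβ hH hκ ha]
  simp only [NNReal.coe_add]
  rw [hβ.norm_reL_sum_series_add hH hκ hκs fun i => ha.inner_mul hκ (v i)]

omit ha in
-- The L² functions measurable with respect to the past form a closed subspace that contains the
-- noise up to time t, hence also the coordinates at time t.
theorem IsRegularVersion.isAdaptedTo :
    IsAdaptedTo β P fun t : ℝ≥0 => solution κ a β' t := by
  intro t
  have hle : natFiltration β t ≤ (inferInstance : MeasurableSpace Ω) :=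
    iSup_le fun k => iSup_le fun s => ((hβ.fbm k).measurable s).comap_le
  have hvec : ∀ k, ∀ u ≤ (t : ℝ), hβ.vec k u ∈ lpMeas ℂ ℂ (natFiltration β t) 2 P :=
    fun k u hu => by
      rw [mem_lpMeas_iff_aestronglyMeasurable]
      have hm : Measurable[natFiltration β t] (β k u) := by
        refine (comap_measurable (β k u)).mono ?_ le_rfl
        exact le_iSup_of_le k (le_iSup_of_le ⟨u, hu⟩ le_rfl)
      exact (hm.stronglyMeasurable.aestronglyMeasurable).congr (hβ.coeFn_vec k u).symm
  have hcl : IsClosed (lpMeas ℂ ℂ (natFiltration β t) 2 P : Set (Lp ℂ 2 P)) :=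
    isClosed_aestronglyMeasurable hle
  have hou : ∀ k, AEStronglyMeasurable[natFiltration β t] (ouPath κ β' k t) P := fun k => by
    have h1 : hβ.ou κ k t ∈ lpMeas ℂ ℂ (natFiltration β t) 2 P := ouVec_mem hcl (hvec k) _
    exact (mem_lpMeas_iff_aestronglyMeasurable.1 h1).congr (hr.ou_ae_eq hβ hH hκ k t)
  -- Each coordinate is replaced by a version that is strictly measurable for the past; summing
  -- these gives a measurable version of the solution.
  choose g hg hge using hou
  have hm : Measurable[natFiltration β t] fun ω => ∑' k, ((a k : ℂ) * g k ω) • e k :=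
    @measurable_tsum_smul_e Ω (natFiltration β t) (fun k ω => (a k : ℂ) * g k ω)
      fun k => (hg k).measurable.const_mul (a k : ℂ)
  refine ⟨_, hm.stronglyMeasurable, ?_⟩
  filter_upwards [ae_all_iff.2 hge] with ω hω
  simp only [solution, hω]

end

end FracField

namespace FracField

/-! ### The mild equation and uniqueness in law. -/

section

local notation "⟪" x ", " y "⟫" => inner ℂ x y

variable {Ω : Type*} [MeasurableSpace Ω] {P : Measure Ω} [IsProbabilityMeasure P] {H ν : ℝ}
  {β β' : ModeIndex → ℝ → Ω → ℂ} {α lam : ModeIndex → ℝ}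

theorem norm_exp_mul_I_sub_le (a b : ℝ) :
    ‖Complex.exp (a * Complex.I) - Complex.exp (b * Complex.I)‖ ≤ |a - b| := by
  have e : Complex.exp (a * Complex.I) - Complex.exp (b * Complex.I) =
      Complex.exp (b * Complex.I) * (Complex.exp (Complex.I * (a - b : ℝ)) - 1) := by
    rw [mul_sub, ← Complex.exp_add, mul_one]
    congr 2
    push_cast
    ring
  rw [e, norm_mul, Complex.norm_exp_ofReal_mul_I, one_mul]
  exact Real.norm_exp_I_mul_ofReal_sub_one_le

theorem lintegral_enorm_le_ofReal_norm (U : Lp ℂ 2 P) :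
    ∫⁻ ω, ‖U ω‖ₑ ∂P ≤ ENNReal.ofReal ‖U‖ := by
  rw [ofReal_norm, Lp.enorm_def, ← eLpNorm_one_eq_lintegral_enorm]
  exact eLpNorm_le_eLpNorm_of_exponent_le one_le_two (Lp.aestronglyMeasurable _)

/-- The decay rates. -/
def rate (ν : ℝ) (α : ModeIndex → ℝ) (k : ModeIndex) : ℝ := ν * α k

/-- The noise coefficients. -/
noncomputable def coeff (H ν : ℝ) (lam : ModeIndex → ℝ) (k : ModeIndex) : ℝ := √(lam k) * ν ^ H

section uniqueness

omit [IsProbabilityMeasure P] in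
theorem integral_prod_chi_fdd {φ : ℝ≥0 → Ω → V} (hφ : ∀ t, Measurable (φ t)) {n : ℕ}
    (t : Fin n → ℝ≥0) (v : Fin n → V) :
    ∫ x, ∏ i, chi (v i) (x i) ∂fdd P φ t = ∫ ω, ∏ i, chi (v i) (φ (t i) ω) ∂P := by
  have hm : Measurable fun ω i => φ (t i) ω := measurable_pi_lambda _ fun i => hφ _
  have hc : Measurable fun x : Fin n → V => ∏ i, chi (v i) (x i) :=
    Finset.measurable_fun_prod _ fun i _ =>
      (continuous_chi (v i)).measurable.comp (measurable_pi_apply i)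
  rw [fdd, integral_map hm.aemeasurable hc.aestronglyMeasurable]

theorem chi_eq_mul_sub {E : Type*} [NormedAddCommGroup E] [InnerProductSpace ℂ E] (v x y : E) : chi v x = chi v y * chi v (x - y) := by
  simp only [chi]
  rw [← Complex.exp_add, ← add_mul, ← Complex.ofReal_add, ← Complex.add_re, ← inner_add_right,
    add_sub_cancel]

/-- Stationary processes that attract each other have the same distribution. -/
theorem fdd_eq_of_tendsto {φ φ' : ℝ≥0 → Ω → V} (hφ : ∀ t, Measurable (φ t))
    (hφ' : ∀ t, Measurable (φ' t)) (hs : IsStrictlyStationary P φ)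
    (hs' : IsStrictlyStationary P φ')
    (h : ∀ t : ℝ≥0, ∀ᵐ ω ∂P, Tendsto (fun n : ℕ => φ' (t + n) ω - φ (t + n) ω) atTop (𝓝 0))
    {n : ℕ} (t : Fin n → ℝ≥0) : fdd P φ' t = fdd P φ t := by
  have hm : ∀ {φ : ℝ≥0 → Ω → V}, (∀ t, Measurable (φ t)) → IsProbabilityMeasure (fdd P φ t) :=
    fun hφ => Measure.isProbabilityMeasure_map
      (measurable_pi_lambda _ fun i => hφ _).aemeasurable
  have h1 := hm hφ
  have h2 := hm hφ'
  refine measure_pi_ext_of_chi fun v => ?_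
  rw [← sub_eq_zero]
  have hmc : ∀ {φ : ℝ≥0 → Ω → V}, (∀ t, Measurable (φ t)) → ∀ t : Fin n → ℝ≥0,
      Measurable fun ω => ∏ i, chi (v i) (φ (t i) ω) := fun hφ t =>
    Finset.measurable_fun_prod _ fun i _ => (continuous_chi (v i)).measurable.comp (hφ _)
  have hi : ∀ {φ : ℝ≥0 → Ω → V}, (∀ t, Measurable (φ t)) → ∀ t : Fin n → ℝ≥0,
      Integrable (fun ω => ∏ i, chi (v i) (φ (t i) ω)) P := fun hφ t =>
    Integrable.of_bound (hmc hφ t).aestronglyMeasurable 1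
      (ae_of_all _ fun ω => by simp [norm_prod, norm_chi])
  -- By stationarity the difference of the two characteristic functions can be evaluated at times
  -- shifted by any N; it is constant in N, while dominated convergence sends it to 0.
  have key : ∀ N : ℕ, ∫ x, ∏ i, chi (v i) (x i) ∂fdd P φ' t - ∫ x, ∏ i, chi (v i) (x i) ∂fdd P φ t =
      ∫ ω, (∏ i, chi (v i) (φ' (t i + N) ω) - ∏ i, chi (v i) (φ (t i + N) ω)) ∂P := fun N => by
    rw [← hs' n t N, ← hs n t N, integral_prod_chi_fdd hφ', integral_prod_chi_fdd hφ,
      integral_sub (hi hφ' _) (hi hφ _)]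
  have hlim : Tendsto (fun N : ℕ => ∫ ω, (∏ i, chi (v i) (φ' (t i + N) ω) -
      ∏ i, chi (v i) (φ (t i + N) ω)) ∂P) atTop (𝓝 (∫ _, 0 ∂P)) := by
    refine tendsto_integral_of_dominated_convergence (fun _ => 2)
      (fun N => ((hmc hφ' _).sub (hmc hφ _)).aestronglyMeasurable) (integrable_const _)
      (fun N => ae_of_all _ fun ω => ?_) ?_
    · refine (norm_sub_le _ _).trans ?_
      simp only [norm_prod, norm_chi, Finset.prod_const_one]
      norm_num
    · filter_upwards [ae_all_iff.2 fun i => h (t i)] with ω hω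
      rw [tendsto_zero_iff_norm_tendsto_zero]
      have e : ∀ N : ℕ, ‖∏ i, chi (v i) (φ' (t i + N) ω) - ∏ i, chi (v i) (φ (t i + N) ω)‖ =
          ‖∏ i, chi (v i) (φ' (t i + N) ω - φ (t i + N) ω) - 1‖ := fun N => by
        have e1 : ∏ i, chi (v i) (φ' (t i + N) ω) = (∏ i, chi (v i) (φ (t i + N) ω)) *
            ∏ i, chi (v i) (φ' (t i + N) ω - φ (t i + N) ω) := by
          rw [← Finset.prod_mul_distrib]
          exact Finset.prod_congr rfl fun i _ => chi_eq_mul_sub _ _ _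
        rw [e1, ← mul_sub_one, norm_mul, norm_prod]
        simp only [norm_chi, Finset.prod_const_one, one_mul]
      simp only [e]
      have h3 : Tendsto (fun N : ℕ => ∏ i, chi (v i) (φ' (t i + N) ω - φ (t i + N) ω)) atTop
          (𝓝 (∏ i, chi (v i) 0)) :=
        tendsto_finsetProd _ fun i _ => ((continuous_chi (v i)).tendsto 0).comp (hω i)
      have h4 : ∏ i, chi (v i) 0 = 1 := Finset.prod_eq_one fun i _ => by simp [chi]
      rw [h4] at h3
      have := (h3.sub_const 1).norm
      rwa [sub_self, norm_zero] at this
  rw [integral_zero] at hlim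
  exact tendsto_nhds_unique (tendsto_const_nhds.congr fun N => key N) hlim

end uniqueness

variable (hr : IsRegularVersion P β β') (hβ : IsFBMFamily H β P)
  (hH : H ∈ Ioo (0 : ℝ) 1) (hν : 0 < ν) (hα : ∀ k, 0 < α k)

include hr hν hα

omit [IsProbabilityMeasure P] in
theorem IsRegularVersion.rsIntegralIic_eq : ∀ᵐ ω ∂P, ∀ k t,
    rsIntegralIic (fun u => Real.exp (-((t - u) * ν * α k))) (fun u => β k u ω) t =
      ouPath (rate ν α) β' k t ω := by
  filter_upwards [hr.ae_eq] with ω hω k t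
  simp only [← hω, mul_assoc]
  exact rsIntegralIic_exp (κ := rate ν α k) (hr.cont k ω) (hr.growth k ω) (mul_pos hν (hα k)) t

omit [IsProbabilityMeasure P] in
theorem IsRegularVersion.rsIntegral_eq : ∀ᵐ ω ∂P, ∀ k, ∀ t : ℝ, 0 ≤ t →
    rsIntegral (fun u => Real.exp (-((t - u) * ν * α k))) (fun u => β k u ω) 0 t =
      ouPath (rate ν α) β' k t ω - Real.exp (-(t * ν * α k)) * ouPath (rate ν α) β' k 0 ω := by
  filter_upwards [hr.ae_eq] with ω hω k t ht
  simp only [← hω, mul_assoc]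
  have h := pathOU_eq_add_rsIntegral (κ := rate ν α k) (hr.cont k ω) (hr.growth k ω)
    (mul_pos hν (hα k)) ht
  rw [ouPath, h, ouPath, rate]
  ring

variable (ha : Admissible H (rate ν α) fun k => (coeff H ν lam k : ℂ))

include hβ hH ha

theorem IsRegularVersion.isFOUSeries : IsFOUSeries H ν α lam β P (solution (rate ν α) (coeff H ν lam) β') := by
  intro t
  refine (hr.tendsto_solution hβ hH (κ := rate ν α) (fun k => mul_pos hν (hα k)) ha t).congr fun F => ?_
  refine eLpNorm_congr_ae ?_
  filter_upwards [hr.rsIntegralIic_eq hν hα] with ω hω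
  simp only [hω]
  rfl

/-- The equation holds in every coordinate by `pathOU_eq_add_rsIntegral`. What remains is L²
convergence of the stochastic convolution, whose coordinates d_k are differences of two series with
admissible coefficients. -/
theorem IsRegularVersion.isMildSolution :
    IsMildSolution H ν α lam β P fun t : ℝ≥0 => solution (rate ν α) (coeff H ν lam) β' t := by
  have hκ : ∀ k, 0 < rate ν α k := fun k => mul_pos hν (hα k)
  refine ⟨hr.measurable_solution.comp (f := fun p : ℝ≥0 × Ω => ((p.1 : ℝ), p.2)) (by fun_prop),
    fun t => ?_⟩
  have h0 : ∀ k, 0 ≤ (t : ℝ) * ν * α k := fun k => by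
    rw [mul_assoc]; exact mul_nonneg t.2 (hκ k).le
  set w : ModeIndex → ℂ := fun k => (coeff H ν lam k : ℂ) * Real.exp (-(t * ν * α k)) with hw
  have hwa : Admissible H (rate ν α) w := by
    refine Admissible.of_le hκ ha fun k => ?_
    have := Real.rpow_nonneg (hκ k).le (-(2 * H))
    have h1 : ‖w k‖ ≤ ‖(coeff H ν lam k : ℂ)‖ := by
      rw [hw, norm_mul]
      refine mul_le_of_le_one_right (norm_nonneg _) ?_
      rw [Complex.norm_real, Real.norm_eq_abs, Real.abs_exp]
      exact Real.exp_le_one_iff.2 (by linarith [h0 k])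
    gcongr
  set d : ModeIndex → Ω → ℂ := fun k ω => (coeff H ν lam k : ℂ) *
    (ouPath (rate ν α) β' k t ω - Real.exp (-(t * ν * α k)) * ouPath (rate ν α) β' k 0 ω) with hd
  have hdm : ∀ k, Measurable (d k) := fun k =>
    ((hr.measurable_ouPath_apply k t).sub ((hr.measurable_ouPath_apply k 0).const_mul _)).const_mul _
  have hx : ∀ k, ((coeff H ν lam k : ℂ) • hβ.ou (rate ν α) k t - w k • hβ.ou (rate ν α) k 0 : Lp ℂ 2 P) =ᵐ[P]
      d k := fun k => by
    filter_upwards [Lp.coeFn_sub ((coeff H ν lam k : ℂ) • hβ.ou (rate ν α) k t) (w k • hβ.ou (rate ν α) k 0),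
      hr.smul_ou_ae_eq hβ hH hκ (fun k => (coeff H ν lam k : ℂ)) k t,
      hr.smul_ou_ae_eq hβ hH hκ w k 0] with ω h1 h2 h3
    rw [h1, Pi.sub_apply, h2, h3]
    simp only [hd, hw]
    ring
  have hfin := FracField.tsum_lintegral_ne_top (hβ.hasSum_norm_series_sub hH hκ ha hwa t 0).summable hx
  have hlim := tendsto_eLpNorm_sub_sum (P := P)
    (Φ := fun ω => solution (rate ν α) (coeff H ν lam) β' t ω - semigroup ν α t (solution (rate ν α) (coeff H ν lam) β' 0 ω))
    (fun k => (hdm k).aemeasurable) hfin (by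
      filter_upwards [hr.inner_e_solution hβ hH hκ ha t, hr.inner_e_solution hβ hH hκ ha 0]
        with ω h1 h2 k
      rw [inner_sub_right, inner_e_semigroup h0, h1, h2]
      simp only [hd]
      ring)
  refine hlim.congr fun F => eLpNorm_congr_ae ?_
  filter_upwards [hr.rsIntegral_eq hν hα] with ω hω
  congr 1
  exact Finset.sum_congr rfl fun k _ =>
    congrArg (fun z => ((coeff H ν lam k : ℂ) * z) • e k) (hω k t t.2).symm

/-- Two mild solutions share the same noise term, so their difference at time t is the difference of
the images under S(t) of the initial values, and it decays like e^{-tνc}. -/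
theorem IsRegularVersion.fdd_eq {c : ℝ} (hc : 0 < c) (hcα : ∀ k, c ≤ α k)
    (hαs : ∀ k, α (-k) = α k) {φ' : ℝ≥0 → Ω → V}
    (hmild : IsMildSolution H ν α lam β P φ') (hs : IsStrictlyStationary P φ') {n : ℕ}
    (t : Fin n → ℝ≥0) : fdd P φ' t = fdd P (fun t : ℝ≥0 => solution (rate ν α) (coeff H ν lam) β' t) t := by
  have hκ : ∀ k, 0 < rate ν α k := fun k => mul_pos hν (hα k)
  have hmild0 := hr.isMildSolution hβ hH hν hα ha
  have hm : ∀ {φ : ℝ≥0 → Ω → V}, IsMildSolution H ν α lam β P φ → ∀ t, Measurable (φ t) :=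
    fun h t => h.measurable.comp measurable_prodMk_left
  have hle : ∀ (t : ℝ≥0) k, (t : ℝ) * (ν * c) ≤ t * ν * α k := fun t k => by
    rw [← mul_assoc]
    exact mul_le_mul_of_nonneg_left (hcα k) (mul_nonneg t.2 hν.le)
  -- Both remainders tend to 0 in L² along the same partial sums, so the L² norm of their
  -- difference, which is independent of the finite set F, is 0.
  have hdiff : ∀ t : ℝ≥0, ∀ᵐ ω ∂P, φ' t ω - solution (rate ν α) (coeff H ν lam) β' t ω =
      semigroup ν α t (φ' 0 ω) - semigroup ν α t (solution (rate ν α) (coeff H ν lam) β' 0 ω) := fun t => by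
    have hS : Continuous (semigroup ν α t) := continuous_semigroup fun k =>
      (mul_nonneg t.2 (mul_pos hν hc).le).trans (hle t k)
    have hms : ∀ k, AEStronglyMeasurable (fun ω => ((√(lam k) * ν ^ H : ℝ) *
        rsIntegral (fun s => Real.exp (-((t - s) * ν * α k))) (fun s => β k s ω) 0 t) • e k) P :=
      fun k => by
        have h1 : Measurable fun ω => ((coeff H ν lam k : ℂ) *
            (ouPath (rate ν α) β' k t ω - Real.exp (-(t * ν * α k)) * ouPath (rate ν α) β' k 0 ω)) • e k :=
          (((hr.measurable_ouPath_apply k t).sub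
            ((hr.measurable_ouPath_apply k 0).const_mul _)).const_mul _).smul_const _
        refine h1.aestronglyMeasurable.congr ?_
        filter_upwards [hr.rsIntegral_eq hν hα] with ω hω
        exact congrArg (fun z => ((coeff H ν lam k : ℂ) * z) • e k) (hω k t t.2).symm
    have hmF : ∀ {φ : ℝ≥0 → Ω → V}, IsMildSolution H ν α lam β P φ → ∀ F : Finset ModeIndex,
        AEStronglyMeasurable (fun ω => φ t ω - semigroup ν α t (φ 0 ω) - ∑ k ∈ F,
          ((√(lam k) * ν ^ H : ℝ) * rsIntegral (fun s => Real.exp (-((t - s) * ν * α k)))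
            (fun s => β k s ω) 0 t) • e k) P := fun h F =>
      (((hm h t).sub (hS.measurable.comp (hm h 0))).aestronglyMeasurable).sub
        (Finset.aestronglyMeasurable_fun_sum _ fun k _ => hms k)
    set D : Ω → V := fun ω => (φ' t ω - semigroup ν α t (φ' 0 ω)) -
      (solution (rate ν α) (coeff H ν lam) β' t ω - semigroup ν α t (solution (rate ν α) (coeff H ν lam) β' 0 ω)) with hD
    have hDm : AEStronglyMeasurable D P :=
      (((hm hmild t).sub (hS.measurable.comp (hm hmild 0))).sub
        ((hm hmild0 t).sub (hS.measurable.comp (hm hmild0 0)))).aestronglyMeasurable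
    have h0 : eLpNorm D 2 P = 0 := by
      have hsum := (hmild.eq t).add (hmild0.eq t)
      rw [add_zero] at hsum
      refine le_antisymm (ge_of_tendsto' hsum fun F => ?_) zero_le
      refine le_trans (le_of_eq ?_) (eLpNorm_sub_le (hmF hmild F) (hmF hmild0 F) one_le_two)
      congr 1
      funext ω
      simp only [hD, Pi.sub_apply, NNReal.coe_zero]
      abel
    rw [eLpNorm_eq_zero_iff hDm (by norm_num)] at h0
    filter_upwards [h0] with ω hω
    have : D ω = 0 := hω
    simp only [hD] at this
    rw [sub_eq_zero] at this
    exact sub_eq_sub_iff_sub_eq_sub.1 this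
  refine fdd_eq_of_tendsto (hm hmild0) (hm hmild)
    (hr.isStrictlyStationary hβ hH hκ ha fun k => by rw [rate, rate, hαs]) hs (fun s => ?_) t
  filter_upwards [ae_all_iff.2 fun n : ℕ => hdiff (s + n)] with ω hω
  simp only [hω]
  have hcoe : ∀ n : ℕ, ((s + n : ℝ≥0) : ℝ) = s + n := fun n => by push_cast; rfl
  refine squeeze_zero_norm (a := fun n : ℕ => Real.exp (-((s + n : ℝ) * (ν * c))) *
    ‖φ' 0 ω - solution (rate ν α) (coeff H ν lam) β' 0 ω‖) (fun n => ?_) ?_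
  · rw [← hcoe]
    exact norm_semigroup_sub_le (mul_nonneg (NNReal.coe_nonneg _) (mul_pos hν hc).le)
      (hle (s + n)) _ _
  · have h := (Real.tendsto_exp_neg_atTop_nhds_zero.comp ((tendsto_atTop_add_const_left _ (s : ℝ)
      tendsto_natCast_atTop_atTop).atTop_mul_const (mul_pos hν hc))).mul_const
        ‖φ' 0 ω - solution (rate ν α) (coeff H ν lam) β' 0 ω‖
    rw [zero_mul] at h
    exact h

end

end FracField

namespace FracField

/-! ### Ergodicity of the stationary solution. -/

section ergodic

local notation "⟪" x ", " y "⟫" => inner ℂ x y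

variable {Ω : Type*} [MeasurableSpace Ω] {P : Measure Ω} [IsProbabilityMeasure P] {H κ₀ : ℝ}
  {β β' : ModeIndex → ℝ → Ω → ℂ} {κ a : ModeIndex → ℝ}

/-- Boundedness of the noise coefficients enters here: with Parseval for v it gives the square
summability behind the decay of correlations and mean continuity. -/
theorem summable_norm_inner_mul (v : V) {A : ℝ} (hA : ∀ k, |a k| ≤ A) :
    Summable fun k => ‖⟪v, e k⟫ * (a k : ℂ)‖ ^ 2 := by
  refine Summable.of_nonneg_of_le (fun k => sq_nonneg _) (fun k => ?_)
    ((hasSum_norm_sq v).summable.mul_right (A ^ 2))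
  have h1 : ‖⟪v, e k⟫‖ = ‖⟪e k, v⟫‖ := by
    rw [← inner_conj_symm, RCLike.norm_conj]
  rw [norm_mul, mul_pow, h1, Complex.norm_real, Real.norm_eq_abs]
  exact mul_le_mul_of_nonneg_left (pow_le_pow_left₀ (abs_nonneg _) (hA k) 2) (sq_nonneg _)

variable (hr : IsRegularVersion P β β') (hβ : IsFBMFamily H β P)
  (hH : H ∈ Ioo (0 : ℝ) 1) (hκ : ∀ k, 0 < κ k) (ha : Admissible H κ fun k => (a k : ℂ))

include hr hβ hH hκ ha

theorem IsRegularVersion.chi_solution_ae_eq (v : V) (t : ℝ) :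
    ∀ᵐ ω ∂P, chi v (solution κ a β' t ω) =
      Complex.exp ((hβ.series κ (fun k => ⟪v, e k⟫ * a k) t ω).re * Complex.I) := by
  filter_upwards [hr.inner_solution_ae_eq hβ hH hκ ha (ha.inner_mul hκ v) t] with ω hω
  rw [hω, chi]

theorem IsRegularVersion.meanContinuous_chi {A : ℝ} (hA : ∀ k, |a k| ≤ A) (v : V) :
    MeanContinuous P (fun t : ℝ≥0 => solution κ a β' t) (chi v) := by
  have hw := ha.inner_mul hκ v
  have hw2 := summable_norm_inner_mul v hA
  set w := fun k => ⟪v, e k⟫ * (a k : ℂ)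
  have hle : ∀ u : ℝ≥0, ∫⁻ ω, ‖chi v (solution κ a β' u ω) - chi v (solution κ a β' 0 ω)‖ₑ ∂P ≤
      ENNReal.ofReal (√((∑' k, ‖w k‖ ^ 2) * (2 * |(u : ℝ)| ^ H) ^ 2)) := fun u => by
    calc ∫⁻ ω, ‖chi v (solution κ a β' u ω) - chi v (solution κ a β' 0 ω)‖ₑ ∂P
        ≤ ∫⁻ ω, ‖(hβ.series κ w u - hβ.series κ w 0 : Lp ℂ 2 P) ω‖ₑ ∂P := by
          refine lintegral_mono_ae ?_
          filter_upwards [hr.chi_solution_ae_eq hβ hH hκ ha v u,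
            hr.chi_solution_ae_eq hβ hH hκ ha v 0,
            Lp.coeFn_sub (hβ.series κ w u) (hβ.series κ w 0)] with ω h1 h2 h3
          rw [h1, h2, h3, enorm_le_iff_norm_le]
          refine (norm_exp_mul_I_sub_le _ _).trans ?_
          rw [← Complex.sub_re]
          exact Complex.abs_re_le_norm _
      _ ≤ _ := (lintegral_enorm_le_ofReal_norm _).trans <| ENNReal.ofReal_le_ofReal <|
          Real.le_sqrt_of_sq_le <| by
            simpa using! hβ.norm_series_sub_le hH hκ hw hw2 u 0
  refine tendsto_of_tendsto_of_tendsto_of_le_of_le tendsto_const_nhds ?_ (fun _ => zero_le) hle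
  have hc : Continuous fun u : ℝ≥0 =>
      ENNReal.ofReal (√((∑' k, ‖w k‖ ^ 2) * (2 * |(u : ℝ)| ^ H) ^ 2)) := by
    have : Continuous fun u : ℝ≥0 => |(u : ℝ)| ^ H :=
      (continuous_abs.comp NNReal.continuous_coe).rpow_const fun _ => Or.inr hH.1.le
    exact ENNReal.continuous_ofReal.comp (by fun_prop)
  have := hc.tendsto 0
  simpa [Real.zero_rpow hH.1.ne'] using this

/-- The covariance of the characters is at most that of the Gaussian projections, which decays with
exponent η = 2 - 2H > 0. -/
theorem IsRegularVersion.averagesConverge_chi (hκs : ∀ k, κ (-k) = κ k) (h0 : 0 < κ₀)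
    (hκ0 : ∀ k, κ₀ ≤ κ k) {A : ℝ} (hA : ∀ k, |a k| ≤ A) (v : V) :
    AveragesConverge P (fun t : ℝ≥0 => solution κ a β' t) (chi v) := by
  have hw := ha.inner_mul hκ v
  have hw2 := summable_norm_inner_mul v hA
  set w := fun k => ⟪v, e k⟫ * (a k : ℂ) with hwd
  have hdn : 0 ≤ decayConst H κ₀ * ∑' k, ‖reSym w k‖ ^ 2 := by
    have := (abs_nonneg _).trans
      (hβ.abs_inner_series_le hH hκ hκs h0 hκ0 hw hw2 (s := 0) (t := 1) (by norm_num))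
    simpa using this
  have hst : ShiftInvariant P (fun t : ℝ≥0 => solution κ a β' t) :=
    hr.isStrictlyStationary hβ hH hκ ha hκs
  have hm : Measurable fun p : ℝ≥0 × Ω => solution κ a β' p.1 p.2 :=
    hr.measurable_solution.comp (f := fun p : ℝ≥0 × Ω => ((p.1 : ℝ), p.2)) (by fun_prop)
  have hI : ∀ t : ℝ≥0, ∫ ω, chi v (solution κ a β' t ω) ∂P =
      ∫ ω, Complex.exp ((hβ.series κ w t ω).re * Complex.I) ∂P := fun t =>
    integral_congr_ae (hr.chi_solution_ae_eq hβ hH hκ ha v t)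
  have hI0 : ∀ t : ℝ≥0, ∫ ω, chi v (solution κ a β' t ω) ∂P =
      ∫ ω, chi v (solution κ a β' (0 : ℝ≥0) ω) ∂P := fun t => by
    have h := hβ.norm_reL_sum_series_add hH hκ hκs (n := 1) (w := fun _ => w) (fun _ => hw)
      (fun _ => 0) t
    simp only [Finset.univ_unique, Finset.sum_singleton, zero_add] at h
    rw [hI, hI, hβ.integral_exp_re (hβ.series_mem _ _), hβ.integral_exp_re (hβ.series_mem _ _), h]
    rfl
  refine FracField.averagesConverge_chi hm hst (η := 2 - 2 * H) hdn (by linarith [hH.2])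
    fun s t hst => ?_
  have h1 := hβ.norm_covariance_exp_le (hβ.series_mem (κ := κ) w s) (hβ.series_mem (κ := κ) w t)
  rw [← hI, ← hI, hI0, hI0 t] at h1
  have h2 : ∫ ω, chi v (solution κ a β' s ω) * conj (chi v (solution κ a β' t ω)) ∂P =
      ∫ ω, Complex.exp ((hβ.series κ w s ω).re * Complex.I) *
        conj (Complex.exp ((hβ.series κ w t ω).re * Complex.I)) ∂P := by
    refine integral_congr_ae ?_
    filter_upwards [hr.chi_solution_ae_eq hβ hH hκ ha v s,
      hr.chi_solution_ae_eq hβ hH hκ ha v t] with ω h1 h2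
    rw [h1, h2]
  rw [← h2] at h1
  refine h1.trans ?_
  rw [neg_sub]
  rcases le_abs.1 hst with h | h
  · rw [abs_of_nonneg (a := (t : ℝ) - s) (by linarith)]
    exact hβ.abs_inner_series_le hH hκ hκs h0 hκ0 hw hw2 (by linarith)
  · rw [abs_sub_comm (t : ℝ), abs_of_nonneg (a := (s : ℝ) - t) (by linarith), real_inner_comm]
    exact hβ.abs_inner_series_le hH hκ hκs h0 hκ0 hw hw2 (by linarith)

theorem IsRegularVersion.isErgodic (hκs : ∀ k, κ (-k) = κ k) (h0 : 0 < κ₀)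
    (hκ0 : ∀ k, κ₀ ≤ κ k) {A : ℝ} (hA : ∀ k, |a k| ≤ A) :
    IsErgodic P fun t : ℝ≥0 => solution κ a β' t := by
  intro ρ hρ hi
  have hst : ShiftInvariant P (fun t : ℝ≥0 => solution κ a β' t) :=
    hr.isStrictlyStationary hβ hH hκ ha hκs
  have hm : Measurable fun p : ℝ≥0 × Ω => solution κ a β' p.1 p.2 :=
    hr.measurable_solution.comp (f := fun p : ℝ≥0 × Ω => ((p.1 : ℝ), p.2)) (by fun_prop)
  have hav := ergodic_theorem hm hst (hr.meanContinuous_chi hβ hH hκ ha hA)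
    (hr.averagesConverge_chi hβ hH hκ ha hκs h0 hκ0 hA)
    (ρ := fun x => (ρ x : ℂ)) (Complex.measurable_ofReal.comp hρ) hi.ofReal
  filter_upwards [hav, hst.ae_intervalIntegrable hm hρ hi] with ω h1 h2
  refine ⟨fun T _ => h2 0 T, ?_⟩
  have h3 := (Complex.continuous_re.tendsto _).comp h1
  rw [integral_complex_ofReal, Complex.ofReal_re] at h3
  refine h3.congr fun T => ?_
  simp only [Function.comp_apply]
  rw [intervalIntegral.integral_ofReal, ← Complex.ofReal_inv, ← Complex.ofReal_mul, Complex.ofReal_re]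

end ergodic

end FracField

namespace FracField

/-! ### Hölder continuous versions on the torus times the line -/

/-- The representative in `[0, 1)`. -/
noncomputable def torusRep (x : UnitAddCircle) : ℝ := AddCircle.equivIco 1 0 x

theorem coe_torusRep (x : UnitAddCircle) : (torusRep x : UnitAddCircle) = x := AddCircle.coe_equivIco

theorem torusRep_mem (x : UnitAddCircle) : torusRep x ∈ Ico (0 : ℝ) 1 := by
  have h := (AddCircle.equivIco 1 0 x).2
  exact ⟨h.1, h.2.trans_eq (zero_add 1)⟩

/-- Dyadic rounding. -/
noncomputable def dyadicFloor (n : ℕ) (x : ℝ) : ℝ := (⌊(2 : ℝ) ^ n * x⌋ : ℝ) / 2 ^ n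

/-- Dyadic rounding on the torus times the line. -/
noncomputable def dyadicPoint (n : ℕ) (p : Torus × ℝ) : Torus × ℝ :=
  (fun i => (dyadicFloor n (torusRep (p.1 i)) : UnitAddCircle), dyadicFloor n p.2)

theorem UnitAddCircle.dist_coe_le (a b : ℝ) : dist (a : UnitAddCircle) b ≤ |a - b| := by
  rw [dist_eq_norm, ← AddCircle.coe_sub, ← Real.norm_eq_abs]
  exact QuotientAddGroup.norm_mk_le_norm

theorem dist_dyadicPoint_le (n : ℕ) (p : Torus × ℝ) : dist (dyadicPoint n p) p ≤ (1 / 2) ^ n := by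
  rw [Prod.dist_eq]
  refine max_le ((dist_pi_le_iff (by positivity)).2 fun i => ?_) ?_
  · conv_lhs => rw [← coe_torusRep (p.1 i)]
    exact (UnitAddCircle.dist_coe_le _ _).trans
      (abs_floor_mul_div_sub_le n _)
  · rw [Real.dist_eq]
    exact abs_floor_mul_div_sub_le n _

/-- Two space dimensions and one time dimension give the exponent 3n. -/
theorem exists_finset_dyadicPoint (N n : ℕ) : ∃ s : Finset (Torus × ℝ),
    (∀ p ∈ (univ : Set Torus) ×ˢ Icc (-(N : ℝ)) N, dyadicPoint n p ∈ s) ∧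
      s.card ≤ (2 * N + 1) * 2 ^ (3 * n) := by
  classical
  set A : Finset UnitAddCircle := (Finset.Ico (0 : ℤ) (2 ^ n)).image fun j : ℤ =>
    (((j : ℝ) / 2 ^ n : ℝ) : UnitAddCircle)
  set B : Finset ℝ := (Finset.Icc (-(N * 2 ^ n : ℤ)) (N * 2 ^ n)).image fun j : ℤ =>
    (j : ℝ) / 2 ^ n
  have h2 : (0 : ℝ) < 2 ^ n := by positivity
  refine ⟨Fintype.piFinset (fun _ : Fin 2 => A) ×ˢ B, fun p hp => ?_, ?_⟩
  · rw [Finset.mem_product, Fintype.mem_piFinset]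
    refine ⟨fun i => Finset.mem_image.2 ⟨⌊(2 : ℝ) ^ n * torusRep (p.1 i)⌋, ?_, rfl⟩,
      Finset.mem_image.2 ⟨⌊(2 : ℝ) ^ n * p.2⌋, ?_, rfl⟩⟩
    · obtain ⟨h0, h1⟩ := torusRep_mem (p.1 i)
      rw [Finset.mem_Ico]
      refine ⟨Int.floor_nonneg.2 (by positivity), Int.floor_lt.2 ?_⟩
      push_cast
      nlinarith
    · obtain ⟨h0, h1⟩ := hp.2
      rw [Finset.mem_Icc]
      refine ⟨Int.le_floor.2 ?_, Int.floor_le_iff.2 ?_⟩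
      · push_cast
        nlinarith
      · push_cast
        nlinarith
  · have hA : A.card ≤ 2 ^ n := Finset.card_image_le.trans (by simp)
    have hB : B.card ≤ (2 * N + 1) * 2 ^ n := by
      refine Finset.card_image_le.trans ?_
      rw [Int.card_Icc]
      have : (1 : ℤ) ≤ 2 ^ n := one_le_pow₀ (by norm_num)
      rw [Int.toNat_le]
      push_cast
      linarith
    rw [Finset.card_product, Fintype.card_piFinset, Finset.prod_const, Finset.card_univ, Fintype.card_fin]
    calc A.card ^ 2 * B.card ≤ (2 ^ n) ^ 2 * ((2 * N + 1) * 2 ^ n) := by gcongr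
      _ = (2 * N + 1) * 2 ^ (3 * n) := by ring

variable {Ω : Type*} [MeasurableSpace Ω] {P : Measure Ω}

theorem exists_holder_version {Y : Torus × ℝ → Ω → ℝ} (hY : ∀ p, Measurable (Y p)) {θ : ℝ}
    (hθ : 0 < θ) (hmom : HasMomentBound P Y θ) : ∃ Z : Torus × ℝ → Ω → ℝ,
      (∀ p, Measurable (Z p)) ∧ (∀ p, Z p =ᵐ[P] Y p) ∧ (∀ ω, Continuous fun p => Z p ω) ∧
      ∀ᵐ ω ∂P, ∀ ε : ℝ≥0, 0 < ε → (ε : ℝ) < θ → ∀ T : ℝ, 0 < T →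
        ∃ C : ℝ≥0, HolderOnWith C ε (fun p => Z p ω) (univ ×ˢ Icc (-T) T) := by
  classical
  set L : Torus × ℝ → Ω → ℝ := fun p ω => limsup (fun n => Y (dyadicPoint n p) ω) atTop with hL
  have hLm : ∀ p, Measurable (L p) := fun p => Measurable.limsup fun n => hY _
  have hall : ∀ᵐ ω ∂P, ∀ N : ℕ,
      (∀ p ∈ (univ : Set Torus) ×ˢ Icc (-(N : ℝ)) N,
        ∃ l, Tendsto (fun n => Y (dyadicPoint n p) ω) atTop (𝓝 l)) ∧
      ∀ ε : ℝ≥0, 0 < ε → (ε : ℝ) < θ → ∃ C : ℝ≥0,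
        HolderOnWith C ε (fun p => L p ω) ((univ : Set Torus) ×ˢ Icc (-(N : ℝ)) N) :=
    ae_all_iff.2 fun N => ae_holder_of_momentBound hY hθ hmom dist_dyadicPoint_le
      (exists_finset_dyadicPoint N)
  have hLY : ∀ p, L p =ᵐ[P] Y p := fun p => by
    refine ae_eq_limsup_of_momentBound hY hθ hmom dist_dyadicPoint_le ?_
    obtain ⟨N, hN⟩ := exists_nat_ge |p.2|
    filter_upwards [hall] with ω hω
    exact (hω N).1 p ⟨mem_univ _, abs_le.1 hN⟩
  have hcont : ∀ᵐ ω ∂P, Continuous fun p => L p ω := by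
    filter_upwards [hall] with ω hω
    rw [continuous_iff_continuousAt]
    intro p
    obtain ⟨N, hN⟩ := exists_nat_gt |p.2|
    have hpos : 0 < (θ / 2).toNNReal := Real.toNNReal_pos.2 (half_pos hθ)
    obtain ⟨C, hC⟩ := (hω N).2 (θ / 2).toNNReal hpos
      (by rw [Real.coe_toNNReal _ (half_pos hθ).le]; exact half_lt_self hθ)
    refine (hC.uniformContinuousOn hpos).continuousOn.continuousAt ?_
    exact prod_mem_nhds univ_mem (Icc_mem_nhds (abs_lt.1 hN).1 (abs_lt.1 hN).2)
  rw [ae_iff] at hcont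
  -- On a measurable null set the limit is replaced by 0, so that every path is continuous. This
  -- later gives joint measurability in (x, ω) and integrability over the torus.
  set S := toMeasurable P {ω | ¬ Continuous fun p => L p ω} with hS
  have hS0 : ∀ᵐ ω ∂P, ω ∉ S := measure_eq_zero_iff_ae_notMem.1 (by rw [hS, measure_toMeasurable, hcont])
  refine ⟨fun p ω => if ω ∈ S then 0 else L p ω, fun p =>
    Measurable.ite (measurableSet_toMeasurable _ _) measurable_const (hLm p), fun p => ?_,
    fun ω => ?_, ?_⟩
  · filter_upwards [hS0, hLY p] with ω h1 h2
    rw [if_neg h1, h2]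
  · by_cases hω : ω ∈ S
    · simp only [hω, if_true]
      exact continuous_const
    · simp only [hω, if_false]
      by_contra hc
      exact hω (subset_toMeasurable _ _ hc)
  · filter_upwards [hS0, hall] with ω h1 h2 ε hε hεθ T hT
    obtain ⟨N, hN⟩ := exists_nat_ge T
    obtain ⟨C, hC⟩ := (h2 N).2 ε hε hεθ
    simp only [h1, if_false]
    exact ⟨C, hC.mono (prod_mono_right (Icc_subset_Icc (neg_le_neg hN) hN))⟩

end FracField

namespace FracField

/-! ### Increments of the random field -/

theorem norm_fourier_sub_le (n : ℤ) (x y : UnitAddCircle) :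
    ‖fourier n x - fourier n y‖ ≤ 2 * Real.pi * |(n : ℝ)| * dist x y := by
  obtain ⟨r, hr⟩ := QuotientAddGroup.mk_surjective (x - y)
  -- The representative r - round r realizes the distance on the circle.
  have hr' : ((r - round r : ℝ) : UnitAddCircle) = x - y := by
    rw [← hr, AddCircle.coe_sub]
    have : ((round r : ℝ) : UnitAddCircle) = 0 := by
      rw [AddCircle.coe_eq_zero_iff]
      exact ⟨round r, by simp⟩
    rw [this, sub_zero]
  have hd : dist x y = |r - round r| := by
    rw [dist_eq_norm, ← hr]
    exact UnitAddCircle.norm_eq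
  have hx : fourier n x = fourier n y * fourier n (x - y) := by
    simp only [fourier_apply]
    rw [← Circle.coe_mul, ← AddCircle.toCircle_add, ← smul_add, add_sub_cancel]
  have h1 : fourier n (x - y) = Complex.exp (Complex.I * (2 * Real.pi * n * (r - round r) : ℝ)) := by
    rw [← hr', fourier_coe_apply]
    congr 1
    push_cast
    ring
  have h2 : ‖fourier n y‖ = 1 := by rw [fourier_apply]; exact Circle.norm_coe _
  rw [hx, ← mul_sub_one, norm_mul, h2, one_mul, h1]
  refine Real.norm_exp_I_mul_ofReal_sub_one_le.trans (le_of_eq ?_)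
  rw [hd, Real.norm_eq_abs, abs_mul, abs_mul, abs_of_pos Real.two_pi_pos]

theorem norm_mFourier_apply (n : Fin 2 → ℤ) (x : Torus) : ‖mFourier n x‖ = 1 := by
  change ‖∏ i, fourier (n i) (x i)‖ = 1
  rw [norm_prod]
  refine Finset.prod_eq_one fun i _ => ?_
  rw [fourier_apply]
  exact Circle.norm_coe _

theorem two_pi_abs_le_norm_waveVector (k : ModeIndex) (i : Fin 2) :
    2 * Real.pi * |(k.1 i : ℝ)| ≤ ‖waveVector k‖ := by
  have h := PiLp.norm_apply_le (waveVector k) i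
  refine le_trans (le_of_eq ?_) h
  rw [waveVector, Real.norm_eq_abs]
  change _ = |2 * Real.pi * (k.1 i : ℝ)|
  rw [abs_mul, abs_of_pos Real.two_pi_pos]

theorem one_le_norm_waveVector (k : ModeIndex) : 1 ≤ ‖waveVector k‖ := by
  obtain ⟨i, hi⟩ := Function.ne_iff.1 k.2
  refine le_trans ?_ (two_pi_abs_le_norm_waveVector k i)
  have h1 : (1 : ℝ) ≤ |(k.1 i : ℝ)| := by
    rw [← Int.cast_abs]
    exact_mod_cast Int.one_le_abs hi
  have := Real.two_le_pi
  nlinarith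

theorem norm_mFourier_sub_le (k : ModeIndex) (x y : Torus) :
    ‖mFourier k.1 x - mFourier k.1 y‖ ≤ 2 * ‖waveVector k‖ * dist x y := by
  change ‖∏ i, fourier (k.1 i) (x i) - ∏ i, fourier (k.1 i) (y i)‖ ≤ _
  rw [Fin.prod_univ_two, Fin.prod_univ_two]
  have hn : ∀ (n : ℤ) (z : UnitAddCircle), ‖fourier n z‖ = 1 := fun n z => by
    rw [fourier_apply]; exact Circle.norm_coe _
  have hi : ∀ i, ‖fourier (k.1 i) (x i) - fourier (k.1 i) (y i)‖ ≤ ‖waveVector k‖ * dist x y :=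
    fun i => (norm_fourier_sub_le _ _ _).trans
      (mul_le_mul (two_pi_abs_le_norm_waveVector k i) (dist_le_pi_dist x y i) dist_nonneg
        (norm_nonneg _))
  have e : fourier (k.1 0) (x 0) * fourier (k.1 1) (x 1) - fourier (k.1 0) (y 0) * fourier (k.1 1) (y 1) =
      (fourier (k.1 0) (x 0) - fourier (k.1 0) (y 0)) * fourier (k.1 1) (x 1) +
        fourier (k.1 0) (y 0) * (fourier (k.1 1) (x 1) - fourier (k.1 1) (y 1)) := by ring
  rw [e]
  refine (norm_add_le _ _).trans ?_
  rw [norm_mul, norm_mul, hn, hn, mul_one, one_mul]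
  linarith [hi 0, hi 1]

theorem le_rpow_of_le_one_of_le {x y θ : ℝ} (hθ : 0 ≤ θ) (hθ1 : θ ≤ 1) (hx : x ≤ 1) (hxy : x ≤ y)
    (hy : 0 ≤ y) : x ≤ y ^ θ := by
  rcases le_or_gt y 1 with h | h
  · exact hxy.trans (Real.self_le_rpow_of_le_one hy h hθ1)
  · exact hx.trans (Real.one_le_rpow h.le hθ)

theorem norm_mFourier_sub_le_rpow (k : ModeIndex) (x y : Torus) {θ : ℝ} (hθ : 0 ≤ θ) (hθ1 : θ ≤ 1) :
    ‖mFourier k.1 x - mFourier k.1 y‖ ≤ 2 * (‖waveVector k‖ ^ θ * dist x y ^ θ) := by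
  rw [← Real.mul_rpow (norm_nonneg _) dist_nonneg]
  have h1 : ‖mFourier k.1 x - mFourier k.1 y‖ ≤ 2 := by
    refine (norm_sub_le _ _).trans ?_
    rw [norm_mFourier_apply, norm_mFourier_apply]
    norm_num
  have h2 := norm_mFourier_sub_le k x y
  have := le_rpow_of_le_one_of_le (x := ‖mFourier k.1 x - mFourier k.1 y‖ / 2)
    (y := ‖waveVector k‖ * dist x y) hθ hθ1 (by linarith) (by linarith) (by positivity)
  linarith

variable {Ω : Type*} [MeasurableSpace Ω] {P : Measure Ω} [IsProbabilityMeasure P] {H : ℝ}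
  {β : ModeIndex → ℝ → Ω → ℂ} {κ : ModeIndex → ℝ} (hβ : IsFBMFamily H β P)
  (hH : H ∈ Ioo (0 : ℝ) 1) (hκ : ∀ k, 0 < κ k)

section
include hH hκ

omit [IsProbabilityMeasure P] in
-- Interpolation between the increment bound 2|s-t|^H and the size bound of order κ^{-H}. The former
-- is used when κ|s-t| ≤ 1 and the latter otherwise.
theorem IsFBMFamily.norm_ou_sub_le {θ : ℝ} (hθ : 0 ≤ θ) (hθH : θ ≤ H) (k : ModeIndex) (s t : ℝ) :
    ‖hβ.ou κ k s - hβ.ou κ k t‖ ≤ 2 * (1 + Real.Gamma (H + 1)) * (κ k ^ (θ - H) * |s - t| ^ θ) := by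
  have hG : 0 < Real.Gamma (H + 1) := Real.Gamma_pos_of_pos (by linarith [hH.1])
  have hk := hκ k
  have hp : 0 ≤ κ k ^ (θ - H) * |s - t| ^ θ := by positivity
  rcases le_or_gt (κ k * |s - t|) 1 with h | h
  · have h1 : ‖hβ.ou κ k s - hβ.ou κ k t‖ ≤ 2 * |s - t| ^ H :=
      (hβ.isFBMCurve k).norm_ouVec_sub_le hH.1 hk t s
    have h2 : |s - t| ^ H ≤ κ k ^ (θ - H) * |s - t| ^ θ := by
      have h3 : (κ k * |s - t|) ^ H ≤ (κ k * |s - t|) ^ θ := by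
        rcases (abs_nonneg (s - t)).eq_or_lt' with h0 | h0
        · rw [h0, mul_zero, Real.zero_rpow hH.1.ne']
          exact Real.rpow_nonneg le_rfl _
        · exact Real.rpow_le_rpow_of_exponent_ge (by positivity) h hθH
      rw [Real.mul_rpow hk.le (abs_nonneg _), Real.mul_rpow hk.le (abs_nonneg _)] at h3
      rw [Real.rpow_sub hk, div_mul_eq_mul_div, le_div_iff₀ (by positivity)]
      linarith
    nlinarith [mul_nonneg hG.le hp]
  · have hn : ∀ t, ‖hβ.ou κ k t‖ ≤ Real.Gamma (H + 1) * κ k ^ (-H) := fun t => (hβ.isFBMCurve k).norm_ouVec_le hH.1 hk t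
    have h1 : ‖hβ.ou κ k s - hβ.ou κ k t‖ ≤ 2 * (Real.Gamma (H + 1) * κ k ^ (-H)) :=
      (norm_sub_le _ _).trans (by linarith [hn s, hn t])
    have h2 : κ k ^ (-H) ≤ κ k ^ (θ - H) * |s - t| ^ θ := by
      have h3 := Real.one_le_rpow h.le hθ
      rw [Real.mul_rpow hk.le (abs_nonneg _)] at h3
      rw [sub_eq_add_neg, Real.rpow_add hk]
      have := Real.rpow_pos_of_pos hk (-H)
      nlinarith
    nlinarith [mul_le_mul_of_nonneg_left h2 hG.le]

/-- The field `∑ b_k c_k(t) e_k(x)`. -/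
noncomputable def IsFBMFamily.field (hβ : IsFBMFamily H β P) (κ : ModeIndex → ℝ) (b : ModeIndex → ℂ) (p : Torus × ℝ) : Lp ℂ 2 P :=
  hβ.series κ (fun k => b k * mFourier k.1 p.1) p.2

omit [IsProbabilityMeasure P] hH in
theorem Admissible.mul_mFourier {b : ModeIndex → ℂ} (hb : Admissible H κ b) (x : Torus) :
    Admissible H κ fun k => b k * mFourier k.1 x := by
  refine Admissible.of_le hκ hb fun k => ?_
  rw [norm_mul, norm_mFourier_apply, mul_one]

/-- Modes at different indices are orthogonal even at different space-time points, so the squared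
increment is a sum over modes. Each is split into a time increment, summed by `h1`, and a space
increment, summed by `h2`. -/
theorem IsFBMFamily.exists_norm_field_sub_le {b : ModeIndex → ℂ} (hb : Admissible H κ b) {θ : ℝ}
    (hθ : 0 ≤ θ) (hθH : θ ≤ H) (h1 : Summable fun k => ‖b k‖ ^ 2 * κ k ^ (2 * θ - 2 * H))
    (h2 : Summable fun k => ‖b k‖ ^ 2 * κ k ^ (-(2 * H)) * ‖waveVector k‖ ^ (2 * θ)) :
    ∃ C : ℝ, 0 ≤ C ∧ ∀ p q, ‖hβ.field κ b p - hβ.field κ b q‖ ≤ C * dist p q ^ θ := by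
  set G := Real.Gamma (H + 1) with hG
  set K : ℝ := 2 * ((2 * (1 + G)) ^ 2 * (∑' k, ‖b k‖ ^ 2 * κ k ^ (2 * θ - 2 * H)) +
    4 * G ^ 2 * ∑' k, ‖b k‖ ^ 2 * κ k ^ (-(2 * H)) * ‖waveVector k‖ ^ (2 * θ)) with hK
  have hK0 : 0 ≤ K := by
    have e1 : 0 ≤ ∑' k, ‖b k‖ ^ 2 * κ k ^ (2 * θ - 2 * H) := tsum_nonneg fun k =>
      mul_nonneg (sq_nonneg _) (Real.rpow_nonneg (hκ k).le _)
    have e2 : 0 ≤ ∑' k, ‖b k‖ ^ 2 * κ k ^ (-(2 * H)) * ‖waveVector k‖ ^ (2 * θ) := tsum_nonneg fun k =>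
      mul_nonneg (mul_nonneg (sq_nonneg _) (Real.rpow_nonneg (hκ k).le _)) (by positivity)
    positivity
  refine ⟨√K, Real.sqrt_nonneg _, fun p q => ?_⟩
  refine le_of_sq_le_sq ?_ (by positivity)
  rw [mul_pow, Real.sq_sqrt hK0]
  set D := dist p q ^ θ with hD
  have hsum := hβ.hasSum_norm_series_sub hH hκ (hb.mul_mFourier hκ p.1) (hb.mul_mFourier hκ q.1) p.2 q.2
  have hmaj := (((h1.hasSum.mul_left ((2 * (1 + G)) ^ 2)).add (h2.hasSum.mul_left (4 * G ^ 2))).mul_left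
    2).mul_right (D ^ 2)
  refine hasSum_le (fun k => ?_) hsum hmaj
  have ht : ‖hβ.ou κ k p.2 - hβ.ou κ k q.2‖ ^ 2 ≤ (2 * (1 + G)) ^ 2 * κ k ^ (2 * θ - 2 * H) * D ^ 2 := by
    have e := hβ.norm_ou_sub_le hH hκ hθ hθH k p.2 q.2
    have e1 : |p.2 - q.2| ^ θ ≤ D :=
      Real.rpow_le_rpow (abs_nonneg _) (by rw [← Real.dist_eq]; exact le_max_right _ _) hθ
    have e2 : κ k ^ (2 * θ - 2 * H) = (κ k ^ (θ - H)) ^ 2 := by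
      rw [← Real.rpow_natCast, ← Real.rpow_mul (hκ k).le]
      congr 1
      push_cast
      ring
    rw [e2, ← mul_pow, ← mul_pow]
    have hG0 : 0 < G := Real.Gamma_pos_of_pos (by linarith [hH.1])
    refine pow_le_pow_left₀ (norm_nonneg _) (e.trans ?_) 2
    rw [mul_assoc _ _ D]
    exact mul_le_mul_of_nonneg_left
      (mul_le_mul_of_nonneg_left e1 (Real.rpow_nonneg (hκ k).le _)) (by positivity)
  have hx : ‖mFourier k.1 p.1 - mFourier k.1 q.1‖ ^ 2 ≤ 4 * ‖waveVector k‖ ^ (2 * θ) * D ^ 2 := by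
    have e := norm_mFourier_sub_le_rpow k p.1 q.1 hθ (hθH.trans hH.2.le)
    have e1 : dist p.1 q.1 ^ θ ≤ D := Real.rpow_le_rpow dist_nonneg (le_max_left _ _) hθ
    have e2 : ‖waveVector k‖ ^ (2 * θ) = (‖waveVector k‖ ^ θ) ^ 2 := by
      rw [← Real.rpow_natCast, ← Real.rpow_mul (norm_nonneg _)]
      congr 1
      push_cast
      ring
    have e3 : (4 : ℝ) * ‖waveVector k‖ ^ (2 * θ) * D ^ 2 = (2 * (‖waveVector k‖ ^ θ * D)) ^ 2 := by
      rw [e2]; ring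
    rw [e3]
    refine pow_le_pow_left₀ (norm_nonneg _) (e.trans ?_) 2
    gcongr
  have hsplit : (b k * mFourier k.1 p.1) • hβ.ou κ k p.2 - (b k * mFourier k.1 q.1) • hβ.ou κ k q.2 =
      (b k * mFourier k.1 p.1) • (hβ.ou κ k p.2 - hβ.ou κ k q.2) +
        (b k * (mFourier k.1 p.1 - mFourier k.1 q.1)) • hβ.ou κ k q.2 := by
    rw [smul_sub, mul_sub, sub_smul]
    abel
  rw [hsplit]
  refine (norm_add_sq_le _ _).trans ?_
  rw [norm_smul, norm_smul, norm_mul, norm_mul, norm_mFourier_apply, mul_one, mul_pow, mul_pow, mul_pow]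
  have hou := hβ.norm_ou_sq_le hH hκ k q.2
  have hb2 := sq_nonneg ‖b k‖
  have t1 := mul_le_mul_of_nonneg_left ht hb2
  have t2 := mul_le_mul_of_nonneg_left (mul_le_mul hx hou (sq_nonneg _) ((sq_nonneg _).trans hx)) hb2
  calc 2 * (‖b k‖ ^ 2 * ‖hβ.ou κ k p.2 - hβ.ou κ k q.2‖ ^ 2 +
        ‖b k‖ ^ 2 * ‖mFourier k.1 p.1 - mFourier k.1 q.1‖ ^ 2 * ‖hβ.ou κ k q.2‖ ^ 2)
      ≤ 2 * (‖b k‖ ^ 2 * ((2 * (1 + G)) ^ 2 * κ k ^ (2 * θ - 2 * H) * D ^ 2) +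
        ‖b k‖ ^ 2 * (4 * ‖waveVector k‖ ^ (2 * θ) * D ^ 2 * (G ^ 2 * κ k ^ (-(2 * H))))) := by
        rw [mul_assoc (‖b k‖ ^ 2) (‖mFourier k.1 p.1 - mFourier k.1 q.1‖ ^ 2)]
        linarith
    _ = _ := by ring

end

end FracField

namespace FracField

/-! ### Fourier coefficients of the random field. -/

section coefficients

local notation "⟪" x ", " y "⟫" => inner ℂ x y

theorem mFourierCoeff_eq_integral_mul (f : Torus → ℂ) (n : Fin 2 → ℤ) :
    mFourierCoeff f n = ∫ x, mFourier (-n) x * f x ∂torusMeasure := rfl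

theorem mFourierCoeff_mFourier (l n : Fin 2 → ℤ) :
    mFourierCoeff (fun x => mFourier l x) n = if n = l then 1 else 0 := by
  have h1 : mFourierCoeff (monomial l) n = mFourierCoeff (fun x => mFourier l x) n := by
    rw [mFourierCoeff_eq_integral_mul, mFourierCoeff_eq_integral_mul]
    refine integral_congr_ae ?_
    filter_upwards [ContinuousMap.coeFn_toLp (p := 2) (𝕜 := ℂ) torusMeasure (mFourier l)] with x hx
    exact congrArg (mFourier (-n) x * ·) hx
  rw [← h1, mFourierCoeff_eq_inner]
  exact orthonormal_iff_ite.1 orthonormal_monomial n l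

theorem integrable_torus {E : Type*} [NormedAddCommGroup E] {f : Torus → E} (hf : Continuous f) :
    Integrable f torusMeasure := hf.integrable_of_hasCompactSupport (HasCompactSupport.of_compactSpace f)

theorem mFourierCoeff_add {f g : Torus → ℂ} (hf : Continuous f) (hg : Continuous g)
    (n : Fin 2 → ℤ) :
    mFourierCoeff (fun x => f x + g x) n = mFourierCoeff f n + mFourierCoeff g n := by
  simp only [mFourierCoeff_eq_integral_mul, mul_add]
  exact integral_add (integrable_torus (by fun_prop)) (integrable_torus (by fun_prop))

theorem mFourierCoeff_sum_mul {ι : Type*} (F : Finset ι) (z : ι → ℂ) (l : ι → Fin 2 → ℤ)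
    (n : Fin 2 → ℤ) :
    mFourierCoeff (fun x => ∑ i ∈ F, z i * mFourier (l i) x) n =
      ∑ i ∈ F, z i * if n = l i then 1 else 0 := by
  rw [mFourierCoeff_eq_integral_mul]
  simp only [Finset.mul_sum]
  rw [integral_finsetSum _ fun i _ => integrable_torus (by fun_prop)]
  refine Finset.sum_congr rfl fun i _ => ?_
  rw [← mFourierCoeff_mFourier, mFourierCoeff_eq_integral_mul, ← integral_const_mul]
  refine integral_congr_ae (Eventually.of_forall fun x => ?_)
  ring

theorem mFourierCoeff_re_sum (F : Finset ModeIndex) (z : ModeIndex → ℂ) (n : Fin 2 → ℤ) :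
    mFourierCoeff (fun x => (((∑ l ∈ F, z l * mFourier l.1 x).re : ℝ) : ℂ)) n =
      ∑ l ∈ F, (2⁻¹ * z l) * (if n = l.1 then 1 else 0) +
        ∑ l ∈ F, (2⁻¹ * conj (z l)) * (if n = -l.1 then 1 else 0) := by
  rw [← mFourierCoeff_sum_mul, ← mFourierCoeff_sum_mul F _ fun l => -l.1,
    ← mFourierCoeff_add (by fun_prop) (by fun_prop)]
  congr 1
  funext x
  simp only [mul_assoc, ← Finset.mul_sum, mFourier_neg, ← map_mul, ← map_sum]
  rw [← mul_add, Complex.add_conj]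
  push_cast
  ring

theorem mFourierCoeff_re_sum_zero (F : Finset ModeIndex) (z : ModeIndex → ℂ) :
    mFourierCoeff (fun x => (((∑ l ∈ F, z l * mFourier l.1 x).re : ℝ) : ℂ)) 0 = 0 := by
  rw [mFourierCoeff_re_sum, Finset.sum_eq_zero, Finset.sum_eq_zero, add_zero]
  · intro l _
    rw [if_neg (neg_ne_zero.2 l.2).symm, mul_zero]
  · intro l _
    rw [if_neg (Ne.symm l.2), mul_zero]

theorem mFourierCoeff_re_sum_of_mem {F : Finset ModeIndex} {z : ModeIndex → ℂ} {k : ModeIndex}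
    (hk : k ∈ F) (hk' : -k ∈ F) (hz : z (-k) = conj (z k)) :
    mFourierCoeff (fun x => (((∑ l ∈ F, z l * mFourier l.1 x).re : ℝ) : ℂ)) k.1 = z k := by
  rw [mFourierCoeff_re_sum, Finset.sum_eq_single_of_mem k hk, Finset.sum_eq_single_of_mem (-k) hk']
  · have h1 : k.1 = -(-k : ModeIndex).1 := (neg_neg k.1).symm
    rw [if_pos rfl, if_pos h1, hz, Complex.conj_conj]
    ring
  · intro l _ hl
    rw [if_neg, mul_zero]
    intro h
    refine hl (Subtype.ext ?_)
    change l.1 = -k.1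
    rw [h, neg_neg]
  · intro l _ hl
    rw [if_neg, mul_zero]
    exact fun h => hl (Subtype.ext h.symm)

theorem enorm_mFourierCoeff_sub_le {f g : Torus → ℝ} (hf : Continuous f) (hg : Continuous g)
    (n : Fin 2 → ℤ) :
    ‖mFourierCoeff (fun x => (f x : ℂ)) n - mFourierCoeff (fun x => (g x : ℂ)) n‖ₑ ≤
      ∫⁻ x, ‖f x - g x‖ₑ ∂torusMeasure := by
  simp only [mFourierCoeff_eq_integral_mul]
  rw [← integral_sub (integrable_torus (by fun_prop)) (integrable_torus (by fun_prop))]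
  refine (enorm_integral_le_lintegral_enorm _).trans (lintegral_mono fun x => ?_)
  have hn : ‖mFourier (-n) x‖ₑ = 1 := by
    rw [← ofReal_norm, norm_mFourier_apply, ENNReal.ofReal_one]
  rw [← mul_sub, enorm_mul, ← Complex.ofReal_sub, hn, one_mul, ← ofReal_norm, Complex.norm_real,
    ofReal_norm]

end coefficients

section field

variable {Ω : Type*} [MeasurableSpace Ω] {P : Measure Ω} [IsProbabilityMeasure P] {H : ℝ}
  {β β' : ModeIndex → ℝ → Ω → ℂ} {κ : ModeIndex → ℝ} {b : ModeIndex → ℂ}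
  (hr : IsRegularVersion P β β') (hβ : IsFBMFamily H β P)
  (hH : H ∈ Ioo (0 : ℝ) 1) (hκ : ∀ k, 0 < κ k) (hb : Admissible H κ b)

include hH hκ hb in
/-- The tails of the field are small, uniformly in space. -/
theorem IsFBMFamily.tendsto_norm_field_sub_sum (t : ℝ) : ∃ τ : Finset ModeIndex → ℝ,
    Tendsto τ atTop (𝓝 0) ∧ ∀ F x,
      ‖hβ.field κ b (x, t) - ∑ k ∈ F, (b k * mFourier k.1 x) • hβ.ou κ k t‖ ≤ τ F := by
  classical
  set f : ModeIndex → ℝ := fun k => ‖b k • hβ.ou κ k t‖ ^ 2 with hf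
  refine ⟨fun F => √(∑' k : {k // k ∉ F}, f k), ?_, fun F x => ?_⟩
  · have h := (Real.continuous_sqrt.tendsto _).comp (tendsto_tsum_compl_atTop_zero f)
    rwa [Real.sqrt_zero] at h
  · refine Real.le_sqrt_of_sq_le (le_of_eq ?_)
    set w : ModeIndex → ℂ := fun k => b k * mFourier k.1 x with hw
    have hwa : Admissible H κ w := hb.mul_mFourier hκ x
    set w' : ModeIndex → ℂ := fun k => if k ∈ F then w k else 0 with hw'
    have hwa' : Admissible H κ w' := by
      refine Admissible.of_le hκ hwa fun k => ?_
      have := Real.rpow_nonneg (hκ k).le (-(2 * H))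
      have h1 : ‖w' k‖ ≤ ‖w k‖ := by
        simp only [hw']
        split_ifs
        · exact le_rfl
        · simp
      gcongr
    have hS : hβ.series κ w' t = ∑ k ∈ F, w k • hβ.ou κ k t := by
      rw [IsFBMFamily.series, tsum_eq_sum (s := F)]
      · exact Finset.sum_congr rfl fun k hk => by simp [hw', hk]
      · intro k hk
        simp [hw', hk]
    have h1 := (hβ.hasSum_norm_series_sub hH hκ hwa hwa' t t).tsum_eq
    rw [hS] at h1
    refine h1.symm.trans (Eq.trans (tsum_congr fun k => ?_) (tsum_subtype {k | k ∉ F} f).symm)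
    by_cases hk : k ∈ F
    · simp [hw', hk]
    · simp only [hw', hk, if_false, zero_smul, sub_zero]
      rw [indicator_of_mem (by exact hk)]
      simp only [hf, hw, norm_smul, norm_mul, norm_mFourier_apply, mul_one]

include hr hH hκ hb in
-- At each point Z agrees with the field only up to a null set depending on the point, so
-- coefficients are compared in the mean over Ω: the real parts of the finite sums converge to Z in
-- L¹ of torus times Ω, and each of their Fourier coefficients is eventually constant in the finite
-- set.
theorem IsRegularVersion.mFourierCoeff_field_ae_eq (hκs : ∀ k, κ (-k) = κ k)
    (hbs : ∀ k, b (-k) = conj (b k)) {Z : Torus × ℝ → Ω → ℝ} (hZ : ∀ p, Measurable (Z p))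
    (hZY : ∀ p, Z p =ᵐ[P] fun ω => (hβ.field κ b p ω).re) (hZc : ∀ ω, Continuous fun p => Z p ω)
    (t : ℝ) : ∀ᵐ ω ∂P, mFourierCoeff (fun x => (Z (x, t) ω : ℂ)) 0 = 0 ∧
      ∀ k : ModeIndex, mFourierCoeff (fun x => (Z (x, t) ω : ℂ)) k.1 = b k * ouPath κ β' k t ω := by
  classical
  set z : ModeIndex → Ω → ℂ := fun k ω => b k * ouPath κ β' k t ω with hz
  have hzs : ∀ k ω, z (-k) ω = conj (z k ω) := fun k ω => by
    simp only [hz, ouPath]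
    rw [hbs, hκs, hr.pathOU_conj, map_mul]
  obtain ⟨τ, hτ, hτF⟩ := hβ.tendsto_norm_field_sub_sum hH hκ hb t
  have hZm : Measurable fun q : Torus × Ω => Z (q.1, t) q.2 := by
    have hc : ∀ ω, Continuous fun x : Torus => Z (x, t) ω := fun ω => (hZc ω).comp (by fun_prop)
    exact measurable_uncurry_of_continuous_of_measurable (u := fun x ω => Z (x, t) ω) hc fun x => hZ _
  have hzm : ∀ k, Measurable (z k) := fun k => (hr.measurable_ouPath_apply k t).const_mul _
  have hSm : ∀ F : Finset ModeIndex, Measurable fun q : Torus × Ω =>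
      (∑ k ∈ F, z k q.2 * mFourier k.1 q.1).re := fun F => by
    refine Complex.measurable_re.comp (Finset.measurable_fun_sum _ fun k _ => ?_)
    exact ((hzm k).comp measurable_snd).mul ((mFourier k.1).continuous.measurable.comp measurable_fst)
  have hbound : ∀ F : Finset ModeIndex, ∫⁻ ω, ∫⁻ x,
      ‖Z (x, t) ω - (∑ k ∈ F, z k ω * mFourier k.1 x).re‖ₑ ∂torusMeasure ∂P ≤ ENNReal.ofReal (τ F) :=
    fun F => by
      have hm : Measurable fun q : Ω × Torus =>
          ‖Z (q.2, t) q.1 - (∑ k ∈ F, z k q.1 * mFourier k.1 q.2).re‖ₑ :=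
        (hZm.sub (hSm F)).enorm.comp measurable_swap
      rw [lintegral_lintegral_swap hm.aemeasurable]
      calc _ ≤ ∫⁻ _ : Torus, ENNReal.ofReal (τ F) ∂torusMeasure := lintegral_mono fun x => ?_
        _ = _ := by rw [lintegral_const, measure_univ, mul_one]
      refine le_trans ?_ ((lintegral_enorm_le_ofReal_norm _).trans (ENNReal.ofReal_le_ofReal (hτF F x)))
      refine lintegral_mono_ae ?_
      filter_upwards [hZY (x, t), Lp.coeFn_sub (hβ.field κ b (x, t))
          (∑ k ∈ F, (b k * mFourier k.1 x) • hβ.ou κ k t),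
        Lp.coeFn_finsetSum F (fun k => (b k * mFourier k.1 x) • hβ.ou κ k t),
        ae_all_iff.2 fun k => hr.smul_ou_ae_eq hβ hH hκ (fun k => b k * mFourier k.1 x) k t]
        with ω h1 h2 h3 h4
      rw [h2, Pi.sub_apply, h3, h1, enorm_le_iff_norm_le]
      have e : ∑ k ∈ F, ((b k * mFourier k.1 x) • hβ.ou κ k t : Lp ℂ 2 P) ω =
          ∑ k ∈ F, z k ω * mFourier k.1 x := Finset.sum_congr rfl fun k _ => by
        rw [h4]; simp only [hz]; ring
      rw [Finset.sum_apply, e, ← Complex.sub_re]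
      exact Complex.abs_re_le_norm _
  have hmain : ∀ (n : Fin 2 → ℤ) (g : Ω → ℂ),
      (∀ᶠ F in atTop, ∀ ω, mFourierCoeff (fun x => (((∑ l ∈ F, z l ω * mFourier l.1 x).re : ℝ) : ℂ)) n = g ω) →
      ∀ᵐ ω ∂P, mFourierCoeff (fun x => (Z (x, t) ω : ℂ)) n = g ω := fun n g hg => by
    have hgm : Measurable g := by
      obtain ⟨F, hF⟩ := hg.exists
      have : g = fun ω => ∫ x, mFourier (-n) x * (((∑ l ∈ F, z l ω * mFourier l.1 x).re : ℝ) : ℂ)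
          ∂torusMeasure := funext fun ω => (hF ω).symm
      rw [this]
      refine StronglyMeasurable.measurable (StronglyMeasurable.integral_prod_left'
        (μ := torusMeasure) (f := fun q : Torus × Ω => mFourier (-n) q.1 * (((∑ l ∈ F, z l q.2 * mFourier l.1 q.1).re : ℝ) : ℂ)) ?_)
      exact (((mFourier (-n)).continuous.measurable.comp measurable_fst).mul
        (Complex.measurable_ofReal.comp (hSm F))).stronglyMeasurable
    have hcm : Measurable fun ω => mFourierCoeff (fun x => (Z (x, t) ω : ℂ)) n := by
      refine StronglyMeasurable.measurable (StronglyMeasurable.integral_prod_left'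
        (μ := torusMeasure) (f := fun q : Torus × Ω => mFourier (-n) q.1 * (Z (q.1, t) q.2 : ℂ)) ?_)
      exact (((mFourier (-n)).continuous.measurable.comp measurable_fst).mul
        (Complex.measurable_ofReal.comp hZm)).stronglyMeasurable
    have h0 : ∫⁻ ω, ‖mFourierCoeff (fun x => (Z (x, t) ω : ℂ)) n - g ω‖ₑ ∂P = 0 := by
      refine le_antisymm ?_ zero_le
      have hlim := (ENNReal.continuous_ofReal.tendsto _).comp hτ
      rw [ENNReal.ofReal_zero] at hlim
      refine ge_of_tendsto hlim ?_
      filter_upwards [hg] with F hF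
      refine le_trans (lintegral_mono fun ω => ?_) (hbound F)
      rw [← hF ω]
      exact enorm_mFourierCoeff_sub_le ((hZc ω).comp (by fun_prop)) (by fun_prop) n
    have hm : Measurable fun ω => ‖mFourierCoeff (fun x => (Z (x, t) ω : ℂ)) n - g ω‖ₑ :=
      (hcm.sub hgm).enorm
    rw [lintegral_eq_zero_iff hm] at h0
    filter_upwards [h0] with ω hω
    rwa [Pi.zero_apply, enorm_eq_zero, sub_eq_zero] at hω
  refine (hmain 0 0 (Eventually.of_forall fun F ω => mFourierCoeff_re_sum_zero F _)).and
    (ae_all_iff.2 fun k => hmain k.1 (z k) ?_)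
  -- Taking the real part halves the coefficient at k and adds half the conjugate of the one at -k;
  -- both modes must be present for the symmetric coefficients to recombine.
  filter_upwards [eventually_ge_atTop ({k, -k} : Finset ModeIndex)] with F hF ω
  exact mFourierCoeff_re_sum_of_mem (z := fun l => z l ω) (hF (by simp)) (hF (by simp)) (hzs k ω)

end field

end FracField

namespace FracField

/-! ### Summability of the differentiated coefficients. -/

section

variable {H ν : ℝ} {α lam : ModeIndex → ℝ}

/-- The Fourier multiplier of `D^δ`. -/
noncomputable def derivSymbol (δ : Fin 2 → ℕ) (k : ModeIndex) : ℂ :=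
  ∏ j : Fin 2, (2 * Real.pi * Complex.I * (k.1 j : ℂ)) ^ δ j

theorem derivSymbol_neg (δ : Fin 2 → ℕ) (k : ModeIndex) :
    derivSymbol δ (-k) = conj (derivSymbol δ k) := by
  rw [derivSymbol, derivSymbol, map_prod]
  refine Finset.prod_congr rfl fun j _ => ?_
  have h : (((-k : ModeIndex).1 j : ℤ) : ℂ) = -(k.1 j : ℂ) := by
    change (((-k.1) j : ℤ) : ℂ) = _
    rw [Pi.neg_apply]
    push_cast
    rfl
  rw [h, map_pow]
  congr 1
  simp only [map_mul, Complex.conj_ofReal, Complex.conj_I, map_intCast, map_ofNat]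
  ring

theorem norm_derivSymbol_le {δ : Fin 2 → ℕ} {m : ℕ} (hδ : δ 0 + δ 1 ≤ m) (k : ModeIndex) :
    ‖derivSymbol δ k‖ ≤ ‖waveVector k‖ ^ m := by
  have hj : ∀ j, ‖(2 * Real.pi * Complex.I * (k.1 j : ℂ))‖ ≤ ‖waveVector k‖ := fun j => by
    refine le_trans (le_of_eq ?_) (two_pi_abs_le_norm_waveVector k j)
    rw [norm_mul, norm_mul, Complex.norm_I, mul_one, norm_mul, Complex.norm_real, Complex.norm_intCast,
      Real.norm_eq_abs, abs_of_pos Real.pi_pos]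
    norm_num
  refine le_trans ?_ (pow_le_pow_right₀ (one_le_norm_waveVector k) hδ)
  rw [derivSymbol, Fin.prod_univ_two, norm_mul, norm_pow, norm_pow, pow_add]
  exact mul_le_mul (pow_le_pow_left₀ (norm_nonneg _) (hj 0) _)
    (pow_le_pow_left₀ (norm_nonneg _) (hj 1) _) (by positivity) (by positivity)

theorem coeff_sq (hν : 0 < ν) (hlam : ∀ k, 0 ≤ lam k) (k : ModeIndex) :
    ‖(coeff H ν lam k : ℂ)‖ ^ 2 = lam k * ν ^ (2 * H) := by
  rw [Complex.norm_real, Real.norm_eq_abs, sq_abs, coeff, mul_pow, Real.sq_sqrt (hlam k),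
    ← Real.rpow_natCast, ← Real.rpow_mul hν.le]
  congr 2
  push_cast
  ring

variable (hν : 0 < ν) {c : ℝ} (hc : 0 < c) (hα : ∀ k, c ≤ α k) (hlam : ∀ k, 0 ≤ lam k) {m : ℕ}
  {γ θ : ℝ} (hθ : 0 ≤ θ) (hθγ : θ ≤ γ) {D : ModeIndex → ℂ} (hD : ∀ k, ‖D k‖ ≤ ‖waveVector k‖ ^ m)

include hν hc hα hlam hD

theorem norm_mul_coeff_sq_mul_le (k : ModeIndex) (s : ℝ) :
    ‖D k * coeff H ν lam k‖ ^ 2 * rate ν α k ^ s ≤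
      (ν ^ (2 * H) * ν ^ s) * (lam k * α k ^ s * ‖waveVector k‖ ^ (2 * m)) := by
  have hk : 0 < α k := hc.trans_le (hα k)
  have h1 : ‖D k‖ ^ 2 ≤ ‖waveVector k‖ ^ (2 * m) := by
    rw [mul_comm 2 m, pow_mul]
    exact pow_le_pow_left₀ (norm_nonneg _) (hD k) 2
  rw [norm_mul, mul_pow, coeff_sq hν hlam, rate, Real.mul_rpow hν.le hk.le]
  have h2 : 0 ≤ lam k * ν ^ (2 * H) * (ν ^ s * α k ^ s) := by
    have := hlam k
    positivity
  nlinarith [mul_le_mul_of_nonneg_right h1 h2]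

include hθγ in
-- Lowering γ to θ costs the constant c^{2θ-2γ}, finite because the α_k are bounded below by c > 0.
theorem summable_time (hs : Summable fun k : ModeIndex =>
      lam k * α k ^ (2 * γ - 2 * H) * ‖waveVector k‖ ^ (2 * m)) :
    Summable fun k => ‖D k * coeff H ν lam k‖ ^ 2 * rate ν α k ^ (2 * θ - 2 * H) := by
  refine (hs.mul_left (ν ^ (2 * H) * ν ^ (2 * θ - 2 * H) * c ^ (2 * θ - 2 * γ))).of_nonneg_of_le
    (fun k => mul_nonneg (sq_nonneg _) (Real.rpow_nonneg (mul_pos hν (hc.trans_le (hα k))).le _))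
    fun k => (norm_mul_coeff_sq_mul_le hν hc hα hlam hD k _).trans ?_
  have hk : 0 < α k := hc.trans_le (hα k)
  have h1 : α k ^ (2 * θ - 2 * H) ≤ c ^ (2 * θ - 2 * γ) * α k ^ (2 * γ - 2 * H) := by
    have e : 2 * θ - 2 * H = (2 * θ - 2 * γ) + (2 * γ - 2 * H) := by ring
    rw [e, Real.rpow_add hk]
    exact mul_le_mul_of_nonneg_right
      (Real.rpow_le_rpow_of_nonpos hc (hα k) (by linarith)) (Real.rpow_nonneg hk.le _)
  rw [mul_assoc (ν ^ (2 * H) * ν ^ (2 * θ - 2 * H)) (c ^ _)]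
  refine mul_le_mul_of_nonneg_left ?_ (by positivity)
  have := hlam k
  calc lam k * α k ^ (2 * θ - 2 * H) * ‖waveVector k‖ ^ (2 * m)
      ≤ lam k * (c ^ (2 * θ - 2 * γ) * α k ^ (2 * γ - 2 * H)) * ‖waveVector k‖ ^ (2 * m) := by gcongr
    _ = _ := by ring

include hθγ in
theorem summable_space (hs : Summable fun k : ModeIndex =>
      lam k * α k ^ (-(2 * H)) * ‖waveVector k‖ ^ (2 * (m : ℝ) + 2 * γ)) :
    Summable fun k => ‖D k * coeff H ν lam k‖ ^ 2 * rate ν α k ^ (-(2 * H)) *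
      ‖waveVector k‖ ^ (2 * θ) := by
  refine (hs.mul_left (ν ^ (2 * H) * ν ^ (-(2 * H)))).of_nonneg_of_le
    (fun k => mul_nonneg (mul_nonneg (sq_nonneg _)
      (Real.rpow_nonneg (mul_pos hν (hc.trans_le (hα k))).le _)) (by positivity))
    fun k => ?_
  have hk : 0 < α k := hc.trans_le (hα k)
  have hw := one_le_norm_waveVector k
  have hw0 : 0 < ‖waveVector k‖ := one_pos.trans_le hw
  refine (mul_le_mul_of_nonneg_right (norm_mul_coeff_sq_mul_le hν hc hα hlam hD k _)
    (by positivity)).trans ?_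
  rw [mul_assoc]
  refine mul_le_mul_of_nonneg_left ?_ (by positivity)
  rw [mul_assoc]
  refine mul_le_mul_of_nonneg_left ?_ (mul_nonneg (hlam k) (Real.rpow_nonneg hk.le _))
  rw [← Real.rpow_natCast, ← Real.rpow_add hw0]
  refine Real.rpow_le_rpow_of_exponent_le hw ?_
  push_cast
  linarith

include hθ hθγ in
-- Since |k| ≥ 1, the spatial summability already dominates the series without the extra power of
-- |k|.
theorem admissible_mul_coeff (hs : Summable fun k : ModeIndex =>
      lam k * α k ^ (-(2 * H)) * ‖waveVector k‖ ^ (2 * (m : ℝ) + 2 * γ)) :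
    Admissible H (rate ν α) fun k => D k * coeff H ν lam k := by
  refine Admissible.of_le (fun k => mul_pos hν (hc.trans_le (hα k)))
    (summable_space hν hc hα hlam hθγ hD hs) fun k => ?_
  refine le_mul_of_one_le_right (mul_nonneg (sq_nonneg _)
    (Real.rpow_nonneg (mul_pos hν (hc.trans_le (hα k))).le _)) ?_
  exact Real.one_le_rpow (one_le_norm_waveVector k) (by linarith)

end

/-! ### Assembly. -/

section

variable {Ω : Type*} [MeasurableSpace Ω] {P : Measure Ω} [IsProbabilityMeasure P] {H ν : ℝ}
  {β β' : ModeIndex → ℝ → Ω → ℂ} {α lam : ModeIndex → ℝ}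
  (hr : IsRegularVersion P β β') (hβ : IsFBMFamily H β P) (hH : H ∈ Ioo (0 : ℝ) 1)

include hr hβ hH

theorem IsRegularVersion.isUniqueErgodicMildSolution (hν : 0 < ν) {c : ℝ} (hc : 0 < c)
    (hα : ∀ k, c ≤ α k) (hαs : ∀ k, α (-k) = α k) (hlam : BddAbove (range lam))
    (ha : Admissible H (rate ν α) fun k => (coeff H ν lam k : ℂ)) :
    IsUniqueErgodicMildSolution H ν α lam β P
      fun t : ℝ≥0 => solution (rate ν α) (coeff H ν lam) β' t := by
  have hα0 : ∀ k, 0 < α k := fun k => hc.trans_le (hα k)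
  have hκ : ∀ k, 0 < rate ν α k := fun k => mul_pos hν (hα0 k)
  have hκs : ∀ k, rate ν α (-k) = rate ν α k := fun k => by rw [rate, rate, hαs]
  obtain ⟨B, hB⟩ := hlam
  have hA : ∀ k, |coeff H ν lam k| ≤ √B * ν ^ H := fun k => by
    rw [coeff, abs_of_nonneg (by positivity)]
    gcongr
    exact hB (mem_range_self k)
  exact ⟨hr.isMildSolution hβ hH hν hα0 ha, hr.isStrictlyStationary hβ hH hκ ha hκs,
    hr.isAdaptedTo hβ hH hκ, hr.isErgodic hβ hH hκ ha hκs (mul_pos hν hc)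
      (fun k => mul_le_mul_of_nonneg_left (hα k) hν.le) hA,
    fun φ' hm hs _ n t => hr.fdd_eq hβ hH hν hα0 ha hc hα hαs hm hs t⟩

theorem IsRegularVersion.exists_isVersionOfDeriv {κ a : ModeIndex → ℝ} (hκ : ∀ k, 0 < κ k)
    (hκs : ∀ k, κ (-k) = κ k) (ha : Admissible H κ fun k => (a k : ℂ)) (has : ∀ k, a (-k) = a k)
    (δ : Fin 2 → ℕ) (hb : Admissible H κ fun k => derivSymbol δ k * a k) {θ : ℝ} (hθ : 0 < θ)
    (hθH : θ ≤ H)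
    (h1 : Summable fun k => ‖derivSymbol δ k * a k‖ ^ 2 * κ k ^ (2 * θ - 2 * H))
    (h2 : Summable fun k => ‖derivSymbol δ k * a k‖ ^ 2 * κ k ^ (-(2 * H)) * ‖waveVector k‖ ^ (2 * θ)) :
    ∃ Z : Torus × ℝ → Ω → ℝ, IsVersionOfDeriv δ P (solution κ a β') Z ∧
      ∀ᵐ ω ∂P, ∀ ε : ℝ≥0, 0 < ε → (ε : ℝ) < θ → ∀ T : ℝ, 0 < T →
        ∃ C : ℝ≥0, HolderOnWith C ε (fun p => Z p ω) (univ ×ˢ Icc (-T) T) := by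
  obtain ⟨C, hC, hfield⟩ := hβ.exists_norm_field_sub_le hH hκ hb hθ.le hθH h1 h2
  have hY : ∀ p, Measurable fun ω => (hβ.field κ (fun k => derivSymbol δ k * a k) p ω).re := fun p =>
    Complex.measurable_re.comp (Lp.stronglyMeasurable _).measurable
  obtain ⟨Z, hZm, hZY, hZc, hZh⟩ := exists_holder_version hY hθ
    (hβ.hasMomentBound (fun p => hβ.series_mem _ _) (fun p => EventuallyEq.rfl) hC hfield)
  refine ⟨Z, ⟨hZm, fun t => Eventually.of_forall fun ω =>
    integrable_torus ((hZc ω).comp (by fun_prop)), fun t => ?_⟩, hZh⟩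
  filter_upwards [hr.mFourierCoeff_field_ae_eq hβ hH hκ hb hκs
    (fun k => by rw [derivSymbol_neg, has, map_mul, Complex.conj_ofReal]) hZm hZY hZc t,
    hr.inner_e_solution hβ hH hκ ha t] with ω h1 h2 n
  by_cases hn : n = 0
  · rw [hn, h1.1, (mem_meanZero_iff _).1 (solution κ a β' t ω).2, mul_zero]
  · have h3 := h1.2 ⟨n, hn⟩
    rw [mul_assoc, ← h2, inner_e] at h3
    exact h3

end

end FracField

theorem mainTheorem3 {Ω : Type*} [MeasurableSpace Ω] (P : Measure Ω) [IsProbabilityMeasure P]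
    (H ν : ℝ) (hH : H ∈ Ioo (0 : ℝ) 1) (hν : 0 < ν)
    (α lam : FracField.ModeIndex → ℝ)
    (hα_pos : ∃ c > 0, ∀ k, c ≤ α k) (hα_symm : ∀ k, α (-k) = α k)
    (hα_lim : Tendsto α cofinite atTop)
    (hlam_nonneg : ∀ k, 0 ≤ lam k) (hlam_symm : ∀ k, lam (-k) = lam k)
    (hlam_bdd : BddAbove (range lam))
    (β : FracField.ModeIndex → ℝ → Ω → ℂ) (hβ : FracField.IsFBMFamily H β P)
    (m : ℕ) (γ : ℝ) (hγ : γ ∈ Ioo (0 : ℝ) 1)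
    (hsum₁ : Summable fun k : FracField.ModeIndex =>
      lam k * α k ^ (2 * γ - 2 * H) * ‖FracField.waveVector k‖ ^ (2 * m))
    (hsum₂ : Summable fun k : FracField.ModeIndex =>
      lam k * α k ^ (-(2 * H)) * ‖FracField.waveVector k‖ ^ (2 * (m : ℝ) + 2 * γ)) :
    ∃ ψ : ℝ → Ω → FracField.V,
      (Measurable fun p : ℝ × Ω => ψ p.1 p.2) ∧
      FracField.IsFOUSeries H ν α lam β P ψ ∧
      FracField.IsUniqueErgodicMildSolution H ν α lam β P (fun t : ℝ≥0 => ψ t) ∧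
      ∀ δ : Fin 2 → ℕ, δ 0 + δ 1 ≤ m →
        ∃ Z : FracField.Torus × ℝ → Ω → ℝ,
          FracField.IsVersionOfDeriv δ P ψ Z ∧
          ∀ᵐ ω ∂P, ∀ ε : ℝ≥0, 0 < ε → (ε : ℝ) < min γ H → ∀ T : ℝ, 0 < T →
            ∃ C : ℝ≥0, HolderOnWith C ε (fun p => Z p ω) (univ ×ˢ Icc (-T) T) := by
  obtain ⟨c, hc, hα⟩ := hα_pos
  obtain ⟨β', hr⟩ := hβ.exists_regularVersion hH
  have hα0 : ∀ k, 0 < α k := fun k => hc.trans_le (hα k)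
  have hκ : ∀ k, 0 < FracField.rate ν α k := fun k => mul_pos hν (hα0 k)
  have hθ : 0 < min γ H := lt_min hγ.1 hH.1
  -- The undifferentiated coefficients are the case of the multiplier 1, which is below |k|^m
  -- because |k| ≥ 1.
  have ha : FracField.Admissible H (FracField.rate ν α) fun k => (FracField.coeff H ν lam k : ℂ) := by
    have h := FracField.admissible_mul_coeff (D := fun _ => 1) hν hc hα hlam_nonneg hθ.le
      (min_le_left γ H)
      (fun k => by rw [norm_one]; exact one_le_pow₀ (FracField.one_le_norm_waveVector k)) hsum₂
    simpa only [one_mul] using h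
  refine ⟨FracField.solution (FracField.rate ν α) (FracField.coeff H ν lam) β',
    hr.measurable_solution, hr.isFOUSeries hβ hH hν hα0 ha,
    hr.isUniqueErgodicMildSolution hβ hH hν hc hα hα_symm hlam_bdd ha, fun δ hδ => ?_⟩
  have hD := FracField.norm_derivSymbol_le hδ
  exact hr.exists_isVersionOfDeriv hβ hH hκ (fun k => by rw [FracField.rate, FracField.rate, hα_symm])
    ha (fun k => by rw [FracField.coeff, FracField.coeff, hlam_symm]) δ
    (FracField.admissible_mul_coeff hν hc hα hlam_nonneg hθ.le (min_le_left γ H) hD hsum₂) hθ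
    (min_le_right γ H)
    (FracField.summable_time hν hc hα hlam_nonneg (min_le_left γ H) hD hsum₁)
    (FracField.summable_space hν hc hα hlam_nonneg (min_le_left γ H) hD hsum₂)
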